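/- **Setting.** Let $E$ be the set of càdlàg functions $u:\mathbb R\to\mathbb R$ and $\mathcal C'(E)$ the smallest $\sigma$-algebra on $E$ making all maps $u\mapsto u(x)-u(y)$, $x,y\in\mathbb R$, measurable. Let $\mathcal D_0$ be the set of real $C^\infty$ functions $v$ on $\mathbb R$ with compact support and $\int_{\mathbb R} v\,dx=0$. For a probability $\mu$ on $(E,\mathcal C'(E))$ and $v\in\mathcal D_0$ put $\hat\mu(v)=\int_E e^{i\int_{\mathbb R}uv\,dx}\,d\mu(u)$. Let $A(x,y)=\frac12(|x|+|y|-|x-y|)$. A family $(\mu_t)_{t\ge 0}$ of probabilities on $(E,\mathcal C'(E))$ is an *intrinsic statistical solution* of the Burgers equation $\partial_t u+\frac12\partial_x(u^2)=f$ with forcing $f$ Brownian in space and white in time ($E(f(x,t)f(y,s))=A(x,y)\delta(t-s)$) if, for all $v\in\mathcal D_0$ and $t\ge 0$, $$\partial_t\hat\mu_t(v)=\lim_{a\to-\infty,\,b\to+\infty}\int_E\Big(\int_{\mathbb R}\tfrac i2\Big(u(x)-\tfrac1{b-a}\int_a^b u(y)\,dy\Big)^2v'(x)\,dx\Big)e^{i\int_{\mathbb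 R} uv\,dx}\,d\mu_t(u)-\Big(\tfrac12\iint v(x)v(y)A(x,y)\,dx\,dy\Big)\hat\mu_t(v),$$ where the integrals over $E$ (for all $a<b$) are required to converge absolutely, and the limit and the time derivative to exist. A *Lévy process* is here a process indexed by $\mathbb R$ with paths in $E$ and with independent and stationary increments; only the law of its increments, a probability on $(E,\mathcal C'(E))$, is considered. It has finite variance if all its increments do. Its *characteristic exponent* is the function $\psi:\mathbb R\to\mathbb C$ with $E\,e^{i\lambda(u(y)-u(x))}=e^{(y-x)\psi(\lambda)}$ for all $x<y$, $\lambda\in\mathbb R$. It has *negative jumps* if almost surely $u(x)\le u(x^-)$ for all $x$; its *Laplace exponent* is then $\varphi(w)=\psi(-iw)$, $w\ge 0$, where $\psi$ denotes the extension of the characteristic exponent that is continuous on $\{\operatorname{Im} z\le 0\}$ and analytic on $\{\operatorname{Im} z<0\}$. Derivatives in $t$ at $t=0$ and derivatives of $\varphi$ in $w$ at $w=0$ are one-sided. **Theorem.** Let $(\mu_t)_{t\ge0}$ be laws of Lévy processes of finite variance, with characteristic exponents $\psi_t=\psi(t,\cdot)$. Assume that for every $\lambda\in\mathbb R$ the map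 $t\mapsto\psi(t,\lambda)$ is differentiable on $[0,\infty)$, and that $\partial_t\psi$ is bounded on compact subsets of $[0,\infty)\times\mathbb R$. Then $(\mu_t)_{t\ge0}$ is an intrinsic statistical solution of the forced Burgers equation if and only if $$\partial_t\psi(t,w)=i\,\psi(t,w)\,\partial_w\psi(t,w)-\frac{w^2}2\qquad\text{for all }t\ge0,\ w\in\mathbb R.$$ If moreover all the processes have negative jumps, then the Laplace exponents $\varphi_t=\varphi(t,\cdot):[0,\infty)\to\mathbb R$ exist, and the above equation for $\psi$ is equivalent to $$\partial_t\varphi(t,w)=-\varphi(t,w)\,\partial_w\varphi(t,w)+\frac{w^2}2\qquad\text{for all }t\ge0,\ w\ge0 .$$ (The existence of the derivatives involved is part of both equations.) -/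

import Mathlib

open MeasureTheory ProbabilityTheory Filter Topology Set
open scoped ContDiff

noncomputable section

namespace LevyBurgers

/-- A càdlàg function `ℝ → ℝ`: right-continuous with left limits at every point. -/
def IsCadlag (u : ℝ → ℝ) : Prop :=
  ∀ x : ℝ, ContinuousWithinAt u (Ici x) x ∧ ∃ l : ℝ, Tendsto u (𝓝[<] x) (𝓝 l)

/-- The space `E` of real càdlàg functions on the line. -/
structure CadlagPath where
  toFun : ℝ → ℝ
  cadlag : IsCadlag toFun

instance : CoeFun CadlagPath (fun _ => ℝ → ℝ) := ⟨CadlagPath.toFun⟩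

/-- The `σ`-algebra `𝒞'(E)`: the smallest one for which all the increments `u ↦ u x - u y`
are measurable. -/
instance : MeasurableSpace CadlagPath :=
  ⨆ p : ℝ × ℝ, MeasurableSpace.comap (fun u : CadlagPath => u p.1 - u p.2) inferInstance

/-! ### Intrinsic statistical solutions -/

/-- The test functions of the class `𝒟₀`: smooth, compactly supported, with zero integral. -/
structure IsTestFunction (v : ℝ → ℝ) : Prop where
  smooth : ContDiff ℝ ∞ v
  compactSupport : HasCompactSupport v
  integral_eq_zero : ∫ x, v x = 0

/-- `exp (i ∫ u(x) v(x) dx)`. -/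
def expPairing (v : ℝ → ℝ) (u : CadlagPath) : ℂ :=
  Complex.exp (Complex.I * ((∫ x, u x * v x : ℝ) : ℂ))

/-- The characteristic function `μ̂(v) = ∫ exp (i ∫ u v) dμ(u)`. -/
def charFunctional (μ : Measure CadlagPath) (v : ℝ → ℝ) : ℂ :=
  ∫ u, expPairing v u ∂μ

/-- The mean `(b - a)⁻¹ ∫_a^b u(y) dy`. -/
def mean (u : CadlagPath) (a b : ℝ) : ℝ :=
  (1 / (b - a)) * ∫ y in a..b, u y

/-- `(∫ (i/2) (u(x) - (b-a)⁻¹ ∫_a^b u)² v'(x) dx) exp (i ∫ u v)`. -/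
def centredFlux (v : ℝ → ℝ) (a b : ℝ) (u : CadlagPath) : ℂ :=
  (Complex.I / 2) * ((∫ x, (u x - mean u a b) ^ 2 * deriv v x : ℝ) : ℂ) * expPairing v u

/-- The spatial covariance `A(x,y) = (|x| + |y| - |x - y|) / 2` of the forcing: that of a
Brownian motion indexed by the whole line. -/
def forcingCov (x y : ℝ) : ℝ := (|x| + |y| - |x - y|) / 2

/-- `∫∫ v(x) v(y) A(x,y) dx dy`. -/
def forcingEnergy (v : ℝ → ℝ) : ℝ := ∫ x, ∫ y, v x * v y * forcingCov x y

/-- `(μ_t)_{t ≥ 0}` is an intrinsic statistical solution of Burgers' equation forced by a noise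
that is Brownian in space and white in time. Only the values of `μ` at `t ≥ 0` matter; the time
derivative at `t = 0` is the right derivative. The integrals over paths are required to converge,
the limit to exist, and the characteristic function to be differentiable in time. -/
structure IsIntrinsicStatisticalSolution (μ : ℝ → Measure CadlagPath) : Prop where
  isProbability : ∀ t : ℝ, 0 ≤ t → IsProbabilityMeasure (μ t)
  integrable_flux : ∀ v : ℝ → ℝ, IsTestFunction v → ∀ t : ℝ, 0 ≤ t →
    ∀ a b : ℝ, a < b → Integrable (centredFlux v a b) (μ t)
  evolution : ∀ v : ℝ → ℝ, IsTestFunction v → ∀ t : ℝ, 0 ≤ t →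
    ∃ L : ℂ,
      Tendsto (fun p : ℝ × ℝ => ∫ u, centredFlux v p.1 p.2 u ∂(μ t)) (atBot ×ˢ atTop) (𝓝 L) ∧
      HasDerivWithinAt (fun s : ℝ => charFunctional (μ s) v)
        (L - ((1 / 2 * forcingEnergy v : ℝ) : ℂ) * charFunctional (μ t) v) (Ici 0) t

/-! ### Lévy processes -/

/-- `μ` is the law on `(E, 𝒞'(E))` of a (two-sided) Lévy process: the increments over
successive intervals are independent, and the law of an increment depends only on the length of
the interval. -/
structure IsLevyLaw (μ : Measure CadlagPath) : Prop where
  isProbability : IsProbabilityMeasure μ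
  indep : HasIndepIncrements (fun (x : ℝ) (u : CadlagPath) => u x) μ
  stationary : ∀ x y h : ℝ,
    μ.map (fun u : CadlagPath => u (y + h) - u (x + h)) = μ.map (fun u : CadlagPath => u y - u x)

/-- All increments have finite variance. -/
def HasFiniteVariance (μ : Measure CadlagPath) : Prop :=
  ∀ x y : ℝ, MemLp (fun u : CadlagPath => u y - u x) 2 μ

/-- `ψ` is the characteristic exponent of `μ`:
`E exp (i lam (u(y) - u(x))) = exp ((y - x) ψ(lam))` for all `x < y` and all real `lam`. -/
def HasCharExponent (μ : Measure CadlagPath) (ψ : ℝ → ℂ) : Prop :=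
  ∀ x y : ℝ, x < y → ∀ lam : ℝ,
    ∫ u : CadlagPath, Complex.exp (Complex.I * ((lam * (u y - u x) : ℝ) : ℂ)) ∂μ
      = Complex.exp (((y - x : ℝ) : ℂ) * ψ lam)

/-- All jumps `u(x) - u(x-)` are negative: almost surely there is no upward jump. -/
def HasNegativeJumps (μ : Measure CadlagPath) : Prop :=
  ∀ᵐ u : CadlagPath ∂μ, ∀ x l : ℝ, Tendsto (u : ℝ → ℝ) (𝓝[<] x) (𝓝 l) → u x ≤ l

/-- `φ : ℝ⁺ → ℝ`, `φ(w) = ψ(-iw)`, is the Laplace exponent attached to the characteristic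
exponent `ψ`, where `ψ` is extended to the closed lower half-plane, continuously, and analytically
in its interior. Only the values of `φ` at `w ≥ 0` matter. -/
def IsLaplaceExponent (ψ : ℝ → ℂ) (φ : ℝ → ℝ) : Prop :=
  ∃ Ψ : ℂ → ℂ, DiffContOnCl ℂ Ψ {z : ℂ | z.im < 0} ∧ (∀ lam : ℝ, Ψ (lam : ℂ) = ψ lam) ∧
    ∀ w : ℝ, 0 ≤ w → Ψ (-Complex.I * (w : ℂ)) = ((φ w : ℝ) : ℂ)

/-! ### The evolution equations -/

/-- `∂_t ψ` is bounded on the compact subsets of `[0,∞) × ℝ`. -/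
def TimeDerivLocallyBounded (ψ : ℝ → ℝ → ℂ) : Prop :=
  ∀ T R : ℝ, ∃ C : ℝ, ∀ t ∈ Icc 0 T, ∀ lam ∈ Icc (-R) R,
    ‖derivWithin (fun s : ℝ => ψ s lam) (Ici 0) t‖ ≤ C

/-- `∂_t ψ = i ψ ∂_w ψ - w² / 2` for `t ≥ 0` and `w ∈ ℝ`, with both derivatives existing. -/
def SolvesCharExponentEq (ψ : ℝ → ℝ → ℂ) : Prop :=
  ∀ t : ℝ, 0 ≤ t → ∀ w : ℝ,
    DifferentiableAt ℝ (ψ t) w ∧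
    HasDerivWithinAt (fun s : ℝ => ψ s w)
      (Complex.I * deriv (ψ t) w * ψ t w - ((w ^ 2 / 2 : ℝ) : ℂ)) (Ici 0) t

/-- `∂_t φ = - φ ∂_w φ + w² / 2` for `t ≥ 0` and `w ≥ 0`, with both derivatives existing
(one-sided at `t = 0` and at `w = 0`). -/
def SolvesLaplaceExponentEq (φ : ℝ → ℝ → ℝ) : Prop :=
  ∀ t : ℝ, 0 ≤ t → ∀ w : ℝ, 0 ≤ w →
    DifferentiableWithinAt ℝ (φ t) (Ici 0) w ∧
    HasDerivWithinAt (fun s : ℝ => φ s w)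
      (-(φ t w * derivWithin (φ t) (Ici 0) w) + w ^ 2 / 2) (Ici 0) t

end LevyBurgers

end

/-!
Everything is reduced to exact formulas for a Lévy law `μ` with characteristic exponent `ψ`.

For the first equivalence, a test function `v` of zero integral has a compactly supported primitive
`V(x) = ∫_x^∞ v` (`tailIntegral`), and `μ̂(v) = exp ∫ ψ(V)`: Riemann sums turn `∫ u v` into a linear
combination of independent increments. Perturbing `v` by a multiple of the measure
`δ_x - 1_{(a,b)} / (b - a)` and differentiating twice at `0` gives the second moment of
`u(x) - mean u a b` weighted by `exp (i ∫ u v)`, in terms of `ψ'(V)` and `ψ''(V)`. After integration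
against `v'` and integration by parts, the flux term of the equation becomes
`i ∫ ψ(V) ψ'(V) · μ̂(v)` as `a → -∞`, `b → ∞`, while the energy of the forcing is `∫ V²`. Being a
statistical solution thus means `∫ G(V) = 0` for all `V`, with `G = ∂ₜψ - i ψ ψ' + w² / 2`. Plateau
functions `V`, whose plateaus can be lengthened, isolate a single value of `G`
(`isIntrinsicStatisticalSolution_iff`).

For the second one, the absence of upward jumps gives exponential moments: by compactness, a path
has no increment above `1` over sufficiently short intervals, and Fatou's lemma bounds
`E exp (w (u h - u 0))` by products of truncated moments (`lintegral_exp_increment_le`). The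
exponent therefore extends to the lower half-plane, with a bound that only depends on `ψ` near `0`
(`HasCharExponent.exists_extension`, `exists_norm_extension_le`). In particular the extensions `Ψ t`
are locally bounded, uniformly in time, and the estimate `norm_pow_four_le`, a consequence of the
maximum principle, carries continuity in time from the real axis into the half-plane.

The equation passes from the real axis to the half-plane in integrated form: with
`J = ∫ ((i/2) Ψ² - z³ / 6) dt`, it says that `J' = Ψ_b - Ψ_a`. As `J` contains no derivative of `Ψ`,
it is continuous up to the axis, and analytic continuation applies
(`IsExtensionFamily.hasDerivWithinAt_of_solves`). Restricting to the negative imaginary axis yields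
the equation for `φ`.

Conversely, the identity theorem extends the equation for `φ` to the half-plane
(`sub_eq_integral_burgersFlux`), but the passage to the real axis requires control of `∂_z Ψ` up to
the boundary, uniformly for close times. Vertical oscillations of `E X exp (i z X)` near the axis
are at most `E X exp (ε X) - E X`, so the only danger is a downward jump in time of the mean
`E X = ∂_w φ(t, 0)`. It is excluded by the equation for `φ`, through a barrier for `φ(t, w) / w`
that does not depend on `w` (`exists_mean_ge`).
-/

noncomputable section

namespace LevyBurgers

/-! ### Càdlàg paths -/

lemma IsCadlag.bounded_on {u : ℝ → ℝ} (hu : IsCadlag u) {K : Set ℝ} (hK : IsCompact K) :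
    ∃ C, ∀ x ∈ K, |u x| ≤ C := by
  refine hK.induction_on (p := fun s => ∃ C, ∀ x ∈ s, |u x| ≤ C) ⟨0, by simp⟩
    (fun s t hst ⟨C, hC⟩ => ⟨C, fun x hx => hC x (hst hx)⟩)
    (fun s t ⟨C, hC⟩ ⟨D, hD⟩ => ⟨max C D, ?_⟩) (fun x _ => ?_)
  · rintro x (hx | hx)
    · exact (hC x hx).trans (le_max_left _ _)
    · exact (hD x hx).trans (le_max_right _ _)
  · obtain ⟨hr, l, hl⟩ := hu x
    have h1 : ∀ᶠ y in 𝓝[≥] x, |u y| ≤ |u x| + 1 := by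
      have := hr.abs.eventually (Iio_mem_nhds (lt_add_one |u x|))
      filter_upwards [this] with y hy using le_of_lt hy
    have h2 : ∀ᶠ y in 𝓝[<] x, |u y| ≤ |l| + 1 := by
      have := hl.abs.eventually (Iio_mem_nhds (lt_add_one |l|))
      filter_upwards [this] with y hy using le_of_lt hy
    have h3 : ∀ᶠ y in 𝓝 x, |u y| ≤ max (|u x| + 1) (|l| + 1) := by
      rw [← nhdsLT_sup_nhdsGE, eventually_sup]
      exact ⟨h2.mono fun y hy => hy.trans (le_max_right _ _),
        h1.mono fun y hy => hy.trans (le_max_left _ _)⟩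
    exact ⟨_, mem_nhdsWithin_of_mem_nhds h3, _, fun y hy => hy⟩

/-- The first point of the grid `(n + 1)⁻¹ ℤ` at or to the right of `x`. -/
def gridPt (n : ℕ) (x : ℝ) : ℝ := ⌈x * (n + 1)⌉ / (n + 1)

lemma le_gridPt (n : ℕ) (x : ℝ) : x ≤ gridPt n x := by
  have h : (0 : ℝ) < n + 1 := by positivity
  rw [gridPt, le_div_iff₀ h]
  exact Int.le_ceil _

lemma gridPt_le (n : ℕ) (x : ℝ) : gridPt n x ≤ x + 1 / (n + 1) := by
  have h : (0 : ℝ) < n + 1 := by positivity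
  rw [gridPt, div_le_iff₀ h, add_mul, one_div, inv_mul_cancel₀ h.ne']
  exact (Int.ceil_lt_add_one _).le

lemma tendsto_gridPt (x : ℝ) : Tendsto (fun n => gridPt n x) atTop (𝓝[≥] x) := by
  refine tendsto_nhdsWithin_iff.2 ⟨?_, Eventually.of_forall fun n => le_gridPt n x⟩
  have h1 : Tendsto (fun n : ℕ => x + 1 / ((n : ℝ) + 1)) atTop (𝓝 (x + 0)) :=
    tendsto_const_nhds.add tendsto_one_div_add_atTop_nhds_zero_nat
  rw [add_zero] at h1
  exact tendsto_of_tendsto_of_tendsto_of_le_of_le tendsto_const_nhds h1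
    (fun n => le_gridPt n x) (fun n => gridPt_le n x)

lemma IsCadlag.tendsto_gridPt {u : ℝ → ℝ} (hu : IsCadlag u) (x : ℝ) :
    Tendsto (fun n => u (gridPt n x)) atTop (𝓝 (u x)) :=
  (hu x).1.tendsto.comp (LevyBurgers.tendsto_gridPt x)

lemma measurable_comp_gridPt (u : ℝ → ℝ) (n : ℕ) : Measurable (fun x => u (gridPt n x)) :=
  (measurable_from_top (f := fun k : ℤ => u (k / (n + 1)))).comp
    (Int.measurable_ceil.comp (measurable_id.mul_const _))

lemma IsCadlag.measurable {u : ℝ → ℝ} (hu : IsCadlag u) : Measurable u :=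
  measurable_of_tendsto_metrizable (measurable_comp_gridPt u)
    (tendsto_pi_nhds.2 fun x => hu.tendsto_gridPt x)

lemma measurable_increment (x y : ℝ) : Measurable (fun u : CadlagPath => u x - u y) := by
  refine Measurable.of_comap_le ?_
  exact le_iSup (fun p : ℝ × ℝ => MeasurableSpace.comap
    (fun u : CadlagPath => u p.1 - u p.2) inferInstance) (x, y)

/-- Joint measurability, by right-continuity: the path at `x` is the limit of its values at the grid
points just above `x`. -/
lemma measurable_increment_zero_uncurry :
    Measurable (fun p : ℝ × CadlagPath => p.2 p.1 - p.2 0) := by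
  refine measurable_of_tendsto_metrizable
    (f := fun (n : ℕ) (p : ℝ × CadlagPath) => p.2 (gridPt n p.1) - p.2 0) (fun n => ?_)
    (tendsto_pi_nhds.2 fun p => ((p.2.cadlag.tendsto_gridPt p.1).sub_const _))
  have h : Measurable (fun q : ℤ × CadlagPath => q.2 (q.1 / (n + 1)) - q.2 0) :=
    measurable_from_prod_countable_right fun k => measurable_increment (k / (n + 1)) 0
  exact h.comp ((Int.measurable_ceil.comp (measurable_fst.mul_const _)).prodMk measurable_snd)

lemma IsCadlag.intervalIntegrable {u : ℝ → ℝ} (hu : IsCadlag u) (a b : ℝ) :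
    IntervalIntegrable u volume a b := by
  obtain ⟨C, hC⟩ := hu.bounded_on (isCompact_uIcc (a := a) (b := b))
  refine (intervalIntegrable_const (c := C)).mono_fun hu.measurable.aestronglyMeasurable ?_
  filter_upwards [ae_restrict_mem measurableSet_uIoc] with x hx
  rw [Real.norm_eq_abs, Real.norm_eq_abs]
  exact (hC x (uIoc_subset_uIcc hx)).trans (le_abs_self C)

lemma IsCadlag.integrable_mul {u : ℝ → ℝ} (hu : IsCadlag u) {v : ℝ → ℝ} (hv : Continuous v)
    (hc : HasCompactSupport v) : Integrable (fun x => u x * v x) := by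
  obtain ⟨C, hC⟩ := hu.bounded_on hc.isCompact
  refine ((hv.integrable_of_hasCompactSupport hc).norm.const_mul C).mono'
    (hu.measurable.mul hv.measurable).aestronglyMeasurable (Eventually.of_forall fun x => ?_)
  rw [norm_mul]
  by_cases hx : x ∈ tsupport v
  · exact mul_le_mul_of_nonneg_right (hC x hx) (norm_nonneg _)
  · simp [image_eq_zero_of_notMem_tsupport hx]

/-! ### Increments of a Lévy process and regularity of the exponent -/

/-- The law of the increment of the process over an interval of length `h`. -/
def incrLaw (μ : Measure CadlagPath) (h : ℝ) : Measure ℝ :=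
  μ.map (fun u : CadlagPath => u h - u 0)

lemma IsLevyLaw.isProbabilityMeasure_incrLaw {μ : Measure CadlagPath} (hμ : IsLevyLaw μ) (h : ℝ) :
    IsProbabilityMeasure (incrLaw μ h) :=
  have := hμ.isProbability
  Measure.isProbabilityMeasure_map (measurable_increment _ _).aemeasurable

lemma IsLevyLaw.map_increment {μ : Measure CadlagPath} (hμ : IsLevyLaw μ) (x y : ℝ) :
    μ.map (fun u : CadlagPath => u y - u x) = incrLaw μ (y - x) := by
  have := hμ.stationary 0 (y - x) x
  simpa [incrLaw] using this

lemma HasFiniteVariance.memLp_incrLaw {μ : Measure CadlagPath} (hv : HasFiniteVariance μ) (h : ℝ) :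
    MemLp id 2 (incrLaw μ h) :=
  (memLp_map_measure_iff aestronglyMeasurable_id (measurable_increment _ _).aemeasurable).2
    (by simpa using! hv 0 h)

lemma HasCharExponent.charFun_incrLaw {μ : Measure CadlagPath} {ψ : ℝ → ℂ}
    (hψ : HasCharExponent μ ψ) {h : ℝ} (hh : 0 < h) (lam : ℝ) :
    charFun (incrLaw μ h) lam = Complex.exp (h * ψ lam) := by
  have h1 := hψ 0 h hh lam
  rw [sub_zero] at h1
  rw [← h1, charFun_apply_real, incrLaw, integral_map (measurable_increment _ _).aemeasurable
    (by fun_prop)]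
  congr 1 with u
  congr 1
  push_cast
  ring

/-- Increments over short intervals are small in probability, because the paths are
right-continuous. -/
lemma HasCharExponent.eventually_norm_exp_sub_one_le {μ : Measure CadlagPath} {ψ : ℝ → ℂ}
    (hμ : IsLevyLaw μ) (hψ : HasCharExponent μ ψ) (R : ℝ) {ε : ℝ} (hε : 0 < ε) :
    ∀ᶠ h : ℝ in 𝓝[>] 0, ∀ lam : ℝ, |lam| ≤ R → ‖Complex.exp (h * ψ lam) - 1‖ ≤ ε := by
  have := hμ.isProbability
  have hlim : Tendsto (fun h : ℝ => ∫ u : CadlagPath, min (|R| * |u h - u 0|) 2 ∂μ) (𝓝[>] 0)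
      (𝓝 (∫ _ : CadlagPath, (0 : ℝ) ∂μ)) := by
    refine tendsto_integral_filter_of_dominated_convergence (fun _ => 2)
      (Eventually.of_forall fun h => ?_) (Eventually.of_forall fun h =>
        Eventually.of_forall fun u => ?_) (integrable_const _) (Eventually.of_forall fun u => ?_)
    · exact (((measurable_increment h 0).abs.const_mul _).min measurable_const).aestronglyMeasurable
    · rw [Real.norm_of_nonneg (le_min (by positivity) (by norm_num))]
      exact min_le_right _ _
    · have h1 : Tendsto (fun h => u h) (𝓝[>] 0) (𝓝 (u 0)) :=
        ((u.cadlag 0).1.tendsto).mono_left (nhdsWithin_mono _ Ioi_subset_Ici_self)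
      have h2 := (((h1.sub_const (u 0)).abs.const_mul |R|).min (tendsto_const_nhds (x := (2 : ℝ))))
      simpa using h2
  rw [integral_zero] at hlim
  filter_upwards [hlim.eventually (Iio_mem_nhds hε), self_mem_nhdsWithin] with h h1 h2 lam hlam
  refine le_trans ?_ (le_of_lt h1)
  have h3 := hψ 0 h h2 lam
  rw [sub_zero] at h3
  have hi : Integrable (fun u : CadlagPath =>
      Complex.exp (Complex.I * ((lam * (u h - u 0) : ℝ) : ℂ))) μ := by
    refine Integrable.of_bound (C := 1) ?_ (Eventually.of_forall fun u => ?_)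
    · have := (measurable_increment h 0).const_mul lam
      exact (by fun_prop : Measurable fun u : CadlagPath =>
        Complex.exp (Complex.I * ((lam * (u h - u 0) : ℝ) : ℂ))).aestronglyMeasurable
    · rw [mul_comm, Complex.norm_exp_ofReal_mul_I]
  have h4 : Complex.exp (h * ψ lam) - 1 = ∫ u : CadlagPath,
      (Complex.exp (Complex.I * ((lam * (u h - u 0) : ℝ) : ℂ)) - 1) ∂μ := by
    rw [integral_sub hi (integrable_const _), h3]
    simp
  rw [h4]
  refine (norm_integral_le_integral_norm _).trans (integral_mono (hi.sub (integrable_const _)).norm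
    ?_ fun u => ?_)
  · refine Integrable.of_bound (C := 2) ?_ (Eventually.of_forall fun u => ?_)
    · exact (((measurable_increment h 0).abs.const_mul _).min measurable_const).aestronglyMeasurable
    · rw [Real.norm_of_nonneg (le_min (by positivity) (by norm_num))]
      exact min_le_right _ _
  · refine le_min ?_ ?_
    · refine (Real.norm_exp_I_mul_ofReal_sub_one_le).trans ?_
      rw [Real.norm_eq_abs, abs_mul]
      exact mul_le_mul_of_nonneg_right (hlam.trans (le_abs_self R)) (abs_nonneg _)
    · refine (norm_sub_le _ _).trans ?_
      rw [mul_comm, Complex.norm_exp_ofReal_mul_I, norm_one]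
      norm_num

/-- For a small enough `h` the number `h * w` is the principal logarithm of its exponential: an
imaginary part exceeding `π` would make `exp (s * w)` a negative number for some `s ≤ h`. -/
lemma abs_im_lt_pi_of_norm_exp_sub_one_lt {h : ℝ} (hh : 0 < h) {w : ℂ}
    (hw : ∀ s ∈ Ioc 0 h, ‖Complex.exp (s * w) - 1‖ < 1) : |(h * w).im| < Real.pi := by
  by_contra! hc
  have him : (h * w).im = h * w.im := by simp
  rw [him, abs_mul, abs_of_pos hh] at hc
  have hpos : 0 < |w.im| := by
    by_contra! h0
    nlinarith [Real.pi_pos]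
  have h1 := hw (Real.pi / |w.im|) ⟨by positivity, by rwa [div_le_iff₀ hpos]⟩
  set s := Real.pi / |w.im| with hs
  have h2 : Real.cos (s * w.im) = -1 := by
    rw [← Real.cos_abs, abs_mul, abs_of_pos (by positivity : 0 < s), hs,
      div_mul_cancel₀ _ hpos.ne', Real.cos_pi]
  have h3 : (Complex.exp (s * w) - 1).re = -Real.exp (s * w.re) - 1 := by
    simp [Complex.exp_re, h2]
  have h4 := Complex.abs_re_le_norm (Complex.exp (s * w) - 1)
  rw [h3] at h4
  have := Real.exp_pos (s * w.re)
  rw [abs_of_neg (by linarith)] at h4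
  linarith

/-- On a bounded set of frequencies the exponent is `h⁻¹` times the principal logarithm of the
characteristic function of a short increment. -/
lemma HasCharExponent.eventually_log_charFun {μ : Measure CadlagPath} {ψ : ℝ → ℂ}
    (hμ : IsLevyLaw μ) (hψ : HasCharExponent μ ψ) (R : ℝ) :
    ∀ᶠ h : ℝ in 𝓝[>] 0, ∀ lam : ℝ, |lam| ≤ R → charFun (incrLaw μ h) lam ∈ Complex.slitPlane ∧
      h * ψ lam = Complex.log (charFun (incrLaw μ h) lam) := by
  have h1 := hψ.eventually_norm_exp_sub_one_le hμ R (ε := 1 / 2) (by norm_num)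
  obtain ⟨δ, hδ, h2⟩ := (mem_nhdsGT_iff_exists_Ioo_subset).1 h1
  filter_upwards [Ioo_mem_nhdsGT hδ] with h hh lam hlam
  rw [hψ.charFun_incrLaw hh.1]
  have h3 : |((h : ℂ) * ψ lam).im| < Real.pi :=
    abs_im_lt_pi_of_norm_exp_sub_one_lt hh.1 fun s hs =>
      (h2 ⟨hs.1, hs.2.trans_lt hh.2⟩ lam hlam).trans_lt (by norm_num)
  rw [abs_lt] at h3
  refine ⟨?_, (Complex.log_exp h3.1 h3.2.le).symm⟩
  have h4 := Complex.mem_slitPlane_of_norm_lt_one (z := Complex.exp (h * ψ lam) - 1)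
    ((h2 hh lam hlam).trans_lt (by norm_num))
  rwa [add_sub_cancel] at h4

lemma HasCharExponent.contDiff {μ : Measure CadlagPath} {ψ : ℝ → ℂ}
    (hμ : IsLevyLaw μ) (hv : HasFiniteVariance μ) (hψ : HasCharExponent μ ψ) :
    ContDiff ℝ 2 ψ := by
  rw [contDiff_iff_contDiffAt]
  intro lam
  obtain ⟨h, h1, h2⟩ := ((hψ.eventually_log_charFun hμ (|lam| + 1)).and self_mem_nhdsWithin).exists
  have h2 : (0 : ℝ) < h := h2
  have := hμ.isProbabilityMeasure_incrLaw h
  have h3 : ContDiff ℝ 2 (charFun (incrLaw μ h)) :=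
    contDiff_charFun (n := 2) (by simpa using hv.memLp_incrLaw h)
  have h4 : ContDiffAt ℝ 2 (fun x => (h : ℂ)⁻¹ * Complex.log (charFun (incrLaw μ h) x)) lam :=
    contDiffAt_const.mul
      (((Complex.contDiffAt_log (h1 lam (by linarith)).1).restrict_scalars ℝ).comp
        lam h3.contDiffAt)
  refine h4.congr_of_eventuallyEq ?_
  have h5 : ∀ᶠ x : ℝ in 𝓝 lam, |x| < |lam| + 1 :=
    (continuous_abs.tendsto lam).eventually (Iio_mem_nhds (lt_add_one _))
  filter_upwards [h5] with x hx
  have hh : (h : ℂ) ≠ 0 := by exact_mod_cast h2.ne'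
  rw [← (h1 x hx.le).2, inv_mul_cancel_left₀ hh]

lemma HasCharExponent.zero {μ : Measure CadlagPath} {ψ : ℝ → ℂ}
    (hμ : IsLevyLaw μ) (hψ : HasCharExponent μ ψ) : ψ 0 = 0 := by
  obtain ⟨h, h1, h2⟩ := ((hψ.eventually_log_charFun hμ 0).and self_mem_nhdsWithin).exists
  have h2 : (0 : ℝ) < h := h2
  have := hμ.isProbabilityMeasure_incrLaw h
  have h3 := (h1 0 (by simp)).2
  rw [charFun_zero] at h3
  simpa [h2.ne'] using h3

lemma HasCharExponent.hasDerivAt {μ : Measure CadlagPath} {ψ : ℝ → ℂ}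
    (hμ : IsLevyLaw μ) (hv : HasFiniteVariance μ) (hψ : HasCharExponent μ ψ) (lam : ℝ) :
    HasDerivAt ψ (deriv ψ lam) lam :=
  ((hψ.contDiff hμ hv).differentiable (by norm_num) lam).hasDerivAt

lemma HasCharExponent.hasDerivAt_deriv {μ : Measure CadlagPath} {ψ : ℝ → ℂ}
    (hμ : IsLevyLaw μ) (hv : HasFiniteVariance μ) (hψ : HasCharExponent μ ψ) (lam : ℝ) :
    HasDerivAt (deriv ψ) (deriv (deriv ψ) lam) lam :=
  (((hψ.contDiff hμ hv).iterate_deriv' 1 1).differentiable (by norm_num) lam).hasDerivAt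

lemma HasCharExponent.continuous_deriv {μ : Measure CadlagPath} {ψ : ℝ → ℂ}
    (hμ : IsLevyLaw μ) (hv : HasFiniteVariance μ) (hψ : HasCharExponent μ ψ) :
    Continuous (deriv ψ) :=
  ((hψ.contDiff hμ hv).iterate_deriv' 1 1).continuous

lemma HasCharExponent.continuous_deriv_deriv {μ : Measure CadlagPath} {ψ : ℝ → ℂ}
    (hμ : IsLevyLaw μ) (hv : HasFiniteVariance μ) (hψ : HasCharExponent μ ψ) :
    Continuous (deriv (deriv ψ)) :=
  ((hψ.contDiff hμ hv).iterate_deriv' 0 2).continuous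

/-- The second moment of an increment is a quadratic polynomial in the length of the interval. -/
lemma HasCharExponent.integral_sq_increment {μ : Measure CadlagPath} {ψ : ℝ → ℂ}
    (hμ : IsLevyLaw μ) (hv : HasFiniteVariance μ) (hψ : HasCharExponent μ ψ) (x y : ℝ) :
    ∫ u : CadlagPath, (u y - u x) ^ 2 ∂μ ≤
      |y - x| * ‖deriv (deriv ψ) 0‖ + |y - x| ^ 2 * ‖deriv ψ 0‖ ^ 2 := by
  wlog hxy : x < y generalizing x y
  · rcases eq_or_lt_of_le (not_lt.1 hxy) with rfl | h
    · simp
    · have := this y x h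
      rw [abs_sub_comm]
      refine le_trans (le_of_eq ?_) this
      congr 1 with u
      ring
  have hh : 0 < y - x := sub_pos.2 hxy
  rw [abs_of_pos hh]
  have := hμ.isProbabilityMeasure_incrLaw (y - x)
  have h1 : ∫ u : CadlagPath, (u y - u x) ^ 2 ∂μ = ∫ s, s ^ 2 ∂(incrLaw μ (y - x)) := by
    rw [← hμ.map_increment x y, integral_map (measurable_increment _ _).aemeasurable (by fun_prop)]
  have h2 := iteratedDeriv_charFun_zero (n := 2) (μ := incrLaw μ (y - x))
    (by simpa using hv.memLp_incrLaw (y - x))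
  have h3 : charFun (incrLaw μ (y - x)) = fun lam => Complex.exp (((y - x : ℝ) : ℂ) * ψ lam) :=
    funext fun lam => hψ.charFun_incrLaw hh lam
  rw [iteratedDeriv_succ, iteratedDeriv_one, h3] at h2
  have h4 : deriv (fun lam => Complex.exp (((y - x : ℝ) : ℂ) * ψ lam)) =
      fun lam => Complex.exp (((y - x : ℝ) : ℂ) * ψ lam) * (((y - x : ℝ) : ℂ) * deriv ψ lam) :=
    funext fun lam => ((hψ.hasDerivAt hμ hv lam).const_mul _).cexp.deriv
  rw [h4, (((hψ.hasDerivAt hμ hv 0).const_mul _).cexp.fun_mul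
    ((hψ.hasDerivAt_deriv hμ hv 0).const_mul _)).deriv, hψ.zero hμ] at h2
  have h5 : ((∫ s, s ^ 2 ∂(incrLaw μ (y - x)) : ℝ) : ℂ) =
      -(((y - x : ℝ) : ℂ) * deriv (deriv ψ) 0 + ((y - x : ℝ) : ℂ) ^ 2 * deriv ψ 0 ^ 2) := by
    rw [Complex.I_sq] at h2
    simp only [mul_zero, Complex.exp_zero] at h2
    linear_combination h2
  have h6 : ‖((∫ s, s ^ 2 ∂(incrLaw μ (y - x)) : ℝ) : ℂ)‖ ≤
      (y - x) * ‖deriv (deriv ψ) 0‖ + (y - x) ^ 2 * ‖deriv ψ 0‖ ^ 2 := by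
    rw [h5, norm_neg]
    refine (norm_add_le _ _).trans (le_of_eq ?_)
    rw [norm_mul, norm_mul, norm_pow, norm_pow, Complex.norm_real, Real.norm_of_nonneg hh.le]
  rw [Complex.norm_real] at h6
  rw [h1]
  exact (le_abs_self _).trans h6

/-! ### The characteristic function of a linear functional of the path -/

/-- The `j`-th point of the subdivision of `[-N, N]` of mesh `(n + 1)⁻¹`. -/
def node (N n j : ℕ) : ℝ := -(N : ℝ) + j / (n + 1)

/-- The number of intervals of the subdivision of `[-N, N]` of mesh `(n + 1)⁻¹`. -/
def numNodes (N n : ℕ) : ℕ := 2 * N * (n + 1)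

lemma node_zero (N n : ℕ) : node N n 0 = -N := by simp [node]

lemma node_succ (N n j : ℕ) : node N n (j + 1) = node N n j + 1 / (n + 1) := by
  simp only [node]; push_cast; ring

lemma node_numNodes (N n : ℕ) : node N n (numNodes N n) = N := by
  have : (n : ℝ) + 1 ≠ 0 := by positivity
  simp only [node, numNodes]; push_cast; field_simp; ring

lemma node_lt_node_succ (N n j : ℕ) : node N n j < node N n (j + 1) := by
  rw [node_succ]
  have : (0 : ℝ) < 1 / (n + 1) := by positivity
  linarith

lemma monotone_node (N n : ℕ) : Monotone (node N n) :=
  monotone_nat_of_le_succ fun j => (node_lt_node_succ N n j).le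

/-- A path sampled on the subdivision is the sum of its increments over the intervals that start
before the given point. -/
lemma sum_increment_indicator (u : ℝ → ℝ) (N n : ℕ) {y : ℝ} (hy : y ∈ Icc (-(N : ℝ)) N) :
    ∑ j ∈ Finset.range (numNodes N n),
      (u (node N n (j + 1)) - u (node N n j)) * (Ioi (node N n j)).indicator 1 y
      = u (gridPt n y) - u (-N) := by
  have hM : (0 : ℝ) < n + 1 := by positivity
  have h1 : -((N * (n + 1) : ℕ) : ℤ) ≤ ⌈y * (n + 1)⌉ := by
    rw [Int.le_ceil_iff]
    push_cast
    nlinarith [hy.1]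
  have h2 : ⌈y * ((n : ℝ) + 1)⌉ ≤ ((N * (n + 1) : ℕ) : ℤ) := by
    rw [Int.ceil_le]
    push_cast
    nlinarith [hy.2]
  obtain ⟨J, hJ⟩ := Int.eq_ofNat_of_zero_le (by linarith :
    0 ≤ ⌈y * ((n : ℝ) + 1)⌉ + ((N * (n + 1) : ℕ) : ℤ))
  have hJle : J ≤ numNodes N n := by
    simp only [numNodes]
    have : ((J : ℕ) : ℤ) ≤ ((2 * N * (n + 1) : ℕ) : ℤ) := by
      rw [← hJ]; push_cast at h2 ⊢; linarith
    exact_mod_cast this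
  have hgrid : gridPt n y = node N n J := by
    have : ((⌈y * ((n : ℝ) + 1)⌉ : ℤ) : ℝ) = J - N * (n + 1) := by
      have : (((⌈y * ((n : ℝ) + 1)⌉ : ℤ) + ((N * (n + 1) : ℕ) : ℤ) : ℤ) : ℝ) = ((J : ℤ) : ℝ) := by
        rw [hJ]
      push_cast at this
      linarith
    rw [gridPt, node, this]
    field_simp
    ring
  have hind : ∀ j : ℕ, (Ioi (node N n j)).indicator (1 : ℝ → ℝ) y = if j < J then 1 else 0 := by
    intro j
    rw [indicator_apply]
    have : y ∈ Ioi (node N n j) ↔ j < J := by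
      rw [mem_Ioi, node]
      have e1 : (j < J) ↔ ((j : ℤ) - ((N * (n + 1) : ℕ) : ℤ)) < ⌈y * ((n : ℝ) + 1)⌉ := by
        omega
      rw [e1, Int.lt_ceil]
      push_cast
      rw [neg_add_lt_iff_lt_add, div_lt_iff₀ hM, add_mul, sub_lt_iff_lt_add, add_comm]
    simp [this]
  have hfilter : (Finset.range (numNodes N n)).filter (· < J) = Finset.range J := by
    ext j; simp only [Finset.mem_filter, Finset.mem_range]; omega
  simp_rw [hind, mul_ite, mul_one, mul_zero]
  rw [← Finset.sum_filter, hfilter, Finset.sum_range_sub (fun j => u (node N n j)), hgrid,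
    node_zero]

/-- Riemann sums converge to the integral against a density, in integrated-by-parts form. -/
lemma tendsto_sum_increment_mul (u : CadlagPath) (N : ℕ) {g : ℝ → ℝ} (hg : Integrable g)
    (hsupp : ∀ y, y ∉ Icc (-(N : ℝ)) N → g y = 0) :
    Tendsto (fun n => ∑ j ∈ Finset.range (numNodes N n),
      (u (node N n (j + 1)) - u (node N n j)) * ∫ y in Ioi (node N n j), g y) atTop
      (𝓝 (∫ y, (u y - u (-N)) * g y)) := by
  have hsum : ∀ n : ℕ, ∑ j ∈ Finset.range (numNodes N n),
      (u (node N n (j + 1)) - u (node N n j)) * ∫ y in Ioi (node N n j), g y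
      = ∫ y, (u (gridPt n y) - u (-N)) * g y := by
    intro n
    have h1 : ∀ y, (u (gridPt n y) - u (-N)) * g y = ∑ j ∈ Finset.range (numNodes N n),
        (u (node N n (j + 1)) - u (node N n j)) * (Ioi (node N n j)).indicator g y := by
      intro y
      by_cases hy : y ∈ Icc (-(N : ℝ)) N
      · rw [← sum_increment_indicator u N n hy, Finset.sum_mul]
        refine Finset.sum_congr rfl fun j _ => ?_
        simp only [indicator_apply]
        split_ifs <;> simp
      · simp [indicator_apply, hsupp y hy]
    simp_rw [h1]
    rw [integral_finsetSum _ fun j _ => (hg.indicator measurableSet_Ioi).const_mul _]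
    refine Finset.sum_congr rfl fun j _ => ?_
    rw [integral_const_mul, integral_indicator measurableSet_Ioi]
  simp_rw [hsum]
  obtain ⟨C, hC⟩ := u.cadlag.bounded_on (isCompact_Icc (a := -(N : ℝ)) (b := N + 1))
  refine tendsto_integral_of_dominated_convergence (fun y => (C + C) * ‖g y‖) (fun n => ?_)
    (hg.norm.const_mul _) (fun n => Eventually.of_forall fun y => ?_)
    (Eventually.of_forall fun y => ?_)
  · exact ((measurable_comp_gridPt u n).sub_const _).aestronglyMeasurable.mul hg.1
  · by_cases hy : y ∈ Icc (-(N : ℝ)) N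
    · rw [norm_mul]
      refine mul_le_mul_of_nonneg_right ?_ (norm_nonneg _)
      have hn : (1 : ℝ) / (n + 1) ≤ 1 := by
        rw [div_le_one (by positivity)]; linarith [(Nat.cast_nonneg n : (0 : ℝ) ≤ n)]
      have h0 : (0 : ℝ) ≤ N := Nat.cast_nonneg N
      refine (norm_sub_le _ _).trans (add_le_add (hC _ ⟨hy.1.trans (le_gridPt n y), ?_⟩)
        (hC _ ⟨le_rfl, by linarith⟩))
      linarith [gridPt_le n y, hy.2]
    · simp [hsupp y hy]
  · exact ((u.cadlag.tendsto_gridPt y).sub_const _).mul_const _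

/-- The characteristic function of a finite sum of weighted increments. -/
lemma HasCharExponent.integral_exp_sum_increment {μ : Measure CadlagPath} {ψ : ℝ → ℂ}
    (hμ : IsLevyLaw μ) (hψ : HasCharExponent μ ψ) (N n : ℕ) (H : ℝ → ℝ) :
    ∫ u : CadlagPath, Complex.exp (Complex.I * ((∑ j ∈ Finset.range (numNodes N n),
      (u (node N n (j + 1)) - u (node N n j)) * H (node N n j) : ℝ) : ℂ)) ∂μ
      = Complex.exp (∑ j ∈ Finset.range (numNodes N n), ((1 / (n + 1) : ℝ) : ℂ)
        * ψ (H (node N n j))) := by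
  have hind := (hμ.indep.nat (monotone_node N n)).precomp
    (g := fun i : Fin (numNodes N n) => (i : ℕ)) Fin.val_injective
  have h1 := hind.integral_fun_prod_comp (𝕜 := ℂ)
    (f := fun (i : Fin (numNodes N n)) (s : ℝ) =>
      Complex.exp (Complex.I * ((H (node N n i) * s : ℝ) : ℂ)))
    (fun i => (measurable_increment _ _).aemeasurable) (fun i => by fun_prop)
  have h2 : ∀ i : Fin (numNodes N n), ∫ u : CadlagPath, Complex.exp (Complex.I *
      ((H (node N n i) * (u (node N n (i + 1)) - u (node N n i)) : ℝ) : ℂ)) ∂μ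
      = Complex.exp (((1 / (n + 1) : ℝ) : ℂ) * ψ (H (node N n i))) := by
    intro i
    rw [hψ _ _ (node_lt_node_succ N n i)]
    congr 3
    rw [node_succ]; ring
  simp_rw [h2] at h1
  rw [Complex.exp_sum, Finset.prod_range, ← h1]
  congr 1 with u
  rw [← Complex.exp_sum]
  congr 1
  rw [Complex.ofReal_sum, Finset.mul_sum, Finset.sum_range]
  exact Finset.sum_congr rfl fun i _ => by rw [mul_comm (H _)]

/-- Left-endpoint Riemann sums of a bounded, almost everywhere continuous function. -/
lemma tendsto_riemannSum_node (N : ℕ) {g : ℝ → ℂ} (hgm : Measurable g) {C : ℝ}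
    (hC : ∀ z, ‖g z‖ ≤ C) (hcont : ∀ᵐ z, ContinuousAt g z) :
    Tendsto (fun n => ∑ j ∈ Finset.range (numNodes N n), ((1 / (n + 1) : ℝ) : ℂ)
      * g (node N n j)) atTop (𝓝 (∫ z in -(N : ℝ)..N, g z)) := by
  -- on the `j`-th interval of the subdivision this is its left endpoint
  let leftPt : ℕ → ℝ → ℝ := fun n z => gridPt n z - 1 / (n + 1)
  have hleftm : ∀ n, Measurable (leftPt n) := fun n =>
    (measurable_comp_gridPt id n).sub_const _
  have hsum : ∀ n : ℕ, ∑ j ∈ Finset.range (numNodes N n), ((1 / (n + 1) : ℝ) : ℂ)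
      * g (node N n j) = ∫ z in -(N : ℝ)..N, g (leftPt n z) := by
    intro n
    have hint : ∀ a b : ℝ, IntervalIntegrable (fun z => g (leftPt n z)) volume a b := fun a b =>
      (intervalIntegrable_const (c := C)).mono_fun (hgm.comp (hleftm n)).aestronglyMeasurable
        (Eventually.of_forall fun z => (hC _).trans (le_abs_self C))
    have := intervalIntegral.sum_integral_adjacent_intervals
      (f := fun z => g (leftPt n z)) (μ := volume) (a := node N n) (n := numNodes N n)
      (fun k _ => hint _ _)
    rw [node_zero, node_numNodes] at this
    rw [← this]
    refine Finset.sum_congr rfl fun j _ => ?_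
    have h1 : ∫ z in node N n j..node N n (j + 1), g (leftPt n z)
        = ∫ z in node N n j..node N n (j + 1), g (node N n j) := by
      rw [intervalIntegral.integral_of_le (node_lt_node_succ N n j).le,
        intervalIntegral.integral_of_le (node_lt_node_succ N n j).le]
      refine setIntegral_congr_fun measurableSet_Ioc fun z hz => ?_
      have hM : (0 : ℝ) < n + 1 := by positivity
      have hceil : ⌈z * ((n : ℝ) + 1)⌉ = -((N : ℤ) * (n + 1)) + j + 1 := by
        have e1 := hz.1
        have e2 := hz.2
        simp only [node] at e1 e2
        rw [← lt_sub_iff_add_lt', div_lt_iff₀ hM] at e1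
        rw [← sub_le_iff_le_add', le_div_iff₀ hM] at e2
        rw [Int.ceil_eq_iff]
        push_cast at e1 e2 ⊢
        constructor <;> linarith
      simp only [leftPt, gridPt, hceil, node]
      congr 1
      push_cast
      field_simp
      ring
    rw [h1, intervalIntegral.integral_const, node_succ, add_sub_cancel_left,
      Complex.real_smul]
  simp_rw [hsum]
  refine intervalIntegral.tendsto_integral_filter_of_dominated_convergence (fun _ => C)
    (Eventually.of_forall fun n => (hgm.comp (hleftm n)).aestronglyMeasurable)
    (Eventually.of_forall fun n => Eventually.of_forall fun z _ => hC _)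
    intervalIntegrable_const ?_
  filter_upwards [hcont] with z hz _
  have h1 : Tendsto (fun n => leftPt n z) atTop (𝓝 (z - 0)) :=
    ((tendsto_gridPt z).mono_right nhdsWithin_le_nhds).sub tendsto_one_div_add_atTop_nhds_zero_nat
  rw [sub_zero] at h1
  exact hz.tendsto.comp h1

/-- The characteristic function of a functional `Z = ∫ H du` of the path, where the stochastic
integral is given as the limit of its Riemann sums. -/
lemma HasCharExponent.integral_exp_eq_of_tendsto {μ : Measure CadlagPath} {ψ : ℝ → ℂ}
    (hμ : IsLevyLaw μ) (hψ : HasCharExponent μ ψ) (hψc : Continuous ψ) (N : ℕ) {H : ℝ → ℝ}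
    (hHm : Measurable H) {R : ℝ} (hR : ∀ z, |H z| ≤ R) (hHc : ∀ᵐ z, ContinuousAt H z)
    {Z : CadlagPath → ℝ}
    (hZ : ∀ u : CadlagPath, Tendsto (fun n => ∑ j ∈ Finset.range (numNodes N n),
      (u (node N n (j + 1)) - u (node N n j)) * H (node N n j)) atTop (𝓝 (Z u))) :
    ∫ u : CadlagPath, Complex.exp (Complex.I * ((Z u : ℝ) : ℂ)) ∂μ
      = Complex.exp (∫ z in -(N : ℝ)..N, ψ (H z)) := by
  have := hμ.isProbability
  obtain ⟨C, hC⟩ := (isCompact_Icc (a := -R) (b := R)).exists_bound_of_continuousOn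
    hψc.continuousOn
  have h1 := (Complex.continuous_exp.tendsto _).comp (tendsto_riemannSum_node N
    (hψc.measurable.comp hHm) (fun z => hC _ (abs_le.1 (hR z)))
    (hHc.mono fun z hz => (hψc.continuousAt).comp hz))
  refine tendsto_nhds_unique ?_ h1
  have h2 : ∀ n, (Complex.exp ∘ fun n : ℕ => ∑ j ∈ Finset.range (numNodes N n),
      ((1 / (n + 1) : ℝ) : ℂ) * (ψ ∘ H) (node N n j)) n = _ :=
    fun n => (hψ.integral_exp_sum_increment hμ N n H).symm
  rw [funext h2]
  refine tendsto_integral_of_dominated_convergence (fun _ => 1) (fun n => ?_)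
    (integrable_const _) (fun n => Eventually.of_forall fun u => ?_)
    (Eventually.of_forall fun u => ?_)
  · have : Measurable fun u : CadlagPath => ∑ j ∈ Finset.range (numNodes N n),
      (u (node N n (j + 1)) - u (node N n j)) * H (node N n j) :=
      Finset.measurable_fun_sum _ fun j _ => (measurable_increment _ _).mul_const _
    exact (by fun_prop : Measurable fun u : CadlagPath => Complex.exp (Complex.I *
      ((∑ j ∈ Finset.range (numNodes N n), (u (node N n (j + 1)) - u (node N n j))
        * H (node N n j) : ℝ) : ℂ))).aestronglyMeasurable
  · rw [mul_comm, Complex.norm_exp_ofReal_mul_I]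
  · have hc : Continuous fun s : ℝ => Complex.exp (Complex.I * (s : ℂ)) := by fun_prop
    exact (hc.tendsto _).comp (hZ u)

/-! ### Centred paths and test functions -/

lemma IsCadlag.comp {u : ℝ → ℝ} (hu : IsCadlag u) {g : ℝ → ℝ} (hg : Continuous g) :
    IsCadlag (fun x => g (u x)) := fun x => by
  obtain ⟨hr, l, hl⟩ := hu x
  exact ⟨hg.continuousAt.comp_continuousWithinAt hr, g l, (hg.tendsto l).comp hl⟩

/-- The centred value of the path is unchanged if a constant is added to the path. -/
lemma sub_mean_eq (u : CadlagPath) {a b : ℝ} (hab : a < b) (c x : ℝ) :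
    u x - mean u a b = (u x - c) - (1 / (b - a)) * ∫ y in a..b, (u y - c) := by
  rw [mean, intervalIntegral.integral_sub (u.cadlag.intervalIntegrable a b)
    intervalIntegrable_const, intervalIntegral.integral_const, smul_eq_mul]
  have : b - a ≠ 0 := (sub_pos.2 hab).ne'
  field_simp
  ring

lemma measurable_centred_uncurry {a b : ℝ} (hab : a < b) :
    Measurable (fun p : ℝ × CadlagPath => p.2 p.1 - mean p.2 a b) := by
  simp_rw [fun p : ℝ × CadlagPath => sub_mean_eq p.2 hab (p.2 0) p.1]
  have h : StronglyMeasurable fun u : CadlagPath => ∫ y in a..b, (u y - u 0) := by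
    simp_rw [intervalIntegral.integral_of_le hab.le]
    exact measurable_increment_zero_uncurry.stronglyMeasurable.integral_prod_left'
  exact measurable_increment_zero_uncurry.sub ((h.measurable.comp measurable_snd).const_mul _)

lemma measurable_centred {a b : ℝ} (hab : a < b) (x : ℝ) :
    Measurable (fun u : CadlagPath => u x - mean u a b) :=
  (measurable_centred_uncurry hab).comp measurable_prodMk_left

lemma measurable_pairing {v : ℝ → ℝ} (hv : IsTestFunction v) :
    Measurable (fun u : CadlagPath => ∫ x, u x * v x) := by
  have h : ∀ u : CadlagPath, ∫ x, u x * v x = ∫ x, (u x - u 0) * v x := by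
    intro u
    simp_rw [sub_mul]
    rw [integral_sub (u.cadlag.integrable_mul hv.smooth.continuous hv.compactSupport)
      ((hv.smooth.continuous.integrable_of_hasCompactSupport hv.compactSupport).const_mul _),
      integral_const_mul, hv.integral_eq_zero, mul_zero, sub_zero]
  simp_rw [h]
  exact ((measurable_increment_zero_uncurry.mul
    (hv.smooth.continuous.measurable.comp measurable_fst)).stronglyMeasurable.integral_prod_left'
    ).measurable

lemma measurable_expPairing {v : ℝ → ℝ} (hv : IsTestFunction v) : Measurable (expPairing v) := by
  have := measurable_pairing hv
  unfold expPairing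
  fun_prop

lemma norm_expPairing (v : ℝ → ℝ) (u : CadlagPath) : ‖expPairing v u‖ = 1 := by
  rw [expPairing, mul_comm, Complex.norm_exp_ofReal_mul_I]

lemma sq_integral_le {f : ℝ → ℝ} {a b : ℝ} (hab : a < b) (hf : IntervalIntegrable f volume a b)
    (hf2 : IntervalIntegrable (fun y => f y ^ 2) volume a b) :
    (1 / (b - a) * ∫ y in a..b, f y) ^ 2 ≤ 1 / (b - a) * ∫ y in a..b, f y ^ 2 := by
  have hba : 0 < b - a := sub_pos.2 hab
  set c := 1 / (b - a) * ∫ y in a..b, f y with hc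
  have h0 : 0 ≤ ∫ y in a..b, (f y - c) ^ 2 :=
    intervalIntegral.integral_nonneg hab.le fun y _ => sq_nonneg _
  have h1 : ∫ y in a..b, (f y - c) ^ 2
      = (∫ y in a..b, f y ^ 2) - 2 * c * (∫ y in a..b, f y) + c ^ 2 * (b - a) := by
    have : ∀ y, (f y - c) ^ 2 = f y ^ 2 - 2 * c * f y + c ^ 2 := fun y => by ring
    simp_rw [this]
    rw [intervalIntegral.integral_add (hf2.sub (hf.const_mul _)) intervalIntegrable_const,
      intervalIntegral.integral_sub hf2 (hf.const_mul _), intervalIntegral.integral_const_mul,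
      intervalIntegral.integral_const, smul_eq_mul]
    ring
  have h2 : ∫ y in a..b, f y = c * (b - a) := by rw [hc]; field_simp
  rw [h1, h2] at h0
  rw [one_div, inv_mul_eq_div, le_div_iff₀ hba]
  nlinarith

/-- The centred values of the path have second moments, bounded for `x` in a bounded set. -/
lemma HasCharExponent.exists_integral_centred_sq_le {μ : Measure CadlagPath} {ψ : ℝ → ℂ}
    (hμ : IsLevyLaw μ) (hv : HasFiniteVariance μ) (hψ : HasCharExponent μ ψ) {a b : ℝ}
    (hab : a < b) (R : ℝ) :
    ∃ D : ℝ, ∀ x : ℝ, |x| ≤ R → MemLp (fun u : CadlagPath => u x - mean u a b) 2 μ ∧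
      ∫ u : CadlagPath, (u x - mean u a b) ^ 2 ∂μ ≤ D := by
  have := hμ.isProbability
  set q : ℝ → ℝ := fun s => |s| * ‖deriv (deriv ψ) 0‖ + |s| ^ 2 * ‖deriv ψ 0‖ ^ 2 with hq
  have hq0 : ∀ x, ∫ u : CadlagPath, (u x - u 0) ^ 2 ∂μ ≤ q x := fun x => by
    simpa [hq] using hψ.integral_sq_increment hμ hv 0 x
  have hqc : Continuous q := by fun_prop
  have hint : ∀ x, Integrable (fun u : CadlagPath => (u x - u 0) ^ 2) μ := fun x =>
    (hv 0 x).integrable_sq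
  have hM : Integrable (fun u : CadlagPath => ∫ y in a..b, (u y - u 0) ^ 2) μ := by
    have hprod : Integrable (fun p : ℝ × CadlagPath => (p.2 p.1 - p.2 0) ^ 2)
        ((volume.restrict (Ioc a b)).prod μ) := by
      have hm := (measurable_increment_zero_uncurry.pow_const 2).aestronglyMeasurable
        (μ := (volume.restrict (Ioc a b)).prod μ)
      refine (integrable_prod_iff hm).2 ⟨Eventually.of_forall hint, ?_⟩
      refine Integrable.mono' (g := q) ?_ hm.norm.integral_prod_right' (Eventually.of_forall ?_)
      · exact (hqc.intervalIntegrable a b).1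
      · intro x
        rw [Real.norm_of_nonneg (integral_nonneg fun u => norm_nonneg _)]
        simp_rw [Real.norm_of_nonneg (sq_nonneg _)]
        exact hq0 x
    simp_rw [intervalIntegral.integral_of_le hab.le]
    exact hprod.integral_prod_right
  obtain ⟨Q, hQ⟩ := (isCompact_Icc (a := -R) (b := R)).exists_bound_of_continuousOn
    hqc.continuousOn
  have hpt : ∀ x (u : CadlagPath), (u x - mean u a b) ^ 2 ≤
      2 * (u x - u 0) ^ 2 + 2 * (1 / (b - a) * ∫ y in a..b, (u y - u 0) ^ 2) := by
    intro x u
    rw [sub_mean_eq u hab (u 0) x]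
    have h1 := sq_integral_le hab
      ((u.cadlag.comp (g := fun s => s - u 0) (by fun_prop)).intervalIntegrable a b)
      ((u.cadlag.comp (g := fun s => (s - u 0) ^ 2) (by fun_prop)).intervalIntegrable a b)
    nlinarith [sq_nonneg ((u x - u 0) + 1 / (b - a) * ∫ y in a..b, (u y - u 0))]
  have hdom : ∀ x, Integrable (fun u : CadlagPath =>
      2 * (u x - u 0) ^ 2 + 2 * (1 / (b - a) * ∫ y in a..b, (u y - u 0) ^ 2)) μ := fun x =>
    ((hint x).const_mul 2).add ((hM.const_mul _).const_mul 2)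
  refine ⟨2 * Q + 2 * (1 / (b - a) * ∫ u : CadlagPath, (∫ y in a..b, (u y - u 0) ^ 2) ∂μ),
    fun x hx => ?_⟩
  have hsq : Integrable (fun u : CadlagPath => (u x - mean u a b) ^ 2) μ :=
    (hdom x).mono' ((measurable_centred hab x).pow_const 2).aestronglyMeasurable
      (Eventually.of_forall fun u => by
        rw [Real.norm_of_nonneg (sq_nonneg _)]; exact hpt x u)
  refine ⟨(memLp_two_iff_integrable_sq (measurable_centred hab x).aestronglyMeasurable).2 hsq, ?_⟩
  refine (integral_mono hsq (hdom x) (hpt x)).trans ?_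
  rw [integral_add ((hint x).const_mul 2) ((hM.const_mul _).const_mul 2), integral_const_mul,
    integral_const_mul, integral_const_mul]
  have h2 : q x ≤ Q := (le_abs_self _).trans (hQ x (abs_le.1 hx))
  linarith [hq0 x]

lemma integrable_centred_sq_mul {μ : Measure CadlagPath} {ψ : ℝ → ℂ}
    (hμ : IsLevyLaw μ) (hv : HasFiniteVariance μ) (hψ : HasCharExponent μ ψ) {a b : ℝ}
    (hab : a < b) {g : ℝ → ℝ} (hg : Continuous g) (hgc : HasCompactSupport g) :
    Integrable (fun p : ℝ × CadlagPath => (p.2 p.1 - mean p.2 a b) ^ 2 * g p.1)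
      (volume.prod μ) := by
  have := hμ.isProbability
  obtain ⟨R, hR⟩ := hgc.isCompact.isBounded.exists_norm_le
  obtain ⟨D, hD⟩ := hψ.exists_integral_centred_sq_le hμ hv hab R
  have hm : AEStronglyMeasurable (fun p : ℝ × CadlagPath => (p.2 p.1 - mean p.2 a b) ^ 2 * g p.1)
      (volume.prod μ) :=
    (((measurable_centred_uncurry hab).pow_const 2).mul
      (hg.measurable.comp measurable_fst)).aestronglyMeasurable
  refine (integrable_prod_iff hm).2 ⟨Eventually.of_forall fun x => ?_, ?_⟩
  · by_cases hx : x ∈ tsupport g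
    · exact (hD x (hR x hx)).1.integrable_sq.mul_const (g x)
    · simp [image_eq_zero_of_notMem_tsupport hx]
  · refine ((hg.integrable_of_hasCompactSupport hgc).norm.const_mul D).mono'
      hm.norm.integral_prod_right' (Eventually.of_forall fun x => ?_)
    rw [Real.norm_of_nonneg (integral_nonneg fun u => norm_nonneg _)]
    by_cases hx : x ∈ tsupport g
    · simp_rw [norm_mul, Real.norm_of_nonneg (sq_nonneg _)]
      rw [integral_mul_const]
      exact mul_le_mul_of_nonneg_right (hD x (hR x hx)).2 (norm_nonneg _)
    · simp [image_eq_zero_of_notMem_tsupport hx]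

lemma IsTestFunction.integrable {v : ℝ → ℝ} (hv : IsTestFunction v) : Integrable v :=
  hv.smooth.continuous.integrable_of_hasCompactSupport hv.compactSupport

lemma IsTestFunction.continuous_deriv {v : ℝ → ℝ} (hv : IsTestFunction v) :
    Continuous (deriv v) := hv.smooth.continuous_deriv (by norm_num)

lemma IsTestFunction.hasDerivAt {v : ℝ → ℝ} (hv : IsTestFunction v) (x : ℝ) :
    HasDerivAt v (deriv v x) x :=
  (hv.smooth.differentiable (by norm_num) x).hasDerivAt

lemma integrable_centredFlux {μ : Measure CadlagPath} {ψ : ℝ → ℂ}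
    (hμ : IsLevyLaw μ) (hv : HasFiniteVariance μ) (hψ : HasCharExponent μ ψ) {a b : ℝ}
    (hab : a < b) {v : ℝ → ℝ} (ht : IsTestFunction v) : Integrable (centredFlux v a b) μ := by
  have := hμ.isProbability
  have h1 := (integrable_centred_sq_mul hμ hv hψ hab ht.continuous_deriv
    ht.compactSupport.deriv).integral_prod_right
  refine Integrable.mul_bdd (c := 1) ?_ (measurable_expPairing ht).aestronglyMeasurable
    (Eventually.of_forall fun u => (norm_expPairing v u).le)
  exact h1.ofReal.const_mul _

/-- The primitive `z ↦ ∫_z^∞ g` of `-g` that vanishes at `+∞`. -/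
def tailIntegral (g : ℝ → ℝ) (z : ℝ) : ℝ := ∫ y in Ioi z, g y

lemma tailIntegral_eq {g : ℝ → ℝ} (hg : Integrable g) (z : ℝ) :
    tailIntegral g z = tailIntegral g 0 - ∫ y in (0 : ℝ)..z, g y := by
  have := intervalIntegral.integral_interval_add_Ioi (f := g) (a := 0) (b := z) (μ := volume)
    hg.integrableOn hg.integrableOn
  simp only [tailIntegral]
  linarith

lemma hasDerivAt_tailIntegral {g : ℝ → ℝ} (hg : Integrable g) (hc : Continuous g) (z : ℝ) :
    HasDerivAt (tailIntegral g) (-g z) z := by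
  rw [funext (tailIntegral_eq hg)]
  simpa using (intervalIntegral.integral_hasDerivAt_right (hc.intervalIntegrable 0 z)
    hc.stronglyMeasurable.stronglyMeasurableAtFilter hc.continuousAt).const_sub (tailIntegral g 0)

lemma continuous_tailIntegral {g : ℝ → ℝ} (hg : Integrable g) : Continuous (tailIntegral g) := by
  rw [funext (tailIntegral_eq hg)]
  exact continuous_const.sub (intervalIntegral.continuous_primitive
    (fun _ _ => hg.intervalIntegrable) 0)

lemma abs_tailIntegral_le {g : ℝ → ℝ} (hg : Integrable g) (z : ℝ) :
    |tailIntegral g z| ≤ ∫ y, |g y| :=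
  (abs_integral_le_integral_abs).trans
    (setIntegral_le_integral hg.abs (Eventually.of_forall fun _ => abs_nonneg _))

lemma tailIntegral_of_le {g : ℝ → ℝ} {N : ℝ} (hsupp : ∀ y, y ∉ Icc (-N) N → g y = 0)
    {z : ℝ} (hz : N ≤ z) : tailIntegral g z = 0 :=
  setIntegral_eq_zero_of_forall_eq_zero fun y hy => hsupp y fun h =>
    (hz.trans_lt (mem_Ioi.1 hy)).not_ge h.2

lemma tailIntegral_of_le_neg {g : ℝ → ℝ} {N : ℝ} (hsupp : ∀ y, y ∉ Icc (-N) N → g y = 0)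
    (h0 : ∫ y, g y = 0) {z : ℝ} (hz : z ≤ -N) : tailIntegral g z = 0 := by
  rw [← h0, tailIntegral, ← integral_indicator measurableSet_Ioi]
  refine integral_congr_ae ?_
  have : ∀ᵐ y : ℝ, y ≠ z := Measure.ae_ne volume z
  filter_upwards [this] with y hy
  rw [indicator_apply]
  split_ifs with h
  · rfl
  · refine (hsupp y fun h' => ?_).symm
    exact hy (le_antisymm (not_lt.1 h) (hz.trans h'.1))

lemma IsTestFunction.exists_support {v : ℝ → ℝ} (hv : IsTestFunction v) :
    ∃ N : ℕ, 0 < N ∧ ∀ y, y ∉ Ioo (-(N : ℝ)) N → v y = 0 := by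
  obtain ⟨R, hR⟩ := hv.compactSupport.isCompact.isBounded.exists_norm_le
  obtain ⟨N, hN⟩ := exists_nat_gt (max R 0)
  refine ⟨N, by exact_mod_cast (le_max_right _ _).trans_lt hN, fun y hy => ?_⟩
  by_contra h
  have h1 := hR y (subset_tsupport v h)
  rw [Real.norm_eq_abs] at h1
  exact hy (abs_lt.1 (h1.trans_lt ((le_max_left _ _).trans_lt hN)))

/-! ### Second moments weighted by the exponential of a pairing -/

/-- The kernel `K` with `u x - (b - a)⁻¹ ∫_a^b u = ∫ K du`. -/
def centringKernel (a b x z : ℝ) : ℝ :=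
  (Iio x).indicator 1 z - (1 / (b - a)) * max (b - max a z) 0

lemma tailIntegral_indicator_Ioc (a b z : ℝ) :
    tailIntegral ((Ioc a b).indicator 1) z = max (b - max a z) 0 := by
  rw [tailIntegral, setIntegral_indicator measurableSet_Ioc, inter_comm, Ioc_inter_Ioi]
  simp [Real.volume_real_Ioc]

lemma measurable_centringKernel (a b x : ℝ) : Measurable (centringKernel a b x) := by
  unfold centringKernel
  exact (measurable_one.indicator measurableSet_Iio).sub (by fun_prop)

lemma abs_centringKernel_le {a b : ℝ} (hab : a < b) (x z : ℝ) : |centringKernel a b x z| ≤ 1 := by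
  have hba : 0 < b - a := sub_pos.2 hab
  have h0 : 0 ≤ (1 / (b - a)) * max (b - max a z) 0 := by positivity
  have h1 : (1 / (b - a)) * max (b - max a z) 0 ≤ 1 := by
    rw [one_div, inv_mul_le_iff₀ hba, mul_one]
    exact max_le (by linarith [le_max_left a z]) hba.le
  rw [centringKernel, abs_le, indicator_apply]
  simp only [Pi.one_apply]
  split_ifs <;> constructor <;> linarith

lemma continuousAt_centringKernel {a b x z : ℝ} (hz : z ≠ x) :
    ContinuousAt (centringKernel a b x) z := by
  unfold centringKernel
  refine ContinuousAt.sub ?_ (by fun_prop)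
  rcases lt_or_gt_of_ne hz with h | h
  · refine continuousAt_const (y := (1 : ℝ)) |>.congr ?_
    filter_upwards [Iio_mem_nhds h] with y hy using by simp [indicator_of_mem hy]
  · refine continuousAt_const (y := (0 : ℝ)) |>.congr ?_
    filter_upwards [Ioi_mem_nhds h] with y hy using by
      rw [indicator_of_notMem (by simpa using le_of_lt hy)]

/-- Riemann sums for `ε (u x - (b - a)⁻¹ ∫_a^b u) + ∫ u v`. -/
lemma tendsto_sum_increment_kernel (u : CadlagPath) {N : ℕ} {a b x : ℝ} (hab : a < b)
    (ha : -(N : ℝ) ≤ a) (hb : b ≤ N) (hx : x ∈ Icc (-(N : ℝ)) N) {v : ℝ → ℝ}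
    (hv : IsTestFunction v) (hsupp : ∀ y, y ∉ Icc (-(N : ℝ)) N → v y = 0) (ε : ℝ) :
    Tendsto (fun n => ∑ j ∈ Finset.range (numNodes N n),
      (u (node N n (j + 1)) - u (node N n j)) *
        (ε * centringKernel a b x (node N n j) + tailIntegral v (node N n j))) atTop
      (𝓝 (ε * (u x - mean u a b) + ∫ y, u y * v y)) := by
  have h1 : Tendsto (fun n => ∑ j ∈ Finset.range (numNodes N n),
      (u (node N n (j + 1)) - u (node N n j)) * (Iio x).indicator 1 (node N n j)) atTop
      (𝓝 (u x - u (-N))) := by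
    have : ∀ n, ∑ j ∈ Finset.range (numNodes N n),
        (u (node N n (j + 1)) - u (node N n j)) * (Iio x).indicator 1 (node N n j)
        = u (gridPt n x) - u (-N) := fun n => by
      rw [← sum_increment_indicator u N n hx]
      rfl
    simp_rw [this]
    exact (u.cadlag.tendsto_gridPt x).sub_const _
  have h2 := tendsto_sum_increment_mul u N (g := (Ioc a b).indicator 1)
    ((integrable_indicator_iff measurableSet_Ioc).2 (integrableOn_const (by simp)))
    (fun y hy => indicator_of_notMem (fun h => hy ⟨ha.trans h.1.le, h.2.trans hb⟩) _)
  have h3 := tendsto_sum_increment_mul u N hv.integrable hsupp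
  have h4 : ∫ y, (u y - u (-N)) * (Ioc a b).indicator 1 y = ∫ y in a..b, (u y - u (-N)) := by
    rw [intervalIntegral.integral_of_le hab.le, ← integral_indicator measurableSet_Ioc]
    congr 1 with y
    simp only [indicator_apply]
    split_ifs <;> simp
  have h5 : ∫ y, (u y - u (-N)) * v y = ∫ y, u y * v y := by
    simp_rw [sub_mul]
    rw [integral_sub (u.cadlag.integrable_mul hv.smooth.continuous hv.compactSupport)
      (hv.integrable.const_mul _), integral_const_mul, hv.integral_eq_zero, mul_zero, sub_zero]
  rw [h4] at h2
  rw [h5] at h3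
  rw [sub_mean_eq u hab (u (-N)) x]
  refine (((h1.sub (h2.const_mul (1 / (b - a)))).const_mul ε).add h3).congr fun n => ?_
  rw [Finset.mul_sum, ← Finset.sum_sub_distrib, Finset.mul_sum, ← Finset.sum_add_distrib]
  refine Finset.sum_congr rfl fun j _ => ?_
  have := tailIntegral_indicator_Ioc a b (node N n j)
  simp only [tailIntegral] at this
  rw [this, centringKernel, tailIntegral]
  ring

/-- The joint law of a centred value and of a pairing, through the characteristic function of
`∫ (ε K + V) du`. -/
lemma HasCharExponent.integral_exp_kernel {μ : Measure CadlagPath} {ψ : ℝ → ℂ}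
    (hμ : IsLevyLaw μ) (hψ : HasCharExponent μ ψ) (hψc : Continuous ψ) {N : ℕ} {a b x : ℝ}
    (hab : a < b) (ha : -(N : ℝ) ≤ a) (hb : b ≤ N) (hx : x ∈ Icc (-(N : ℝ)) N) {v : ℝ → ℝ}
    (hv : IsTestFunction v) (hsupp : ∀ y, y ∉ Icc (-(N : ℝ)) N → v y = 0) (ε : ℝ) :
    ∫ u : CadlagPath, Complex.exp (Complex.I *
      ((ε * (u x - mean u a b) + ∫ y, u y * v y : ℝ) : ℂ)) ∂μ
      = Complex.exp (∫ z in -(N : ℝ)..N, ψ (ε * centringKernel a b x z + tailIntegral v z)) := by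
  have hVc := continuous_tailIntegral hv.integrable
  refine hψ.integral_exp_eq_of_tendsto hμ hψc N
    (H := fun z => ε * centringKernel a b x z + tailIntegral v z)
    (((measurable_centringKernel a b x).const_mul ε).add hVc.measurable)
    (R := |ε| + ∫ y, |v y|) (fun z => ?_) ?_
    (fun u => tendsto_sum_increment_kernel u hab ha hb hx hv hsupp ε)
  · refine (abs_add_le _ _).trans (add_le_add ?_ (abs_tailIntegral_le hv.integrable z))
    rw [abs_mul]
    exact mul_le_of_le_one_right (abs_nonneg _) (abs_centringKernel_le hab x z)
  · filter_upwards [Measure.ae_ne volume x] with z hz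
    exact ((continuousAt_centringKernel hz).const_mul ε).add hVc.continuousAt

/-- The characteristic functional of the law of a Lévy process. -/
lemma HasCharExponent.charFunctional_eq {μ : Measure CadlagPath} {ψ : ℝ → ℂ}
    (hμ : IsLevyLaw μ) (hψ : HasCharExponent μ ψ) (hψc : Continuous ψ) {N : ℕ} (hN : 0 < N)
    {v : ℝ → ℝ} (hv : IsTestFunction v) (hsupp : ∀ y, y ∉ Icc (-(N : ℝ)) N → v y = 0) :
    charFunctional μ v = Complex.exp (∫ z in -(N : ℝ)..N, ψ (tailIntegral v z)) := by
  have hN' : (0 : ℝ) < N := by exact_mod_cast hN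
  have := hψ.integral_exp_kernel hμ hψc (N := N) (a := -N) (b := N) (x := 0) (by linarith)
    le_rfl le_rfl ⟨by linarith, hN'.le⟩ hv hsupp 0
  simpa [charFunctional, expPairing] using this

/-- Differentiation in `ε` of `∫ c exp (i (ε X + Y))` under the integral sign. -/
lemma hasDerivAt_integral_exp_mul_add {Ω : Type*} [MeasurableSpace Ω] {μ : Measure Ω}
    [IsFiniteMeasure μ] {X Y : Ω → ℝ} (hX : Integrable X μ) (hY : Measurable Y)
    {c : Ω → ℂ} (hc : AEStronglyMeasurable c μ) {B : Ω → ℝ} (hcB : ∀ w, ‖c w‖ ≤ B w)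
    (hB : Integrable B μ) (hBX : Integrable (fun w => |X w| * B w) μ) (ε : ℝ) :
    HasDerivAt (fun ε : ℝ => ∫ w, c w * Complex.exp (Complex.I * ((ε * X w + Y w : ℝ) : ℂ)) ∂μ)
      (∫ w, (Complex.I * X w * c w) * Complex.exp (Complex.I * ((ε * X w + Y w : ℝ) : ℂ)) ∂μ)
      ε := by
  have hexp : ∀ ε : ℝ, AEStronglyMeasurable
      (fun w => Complex.exp (Complex.I * ((ε * X w + Y w : ℝ) : ℂ))) μ := fun ε =>
    (by fun_prop : Continuous fun s : ℝ => Complex.exp (Complex.I * (s : ℂ))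
      ).comp_aestronglyMeasurable ((hX.1.const_mul ε).add hY.aestronglyMeasurable)
  have hn : ∀ (ε : ℝ) w, ‖Complex.exp (Complex.I * ((ε * X w + Y w : ℝ) : ℂ))‖ = 1 := fun ε w => by
    rw [mul_comm, Complex.norm_exp_ofReal_mul_I]
  refine (hasDerivAt_integral_of_dominated_loc_of_deriv_le (bound := fun w => |X w| * B w)
    (F' := fun ε w => (Complex.I * X w * c w) *
      Complex.exp (Complex.I * ((ε * X w + Y w : ℝ) : ℂ)))
    univ_mem (Eventually.of_forall fun ε => hc.mul (hexp ε)) ?_ ?_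
    (Eventually.of_forall fun w ε _ => ?_) hBX (Eventually.of_forall fun w ε _ => ?_)).2
  · refine hB.mono' (hc.mul (hexp ε)) (Eventually.of_forall fun w => ?_)
    rw [Pi.mul_apply, norm_mul, hn, mul_one]
    exact hcB w
  · exact (((Complex.continuous_ofReal.comp_aestronglyMeasurable hX.1).const_mul _).mul hc).mul
      (hexp ε)
  · rw [norm_mul, hn, mul_one, norm_mul, norm_mul, Complex.norm_I, one_mul, Complex.norm_real]
    exact mul_le_mul_of_nonneg_left (hcB w) (norm_nonneg _)
  · have h1 : HasDerivAt (fun ε : ℝ => Complex.I * ((ε * X w + Y w : ℝ) : ℂ))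
        (Complex.I * ((1 * X w : ℝ) : ℂ)) ε :=
      ((((hasDerivAt_id ε).mul_const (X w)).add_const (Y w)).ofReal_comp).const_mul _
    have h2 := (h1.cexp).const_mul (c w)
    exact h2.congr_deriv (by push_cast; ring)

/-- One derivative in `ε` of `∫ c(z) g(ε K(z) + V(z)) dz`. -/
lemma hasDerivAt_integral_comp_mul_add {g g' : ℝ → ℂ} (hg : ∀ s, HasDerivAt g (g' s) s)
    (hg' : Continuous g') {K V : ℝ → ℝ} {c : ℝ → ℂ} (hK : Measurable K) (hK1 : ∀ z, |K z| ≤ 1)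
    (hV : Measurable V) {R : ℝ} (hVR : ∀ z, |V z| ≤ R) (hc : Measurable c)
    (hc1 : ∀ z, ‖c z‖ ≤ 1) (a b ε : ℝ) :
    HasDerivAt (fun ε : ℝ => ∫ z in a..b, c z * g (ε * K z + V z))
      (∫ z in a..b, (c z * K z) * g' (ε * K z + V z)) ε := by
  have hgc : Continuous g := continuous_iff_continuousAt.2 fun s => (hg s).continuousAt
  obtain ⟨C, hC⟩ := (isCompact_Icc (a := -(|ε| + 1 + R)) (b := |ε| + 1 + R)
    ).exists_bound_of_continuousOn hg'.continuousOn
  obtain ⟨D, hD⟩ := (isCompact_Icc (a := -(|ε| + 1 + R)) (b := |ε| + 1 + R)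
    ).exists_bound_of_continuousOn hgc.continuousOn
  have hmem : ∀ e ∈ Metric.ball ε 1, ∀ z, e * K z + V z ∈ Icc (-(|ε| + 1 + R)) (|ε| + 1 + R) := by
    intro e he z
    rw [Metric.mem_ball, Real.dist_eq] at he
    refine abs_le.1 ((abs_add_le _ _).trans (add_le_add ?_ (hVR z)))
    rw [abs_mul]
    refine (mul_le_of_le_one_right (abs_nonneg _) (hK1 z)).trans ?_
    linarith [abs_sub_abs_le_abs_sub e ε]
  have hm : ∀ e : ℝ, Measurable fun z => e * K z + V z := fun e => (hK.const_mul e).add hV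
  refine (intervalIntegral.hasDerivAt_integral_of_dominated_loc_of_deriv_le (bound := fun _ => C)
    (F' := fun e z => (c z * K z) * g' (e * K z + V z))
    (Metric.ball_mem_nhds ε one_pos) (Eventually.of_forall fun e =>
      (hc.mul (hgc.measurable.comp (hm e))).aestronglyMeasurable) ?_ ?_
    (Eventually.of_forall fun z _ e he => ?_) intervalIntegrable_const
    (Eventually.of_forall fun z _ e _ => ?_)).2
  · refine (intervalIntegrable_const (c := D)).mono_fun
      (hc.mul (hgc.measurable.comp (hm ε))).aestronglyMeasurable (Eventually.of_forall fun z => ?_)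
    change ‖c z * g (ε * K z + V z)‖ ≤ |D|
    rw [norm_mul]
    refine le_trans ?_ (le_abs_self D)
    exact (mul_le_of_le_one_left (norm_nonneg _) (hc1 z)).trans
      (hD _ (hmem ε (Metric.mem_ball_self one_pos) z))
  · exact ((hc.mul (Complex.measurable_ofReal.comp hK)).mul
      (hg'.measurable.comp (hm ε))).aestronglyMeasurable
  · rw [norm_mul, norm_mul, Complex.norm_real]
    exact (mul_le_of_le_one_left (norm_nonneg _)
      (mul_le_one₀ (hc1 z) (norm_nonneg _) (hK1 z))).trans (hC _ (hmem e he z))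
  · have h1 : HasDerivAt (fun e : ℝ => e * K z + V z) (K z) e := by
      simpa using ((hasDerivAt_id e).mul_const (K z)).add_const (V z)
    have h2 := ((hg (e * K z + V z)).scomp e h1).const_mul (c z)
    exact h2.congr_deriv (by rw [Complex.real_smul]; ring)

/-- The second moment of the centred path weighted by `exp (i ∫ u v)`: the second derivative at
`ε = 0` of the characteristic function of `ε (u x - mean u a b) + ∫ u v`. -/
lemma HasCharExponent.integral_centred_sq_mul_expPairing {μ : Measure CadlagPath} {ψ : ℝ → ℂ}
    (hμ : IsLevyLaw μ) (hvar : HasFiniteVariance μ) (hψ : HasCharExponent μ ψ) {N : ℕ}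
    {a b x : ℝ} (hab : a < b) (ha : -(N : ℝ) ≤ a) (hb : b ≤ N) (hx : x ∈ Icc (-(N : ℝ)) N)
    {v : ℝ → ℝ} (hv : IsTestFunction v) (hsupp : ∀ y, y ∉ Icc (-(N : ℝ)) N → v y = 0) :
    ∫ u : CadlagPath, (((u x - mean u a b) ^ 2 : ℝ) : ℂ) * expPairing v u ∂μ
      = -((∫ z in -(N : ℝ)..N, (centringKernel a b x z : ℂ) * deriv ψ (tailIntegral v z)) ^ 2
        + ∫ z in -(N : ℝ)..N, (centringKernel a b x z : ℂ) ^ 2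
          * deriv (deriv ψ) (tailIntegral v z)) * charFunctional μ v := by
  have := hμ.isProbability
  have hψc : Continuous ψ := (hψ.contDiff hμ hvar).continuous
  set X : CadlagPath → ℝ := fun u => u x - mean u a b with hX
  set Y : CadlagPath → ℝ := fun u => ∫ y, u y * v y with hY
  set K := centringKernel a b x with hK
  set V := tailIntegral v with hV
  have hX2 : MemLp X 2 μ := by
    obtain ⟨D, hD⟩ := hψ.exists_integral_centred_sq_le hμ hvar hab |x|
    exact (hD x le_rfl).1
  have hXi : Integrable X μ := hX2.integrable (by norm_num)
  have hYm : Measurable Y := measurable_pairing hv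
  have hKm := measurable_centringKernel a b x
  have hK1 := abs_centringKernel_le hab x
  have hVm : Measurable V := (continuous_tailIntegral hv.integrable).measurable
  have hVR := abs_tailIntegral_le hv.integrable
  have hJ1 : ∀ ε : ℝ, HasDerivAt (fun ε : ℝ => ∫ z in -(N : ℝ)..N, ψ (ε * K z + V z))
      (∫ z in -(N : ℝ)..N, (K z : ℂ) * deriv ψ (ε * K z + V z)) ε := fun ε => by
    simpa using hasDerivAt_integral_comp_mul_add (c := fun _ => 1) (hψ.hasDerivAt hμ hvar)
      (hψ.continuous_deriv hμ hvar) hKm hK1 hVm hVR measurable_const (by simp) (-N) N ε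
  have hJ2 : ∀ ε : ℝ, HasDerivAt
      (fun ε : ℝ => ∫ z in -(N : ℝ)..N, (K z : ℂ) * deriv ψ (ε * K z + V z))
      (∫ z in -(N : ℝ)..N, (K z * K z : ℂ) * deriv (deriv ψ) (ε * K z + V z)) ε := fun ε => by
    refine hasDerivAt_integral_comp_mul_add (c := fun z => (K z : ℂ)) (hψ.hasDerivAt_deriv hμ hvar)
      (hψ.continuous_deriv_deriv hμ hvar) hKm hK1 hVm hVR
      (Complex.measurable_ofReal.comp hKm) (fun z => ?_) (-N) N ε
    rw [Complex.norm_real]; exact hK1 z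
  have hG : ∀ ε : ℝ, ∫ u, Complex.exp (Complex.I * ((ε * X u + Y u : ℝ) : ℂ)) ∂μ
      = Complex.exp (∫ z in -(N : ℝ)..N, ψ (ε * K z + V z)) :=
    fun ε => hψ.integral_exp_kernel hμ hψc hab ha hb hx hv hsupp ε
  have hG1 : ∀ ε : ℝ, HasDerivAt
      (fun ε : ℝ => ∫ u, Complex.exp (Complex.I * ((ε * X u + Y u : ℝ) : ℂ)) ∂μ)
      (∫ u, (Complex.I * X u) * Complex.exp (Complex.I * ((ε * X u + Y u : ℝ) : ℂ)) ∂μ) ε :=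
    fun ε => by
      simpa using hasDerivAt_integral_exp_mul_add (c := fun _ => 1) (B := fun _ => 1) hXi hYm
        aestronglyMeasurable_const (by simp) (integrable_const _) (by simpa using hXi.abs) ε
  have hG2 : HasDerivAt
      (fun ε : ℝ => ∫ u, (Complex.I * X u) * Complex.exp (Complex.I * ((ε * X u + Y u : ℝ) : ℂ)) ∂μ)
      (∫ u, (Complex.I * X u * (Complex.I * X u)) *
        Complex.exp (Complex.I * (((0 : ℝ) * X u + Y u : ℝ) : ℂ)) ∂μ) 0 := by
    refine hasDerivAt_integral_exp_mul_add (c := fun u => Complex.I * X u) (B := fun u => |X u|)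
      hXi hYm ((Complex.continuous_ofReal.comp_aestronglyMeasurable hXi.1).const_mul _)
      (fun u => by simp) hXi.abs ?_ 0
    simpa [← sq, sq_abs] using hX2.integrable_sq
  -- the first derivatives of the two expressions of the characteristic function agree for all `ε`,
  -- so that a second differentiation at `ε = 0` is possible
  have hE1 : ∀ ε : ℝ, ∫ u, (Complex.I * X u) *
      Complex.exp (Complex.I * ((ε * X u + Y u : ℝ) : ℂ)) ∂μ
      = Complex.exp (∫ z in -(N : ℝ)..N, ψ (ε * K z + V z)) *
        ∫ z in -(N : ℝ)..N, (K z : ℂ) * deriv ψ (ε * K z + V z) := fun ε => by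
    have h1 := hG1 ε
    rw [funext hG] at h1
    exact h1.unique (hJ1 ε).cexp
  rw [funext hE1] at hG2
  have h2 := hG2.unique ((hJ1 0).cexp.fun_mul (hJ2 0))
  have h3 : charFunctional μ v = Complex.exp (∫ z in -(N : ℝ)..N, ψ (0 * K z + V z)) := by
    rw [← hG 0]
    simp [charFunctional, expPairing, hY]
  rw [h3]
  have h4 : ∫ u : CadlagPath, (((u x - mean u a b) ^ 2 : ℝ) : ℂ) * expPairing v u ∂μ
      = -∫ u, (Complex.I * X u * (Complex.I * X u)) *
        Complex.exp (Complex.I * (((0 : ℝ) * X u + Y u : ℝ) : ℂ)) ∂μ := by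
    rw [← integral_neg]
    congr 1 with u
    simp only [hX, hY, expPairing, zero_mul, zero_add]
    push_cast
    linear_combination ((u x - mean u a b : ℂ) ^ 2 *
      Complex.exp (Complex.I * ((∫ y, u y * v y : ℝ) : ℂ))) * Complex.I_sq
  rw [h4, h2]
  simp only [zero_mul, zero_add, ← sq]
  ring

/-! ### The mean flux -/

lemma tailIntegral_eq_zero_of_notMem_Ioc {v : ℝ → ℝ} (hv : IsTestFunction v) {N : ℝ}
    (hsupp : ∀ y, y ∉ Icc (-N) N → v y = 0) {z : ℝ} (hz : z ∉ Ioc (-N) N) :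
    tailIntegral v z = 0 := by
  by_cases h : z ≤ -N
  · exact tailIntegral_of_le_neg hsupp hv.integral_eq_zero h
  · exact tailIntegral_of_le hsupp (le_of_lt (by_contra fun h' => hz ⟨not_le.1 h, not_lt.1 h'⟩))

lemma deriv_eq_zero_of_notMem_Icc {v : ℝ → ℝ} {N : ℝ}
    (hsupp : ∀ y, y ∉ Icc (-N) N → v y = 0) {x : ℝ} (hx : x ∉ Icc (-N) N) : deriv v x = 0 := by
  have h : v =ᶠ[𝓝 x] fun _ => 0 := by
    filter_upwards [isClosed_Icc.isOpen_compl.mem_nhds hx] with y hy using hsupp y hy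
  rw [h.deriv_eq, deriv_const]

/-- The deterministic identity behind the evolution equation: two integrations by parts turn the
mean flux into `∫ ψ ψ'`, up to a term of order `(b - a)⁻¹`. -/
lemma integral_deriv_mul_kernel {ψ p q : ℝ → ℂ} (hp : ∀ s, HasDerivAt ψ (p s) s)
    (hq : ∀ s, HasDerivAt p (q s) s) (hqc : Continuous q) (h0 : ψ 0 = 0) {v : ℝ → ℝ}
    (hv : IsTestFunction v) {n N a b : ℝ} (hn : 0 ≤ n) (hsupp : ∀ y, y ∉ Ioo (-n) n → v y = 0)
    (hNa : -N ≤ a) (hbN : b ≤ N) (han : a ≤ -n) (hnb : n ≤ b) (hab : a < b) :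
    ∫ x, ((deriv v x : ℝ) : ℂ) *
      ((∫ z in -N..N, (centringKernel a b x z : ℂ) * p (tailIntegral v z)) ^ 2
        + ∫ z in -N..N, (centringKernel a b x z : ℂ) ^ 2 * q (tailIntegral v z))
      = -2 * (∫ z, ψ (tailIntegral v z) * p (tailIntegral v z))
        - (2 / (b - a) : ℝ) * ∫ z in -n..n, (p (tailIntegral v z) - p 0) := by
  set V := tailIntegral v with hV
  have hba : b - a ≠ 0 := (sub_pos.2 hab).ne'
  have hnN : n ≤ N := hnb.trans hbN
  have hNN : -N ≤ N := by linarith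
  have hsuppn : ∀ y, y ∉ Icc (-n) n → v y = 0 := fun y hy =>
    hsupp y fun h => hy (Ioo_subset_Icc_self h)
  have hpc : Continuous p := continuous_iff_continuousAt.2 fun s => (hq s).continuousAt
  have hVc : Continuous V := continuous_tailIntegral hv.integrable
  have hVd : ∀ z, HasDerivAt V (-v z) z :=
    hasDerivAt_tailIntegral hv.integrable hv.smooth.continuous
  have hvc : Continuous v := hv.smooth.continuous
  have hv'c : Continuous (deriv v) := hv.continuous_deriv
  have hV0 : ∀ z, z ∉ Ioc (-n) n → V z = 0 := fun z hz =>
    tailIntegral_eq_zero_of_notMem_Ioc hv hsuppn hz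
  -- the kernel is the indicator of `z < x` minus `ρ z`, which does not depend on `x`
  set ρ : ℝ → ℝ := fun z => (1 / (b - a)) * max (b - max a z) 0 with hρ
  have hρc : Continuous ρ := by fun_prop
  have hpV : Continuous fun z => p (V z) := hpc.comp hVc
  have hqV : Continuous fun z => q (V z) := hqc.comp hVc
  have hψV' : ∀ z, HasDerivAt (fun z => ψ (V z)) (-(v z * p (V z))) z := fun z =>
    ((hp (V z)).scomp z (hVd z)).congr_deriv (by rw [Complex.real_smul]; push_cast; ring)
  have hpV' : ∀ z, HasDerivAt (fun z => p (V z) - p 0) (-(v z * q (V z))) z := fun z =>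
    (((hq (V z)).scomp z (hVd z)).sub_const (p 0)).congr_deriv
      (by rw [Complex.real_smul]; push_cast; ring)
  set P : ℝ → ℂ := fun x => ∫ z in -N..x, p (V z) with hP
  set Q : ℝ → ℂ := fun x => ∫ z in -N..x, (1 - 2 * (ρ z : ℂ)) * q (V z) with hQ
  set c : ℂ := ∫ z in -N..N, (ρ z : ℂ) * p (V z) with hc
  set c' : ℂ := ∫ z in -N..N, (ρ z : ℂ) ^ 2 * q (V z) with hc'
  have hPd : ∀ x, HasDerivAt P (p (V x)) x := fun x =>
    intervalIntegral.integral_hasDerivAt_right (hpV.intervalIntegrable _ _)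
      hpV.stronglyMeasurable.stronglyMeasurableAtFilter hpV.continuousAt
  have hQc : Continuous fun z => (1 - 2 * (ρ z : ℂ)) * q (V z) := by fun_prop
  have hQd : ∀ x, HasDerivAt Q ((1 - 2 * (ρ x : ℂ)) * q (V x)) x := fun x =>
    intervalIntegral.integral_hasDerivAt_right (hQc.intervalIntegrable _ _)
      hQc.stronglyMeasurable.stronglyMeasurableAtFilter hQc.continuousAt
  -- the integral of a function cut off at `x`
  have hcut : ∀ g : ℝ → ℂ, Continuous g → ∀ x ∈ Icc (-N) N,
      IntervalIntegrable (fun z => (Iio x).indicator g z) volume (-N) N ∧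
      ∫ z in -N..N, (Iio x).indicator g z = ∫ z in -N..x, g z := by
    intro g hg x hx
    constructor
    · have := hg.intervalIntegrable (μ := volume) (-N) N
      rw [intervalIntegrable_iff_integrableOn_Ioc_of_le hNN] at this ⊢
      exact this.indicator measurableSet_Iio
    · rw [intervalIntegral.integral_of_le hNN, intervalIntegral.integral_of_le hx.1,
        setIntegral_indicator measurableSet_Iio]
      refine setIntegral_congr_set ?_
      have : ∀ᵐ y : ℝ, y ≠ x := Measure.ae_ne volume x
      filter_upwards [this] with y hy
      refine propext ⟨fun h => ⟨h.1.1, le_of_lt h.2⟩, fun h => ⟨⟨h.1, h.2.trans hx.2⟩, ?_⟩⟩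
      exact lt_of_le_of_ne h.2 hy
  have hin : ∀ x ∈ Icc (-N) N,
      (∫ z in -N..N, (centringKernel a b x z : ℂ) * p (V z)) ^ 2
        + ∫ z in -N..N, (centringKernel a b x z : ℂ) ^ 2 * q (V z)
      = (P x - c) ^ 2 + c' + Q x := by
    intro x hx
    have e1 : ∀ z, (centringKernel a b x z : ℂ) * p (V z)
        = (Iio x).indicator (fun z => p (V z)) z - (ρ z : ℂ) * p (V z) := by
      intro z
      simp only [centringKernel, indicator_apply, hρ]
      split_ifs <;> simp <;> ring
    have e2 : ∀ z, (centringKernel a b x z : ℂ) ^ 2 * q (V z)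
        = (Iio x).indicator (fun z => (1 - 2 * (ρ z : ℂ)) * q (V z)) z
          + (ρ z : ℂ) ^ 2 * q (V z) := by
      intro z
      simp only [centringKernel, indicator_apply, hρ]
      split_ifs <;> simp <;> ring
    have i1 : Continuous fun z => (ρ z : ℂ) * p (V z) := by fun_prop
    have i2 : Continuous fun z => (ρ z : ℂ) ^ 2 * q (V z) := by fun_prop
    simp_rw [e1, e2]
    rw [intervalIntegral.integral_sub (hcut _ hpV x hx).1 (i1.intervalIntegrable _ _),
      intervalIntegral.integral_add (hcut _ hQc x hx).1 (i2.intervalIntegrable _ _),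
      (hcut _ hpV x hx).2, (hcut _ hQc x hx).2]
    ring
  have hWd : ∀ x, HasDerivAt (fun x => (P x - c) ^ 2 + c' + Q x)
      (2 * (P x - c) * p (V x) + (1 - 2 * (ρ x : ℂ)) * q (V x)) x := fun x =>
    (((((hPd x).sub_const c).fun_pow 2).add_const c').add (hQd x)).congr_deriv (by simp)
  have hPc : Continuous P := continuous_iff_continuousAt.2 fun x => (hPd x).continuousAt
  -- the outer integral over `[-N, N]`
  have s1 : ∫ x, ((deriv v x : ℝ) : ℂ) *
      ((∫ z in -N..N, (centringKernel a b x z : ℂ) * p (V z)) ^ 2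
        + ∫ z in -N..N, (centringKernel a b x z : ℂ) ^ 2 * q (V z))
      = ∫ x in -N..N, ((P x - c) ^ 2 + c' + Q x) * ((deriv v x : ℝ) : ℂ) := by
    rw [intervalIntegral.integral_of_le hNN, ← integral_Icc_eq_integral_Ioc,
      ← integral_indicator measurableSet_Icc]
    congr 1 with x
    rw [indicator_apply]
    split_ifs with hx
    · rw [hin x hx, mul_comm]
    · rw [deriv_eq_zero_of_notMem_Icc hsuppn fun h => hx ⟨by linarith [h.1], by linarith [h.2]⟩]
      simp
  have hvN : v N = 0 := hsupp N fun h => by linarith [h.2]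
  have hvN' : v (-N) = 0 := hsupp (-N) fun h => by linarith [h.1]
  -- first integration by parts, moving the derivative off `v`
  have s2 : ∫ x in -N..N, ((P x - c) ^ 2 + c' + Q x) * ((deriv v x : ℝ) : ℂ)
      = - ∫ x in -N..N, (2 * (P x - c) * p (V x) + (1 - 2 * (ρ x : ℂ)) * q (V x)) * (v x : ℂ) := by
    rw [intervalIntegral.integral_mul_deriv_eq_deriv_mul (fun x _ => hWd x)
      (fun x _ => (hv.hasDerivAt x).ofReal_comp)
      (Continuous.intervalIntegrable (by fun_prop) _ _)
      (Continuous.intervalIntegrable (by fun_prop) _ _), hvN, hvN']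
    simp
  have hψN : ψ (V N) = 0 := by
    rw [hV, tailIntegral_of_le hsuppn hnN, h0]
  have hψN' : ψ (V (-N)) = 0 := by
    rw [hV, tailIntegral_of_le_neg hsuppn hv.integral_eq_zero (by linarith), h0]
  -- second integration by parts, with `-v p(V)` the derivative of `ψ(V)`; the constant `c`
  -- drops out
  have s3 : ∫ x in -N..N, (2 * (P x - c)) * (-(v x * p (V x)))
      = - ∫ x in -N..N, (2 * p (V x)) * ψ (V x) := by
    rw [intervalIntegral.integral_mul_deriv_eq_deriv_mul
      (fun x _ => ((hPd x).sub_const c).const_mul 2) (fun x _ => hψV' x)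
      (Continuous.intervalIntegrable (by fun_prop) _ _)
      (Continuous.intervalIntegrable (by fun_prop) _ _), hψN, hψN']
    simp
  have s4 : ∫ x in -N..N, (2 * p (V x)) * ψ (V x) = 2 * ∫ z, ψ (V z) * p (V z) := by
    rw [intervalIntegral.integral_eq_integral_of_support_subset, ← integral_const_mul]
    · congr 1 with x; ring
    · intro x hx
      by_contra h
      refine hx ?_
      have : V x = 0 := hV0 x fun h' => h ⟨by linarith [h'.1], by linarith [h'.2]⟩
      simp [this, h0]
  have hV00 : V n = 0 := tailIntegral_of_le hsuppn le_rfl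
  have hV01 : V (-n) = 0 := tailIntegral_of_le_neg hsuppn hv.integral_eq_zero le_rfl
  -- on the support of `v`, contained in `(a, b)`, the function `ρ` is affine
  have s5 : ∫ x in -N..N, (1 - 2 * (ρ x : ℂ)) * (-(v x * q (V x)))
      = ∫ x in -n..n, (1 - 2 * (((b - x) / (b - a) : ℝ) : ℂ)) * (-(v x * q (V x))) := by
    rw [intervalIntegral.integral_of_le hNN, intervalIntegral.integral_of_le (by linarith),
      ← integral_indicator measurableSet_Ioc, ← integral_indicator measurableSet_Ioc]
    congr 1 with x
    by_cases hx : x ∈ Ioc (-n) n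
    · have hxN : x ∈ Ioc (-N) N := ⟨by linarith [hx.1], by linarith [hx.2]⟩
      rw [indicator_of_mem hx, indicator_of_mem hxN]
      have : ρ x = (b - x) / (b - a) := by
        simp only [hρ]
        rw [max_eq_right (by linarith [hx.1] : a ≤ x), max_eq_left (by linarith [hx.2]),
          one_div, inv_mul_eq_div]
      rw [this]
    · rw [indicator_of_notMem hx, indicator_apply]
      split_ifs
      · rw [hsupp x fun h => hx ⟨h.1, h.2.le⟩]; simp
      · rfl
  have hρd : ∀ x, HasDerivAt (fun x : ℝ => 1 - 2 * (((b - x) / (b - a) : ℝ) : ℂ))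
      ((2 / (b - a) : ℝ) : ℂ) x := fun x => by
    have : HasDerivAt (fun x : ℝ => (b - x) / (b - a)) (-1 / (b - a)) x :=
      ((hasDerivAt_id x).const_sub b).div_const (b - a)
    exact ((this.ofReal_comp.const_mul 2).const_sub 1).congr_deriv (by push_cast; ring)
  -- the integral of `-v q(V) = (p(V) - p 0)'` against an affine function of slope `2 / (b - a)`
  have s6 : ∫ x in -n..n, (1 - 2 * (((b - x) / (b - a) : ℝ) : ℂ)) * (-(v x * q (V x)))
      = - ((2 / (b - a) : ℝ) * ∫ z in -n..n, (p (V z) - p 0)) := by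
    rw [intervalIntegral.integral_mul_deriv_eq_deriv_mul (fun x _ => hρd x)
      (fun x _ => hpV' x)
      (Continuous.intervalIntegrable (by fun_prop) _ _)
      (Continuous.intervalIntegrable (by fun_prop) _ _), hV00, hV01,
      intervalIntegral.integral_const_mul]
    simp
  rw [s1, s2, ← intervalIntegral.integral_neg]
  have s7 : ∀ x, -((2 * (P x - c) * p (V x) + (1 - 2 * (ρ x : ℂ)) * q (V x)) * (v x : ℂ))
      = (2 * (P x - c)) * (-(v x * p (V x))) + (1 - 2 * (ρ x : ℂ)) * (-(v x * q (V x))) :=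
    fun x => by ring
  simp_rw [s7]
  rw [intervalIntegral.integral_add (Continuous.intervalIntegrable (by fun_prop) _ _)
    (Continuous.intervalIntegrable (by fun_prop) _ _), s3, s4, s5, s6]
  ring

/-- The mean flux under the law of a Lévy process. -/
lemma HasCharExponent.integral_centredFlux {μ : Measure CadlagPath} {ψ : ℝ → ℂ}
    (hμ : IsLevyLaw μ) (hvar : HasFiniteVariance μ) (hψ : HasCharExponent μ ψ) {v : ℝ → ℝ}
    (hv : IsTestFunction v) {n a b : ℝ} (hn : 0 ≤ n) (hsupp : ∀ y, y ∉ Ioo (-n) n → v y = 0)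
    (han : a ≤ -n) (hnb : n ≤ b) (hab : a < b) :
    ∫ u, centredFlux v a b u ∂μ
      = (Complex.I * (∫ z, ψ (tailIntegral v z) * deriv ψ (tailIntegral v z))
        + Complex.I * (1 / (b - a) : ℝ) *
          ∫ z in -n..n, (deriv ψ (tailIntegral v z) - deriv ψ 0)) * charFunctional μ v := by
  have := hμ.isProbability
  obtain ⟨N, hN⟩ := exists_nat_ge (max (-a) b)
  have hNa : -(N : ℝ) ≤ a := by linarith [le_max_left (-a) b]
  have hbN : b ≤ N := (le_max_right _ _).trans hN
  have hsuppN : ∀ y, y ∉ Icc (-(N : ℝ)) N → v y = 0 := fun y hy =>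
    hsupp y fun h => hy ⟨by linarith [h.1], by linarith [h.2]⟩
  have hprod : Integrable (Function.uncurry fun (x : ℝ) (u : CadlagPath) =>
      (((u x - mean u a b) ^ 2 * deriv v x : ℝ) : ℂ) * expPairing v u) (volume.prod μ) := by
    refine Integrable.mul_bdd (c := 1) (integrable_centred_sq_mul hμ hvar hψ hab
      hv.continuous_deriv hv.compactSupport.deriv).ofReal
      ((measurable_expPairing hv).comp measurable_snd).aestronglyMeasurable
      (Eventually.of_forall fun p => (norm_expPairing v p.2).le)
  have h1 : ∀ u : CadlagPath, centredFlux v a b u = (Complex.I / 2) * ∫ x : ℝ,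
      (((u x - mean u a b) ^ 2 * deriv v x : ℝ) : ℂ) * expPairing v u := fun u => by
    rw [centredFlux, integral_mul_const, integral_complex_ofReal, mul_assoc]
  have h2 : ∀ x : ℝ, ∫ u : CadlagPath,
      (((u x - mean u a b) ^ 2 * deriv v x : ℝ) : ℂ) * expPairing v u ∂μ
      = -charFunctional μ v * (((deriv v x : ℝ) : ℂ) *
      ((∫ z in -(N : ℝ)..N, (centringKernel a b x z : ℂ) * deriv ψ (tailIntegral v z)) ^ 2
        + ∫ z in -(N : ℝ)..N, (centringKernel a b x z : ℂ) ^ 2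
          * deriv (deriv ψ) (tailIntegral v z))) := by
    intro x
    by_cases hx : x ∈ Icc (-(N : ℝ)) N
    · have h3 := hψ.integral_centred_sq_mul_expPairing hμ hvar hab hNa hbN hx hv hsuppN
      have h4 : ∀ u : CadlagPath,
          (((u x - mean u a b) ^ 2 * deriv v x : ℝ) : ℂ) * expPairing v u
          = ((deriv v x : ℝ) : ℂ) * ((((u x - mean u a b) ^ 2 : ℝ) : ℂ) * expPairing v u) :=
        fun u => by push_cast; ring
      simp_rw [h4]
      rw [integral_const_mul, h3]
      ring
    · simp [deriv_eq_zero_of_notMem_Icc hsuppN hx]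
  simp_rw [h1]
  rw [integral_const_mul, ← integral_integral_swap hprod]
  simp_rw [h2]
  rw [integral_const_mul, integral_deriv_mul_kernel (hψ.hasDerivAt hμ hvar)
    (hψ.hasDerivAt_deriv hμ hvar) (hψ.continuous_deriv_deriv hμ hvar) (hψ.zero hμ) hv hn hsupp
    hNa hbN han hnb hab]
  push_cast
  ring

/-- The boundary term of the flux is of order `(b - a)⁻¹`. -/
lemma HasCharExponent.tendsto_integral_centredFlux {μ : Measure CadlagPath} {ψ : ℝ → ℂ}
    (hμ : IsLevyLaw μ) (hvar : HasFiniteVariance μ) (hψ : HasCharExponent μ ψ) {v : ℝ → ℝ}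
    (hv : IsTestFunction v) :
    Tendsto (fun p : ℝ × ℝ => ∫ u, centredFlux v p.1 p.2 u ∂μ) (atBot ×ˢ atTop)
      (𝓝 (Complex.I * (∫ z, ψ (tailIntegral v z) * deriv ψ (tailIntegral v z))
        * charFunctional μ v)) := by
  obtain ⟨n, hn, hsupp⟩ := hv.exists_support
  have hn' : (0 : ℝ) < n := by exact_mod_cast hn
  have h1 : Tendsto (fun p : ℝ × ℝ => p.2 - p.1) (atBot ×ˢ atTop) atTop := by
    simp_rw [sub_eq_add_neg]
    exact tendsto_snd.atTop_add_atTop (tendsto_neg_atBot_atTop.comp tendsto_fst)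
  have h2 : Tendsto (fun p : ℝ × ℝ => ((1 / (p.2 - p.1) : ℝ) : ℂ)) (atBot ×ˢ atTop) (𝓝 0) := by
    simp_rw [one_div]
    exact_mod_cast (Complex.continuous_ofReal.tendsto 0).comp (tendsto_inv_atTop_zero.comp h1)
  have h3 := (((h2.const_mul Complex.I).mul_const
    (∫ z in -(n : ℝ)..n, (deriv ψ (tailIntegral v z) - deriv ψ 0))).const_add (Complex.I *
      (∫ z, ψ (tailIntegral v z) * deriv ψ (tailIntegral v z)))).mul_const (charFunctional μ v)
  rw [mul_zero, zero_mul, add_zero] at h3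
  refine h3.congr' ?_
  have e1 : ∀ᶠ p : ℝ × ℝ in atBot ×ˢ atTop, p.1 ≤ -n :=
    tendsto_fst.eventually (eventually_le_atBot (-(n : ℝ)))
  have e2 : ∀ᶠ p : ℝ × ℝ in atBot ×ˢ atTop, n ≤ p.2 :=
    tendsto_snd.eventually (eventually_ge_atTop (n : ℝ))
  filter_upwards [e1, e2] with p hp1 hp2
  rw [hψ.integral_centredFlux hμ hvar hv hn'.le hsupp hp1 hp2 (by linarith)]

/-! ### The energy of the forcing -/

/-- The covariance is the measure of `[0, x] ∩ (-∞, y)`, signed by the orientation of `0..x`, up to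
a term that does not depend on `y` and hence does not contribute to the energy. -/
lemma forcingCov_eq (x y : ℝ) :
    forcingCov x y = (∫ z in (0 : ℝ)..x, (Iio y).indicator (1 : ℝ → ℝ) z) + max (-x) 0 := by
  have h : ∀ a b : ℝ, ∫ z in Ioc a b, (Iio y).indicator (1 : ℝ → ℝ) z
      = max (min b y - a) 0 := fun a b => by
    rw [integral_Ioc_eq_integral_Ioo, setIntegral_indicator measurableSet_Iio, Ioo_inter_Iio]
    simp [Real.volume_real_Ioo]
  rw [forcingCov]
  rcases le_total 0 x with hx | hx
  · rw [intervalIntegral.integral_of_le hx, h, abs_of_nonneg hx]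
    rcases abs_cases y with hy | hy <;> rcases abs_cases (x - y) with hxy | hxy <;>
      rcases min_cases x y with hm | hm <;>
      rcases max_cases (min x y - 0) 0 with hM | hM <;>
      rcases max_cases (-x) 0 with hX | hX <;> linarith
  · rw [intervalIntegral.integral_of_ge hx, h, abs_of_nonpos hx]
    rcases abs_cases y with hy | hy <;> rcases abs_cases (x - y) with hxy | hxy <;>
      rcases min_cases 0 y with hm | hm <;>
      rcases max_cases (min 0 y - x) 0 with hM | hM <;>
      rcases max_cases (-x) 0 with hX | hX <;> linarith

lemma integral_mul_forcingCov {v : ℝ → ℝ} (hv : IsTestFunction v) (x : ℝ) :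
    ∫ y, v y * forcingCov x y = ∫ z in (0 : ℝ)..x, tailIntegral v z := by
  have hfin : IsFiniteMeasure (volume.restrict (uIoc 0 x)) := by
    rw [uIoc]
    infer_instance
  have hint : Integrable (Function.uncurry fun (z y : ℝ) => (Ioi z).indicator v y)
      ((volume.restrict (uIoc 0 x)).prod volume) := by
    have h1 : Integrable (fun p : ℝ × ℝ => v p.2) ((volume.restrict (uIoc 0 x)).prod volume) :=
      hv.integrable.comp_snd _
    have h2 : (Function.uncurry fun (z y : ℝ) => (Ioi z).indicator v y)
        = {p : ℝ × ℝ | p.1 < p.2}.indicator fun p => v p.2 := by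
      ext p
      simp [Function.uncurry, indicator_apply]
    rw [h2]
    exact h1.indicator (measurableSet_lt measurable_fst measurable_snd)
  have h3 : ∀ z, tailIntegral v z = ∫ y, (Ioi z).indicator v y := fun z => by
    rw [tailIntegral, integral_indicator measurableSet_Ioi]
  have h5 : ∀ y, (∫ z in (0 : ℝ)..x, (Ioi z).indicator v y)
      = v y * ∫ z in (0 : ℝ)..x, (Iio y).indicator (1 : ℝ → ℝ) z := fun y => by
    rw [← intervalIntegral.integral_const_mul]
    congr 1 with z
    simp only [indicator_apply, mem_Ioi, mem_Iio, Pi.one_apply]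
    split_ifs <;> simp
  simp_rw [h3]
  rw [intervalIntegral_integral_swap hint]
  have h6 := intervalIntegral_integral_swap hint
  have h7 : Integrable fun y => v y * ∫ z in (0 : ℝ)..x, (Iio y).indicator (1 : ℝ → ℝ) z := by
    simp_rw [← h5]
    rcases le_total 0 x with hx | hx
    · rw [uIoc_of_le hx] at hint
      simp_rw [intervalIntegral.integral_of_le hx]
      exact hint.integral_prod_right
    · rw [uIoc_of_ge hx] at hint
      simp_rw [intervalIntegral.integral_of_ge hx]
      exact hint.integral_prod_right.neg
  simp_rw [h5, forcingCov_eq, mul_add]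
  rw [integral_add h7 (hv.integrable.mul_const _), integral_mul_const, hv.integral_eq_zero,
    zero_mul, add_zero]

/-- The energy of the forcing is the squared norm of the primitive of the test function: Fubini and
an integration by parts. -/
lemma forcingEnergy_eq {v : ℝ → ℝ} (hv : IsTestFunction v) :
    forcingEnergy v = ∫ z, tailIntegral v z ^ 2 := by
  obtain ⟨n, hn, hsupp⟩ := hv.exists_support
  have hn' : (0 : ℝ) < n := by exact_mod_cast hn
  have hsuppn : ∀ y, y ∉ Icc (-(n : ℝ)) n → v y = 0 := fun y hy =>
    hsupp y fun h => hy (Ioo_subset_Icc_self h)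
  have hVc := continuous_tailIntegral hv.integrable
  have hVd := hasDerivAt_tailIntegral hv.integrable hv.smooth.continuous
  have hvc := hv.smooth.continuous
  have h1 : ∀ x, ∫ y, v x * v y * forcingCov x y
      = v x * ∫ z in (0 : ℝ)..x, tailIntegral v z := fun x => by
    rw [← integral_mul_forcingCov hv, ← integral_const_mul]
    simp_rw [mul_assoc]
  have hPd : ∀ x, HasDerivAt (fun x => ∫ z in (0 : ℝ)..x, tailIntegral v z)
      (tailIntegral v x) x := fun x =>
    intervalIntegral.integral_hasDerivAt_right (hVc.intervalIntegrable _ _)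
      hVc.stronglyMeasurable.stronglyMeasurableAtFilter hVc.continuousAt
  rw [forcingEnergy]
  simp_rw [h1]
  have h2 := intervalIntegral.integral_mul_deriv_eq_deriv_mul (a := -(n : ℝ)) (b := n)
    (fun x _ => hPd x) (fun x _ => hVd x) (hVc.intervalIntegrable _ _)
    (hvc.neg.intervalIntegrable _ _)
  rw [tailIntegral_of_le hsuppn le_rfl, tailIntegral_of_le_neg hsuppn hv.integral_eq_zero le_rfl]
    at h2
  have h3 : ∫ z in -(n : ℝ)..n, tailIntegral v z * tailIntegral v z
      = ∫ z, tailIntegral v z ^ 2 := by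
    rw [intervalIntegral.integral_eq_integral_of_support_subset]
    · simp_rw [sq]
    · intro x hx
      by_contra h
      exact hx (by simp [tailIntegral_eq_zero_of_notMem_Ioc hv hsuppn h])
  have h4 : ∫ x in -(n : ℝ)..n, (∫ z in (0 : ℝ)..x, tailIntegral v z) * -v x
      = - ∫ x, v x * ∫ z in (0 : ℝ)..x, tailIntegral v z := by
    rw [intervalIntegral.integral_eq_integral_of_support_subset, ← integral_neg]
    · congr 1 with x; ring
    · intro x hx
      by_contra h
      exact hx (by simp [hsupp x fun h' => h (Ioo_subset_Ioc_self h')])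
  rw [h3, h4] at h2
  simpa using h2

/-! ### The time derivative of the characteristic functional -/

/-- The time derivative of the exponent, one-sided at `t = 0`. -/
def timeDeriv (ψ : ℝ → ℝ → ℂ) (t lam : ℝ) : ℂ := derivWithin (fun s => ψ s lam) (Ici 0) t

lemma hasDerivWithinAt_timeDeriv {ψ : ℝ → ℝ → ℂ}
    (hDiff : ∀ lam : ℝ, DifferentiableOn ℝ (fun t : ℝ => ψ t lam) (Ici 0)) {t : ℝ} (ht : 0 ≤ t)
    (lam : ℝ) : HasDerivWithinAt (fun s => ψ s lam) (timeDeriv ψ t lam) (Ici 0) t :=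
  (hDiff lam t ht).hasDerivWithinAt

lemma TimeDerivLocallyBounded.exists_lipschitz {ψ : ℝ → ℝ → ℂ}
    (hDiff : ∀ lam : ℝ, DifferentiableOn ℝ (fun t : ℝ => ψ t lam) (Ici 0))
    (hBdd : TimeDerivLocallyBounded ψ) (T R : ℝ) :
    ∃ C : ℝ, 0 ≤ C ∧ ∀ s ∈ Icc 0 T, ∀ t ∈ Icc 0 T, ∀ lam : ℝ, |lam| ≤ R →
      ‖ψ s lam - ψ t lam‖ ≤ C * |s - t| := by
  obtain ⟨C, hC⟩ := hBdd T R
  refine ⟨max C 0, le_max_right _ _, fun s hs t ht lam hlam => ?_⟩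
  exact (convex_Icc 0 T).norm_image_sub_le_of_norm_hasDerivWithin_le
    (f := fun s => ψ s lam) (f' := fun s => timeDeriv ψ s lam)
    (fun x hx => (hasDerivWithinAt_timeDeriv hDiff hx.1 lam).mono Icc_subset_Ici_self)
    (fun x hx => (hC x hx lam (abs_le.1 hlam)).trans (le_max_left _ _)) ht hs

/-- A right neighbourhood sequence exhibits the time derivative as a limit of functions that are
continuous in the frequency. -/
lemma measurable_timeDeriv {ψ : ℝ → ℝ → ℂ}
    (hDiff : ∀ lam : ℝ, DifferentiableOn ℝ (fun t : ℝ => ψ t lam) (Ici 0))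
    (hc : ∀ t, 0 ≤ t → Continuous (ψ t)) {t : ℝ} (ht : 0 ≤ t) : Measurable (timeDeriv ψ t) := by
  have hseq : Tendsto (fun k : ℕ => t + 1 / ((k : ℝ) + 1)) atTop (𝓝[Ici 0 \ {t}] t) := by
    refine tendsto_nhdsWithin_iff.2 ⟨?_, Eventually.of_forall fun k => ?_⟩
    · simpa using tendsto_const_nhds.add (tendsto_one_div_add_atTop_nhds_zero_nat (𝕜 := ℝ))
    · have : (0 : ℝ) < 1 / ((k : ℝ) + 1) := by positivity
      exact ⟨mem_Ici.2 (by linarith), by simpa using this.ne'⟩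
  refine measurable_of_tendsto_metrizable
    (f := fun (k : ℕ) lam => slope (fun s => ψ s lam) t (t + 1 / ((k : ℝ) + 1))) (fun k => ?_)
    (tendsto_pi_nhds.2 fun lam =>
      (hasDerivWithinAt_iff_tendsto_slope.1 (hasDerivWithinAt_timeDeriv hDiff ht lam)).comp hseq)
  have : 0 ≤ t + 1 / ((k : ℝ) + 1) := by positivity
  have h1 := (hc _ this).measurable
  have h2 := (hc _ ht).measurable
  simp only [slope_def_module]
  exact (h1.sub h2).const_smul _

/-- A whole-line integral of a function of a compactly supported `V` is an interval integral. -/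
lemma integral_comp_tailIntegral {v : ℝ → ℝ} (hv : IsTestFunction v) {n : ℝ}
    (hsupp : ∀ y, y ∉ Icc (-n) n → v y = 0) {g : ℝ → ℂ} (hg : g 0 = 0) :
    ∫ z, g (tailIntegral v z) = ∫ z in -n..n, g (tailIntegral v z) := by
  rw [intervalIntegral.integral_eq_integral_of_support_subset]
  intro x hx
  by_contra h
  exact hx (by simp [tailIntegral_eq_zero_of_notMem_Ioc hv hsupp h, hg])

lemma integrable_comp_tailIntegral {v : ℝ → ℝ} (hv : IsTestFunction v) {g : ℝ → ℂ}
    (hg : g 0 = 0) (hgm : Measurable g) (hgb : ∀ R, ∃ C, ∀ s, |s| ≤ R → ‖g s‖ ≤ C) :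
    Integrable fun z => g (tailIntegral v z) := by
  obtain ⟨n, hn, hsupp⟩ := hv.exists_support
  obtain ⟨C, hC⟩ := hgb (∫ y, |v y|)
  have hsuppn : ∀ y, y ∉ Icc (-(n : ℝ)) n → v y = 0 := fun y hy =>
    hsupp y fun h => hy (Ioo_subset_Icc_self h)
  have h1 : Integrable ((Ioc (-(n : ℝ)) n).indicator fun _ => C) :=
    (integrable_indicator_iff measurableSet_Ioc).2 (integrableOn_const (by simp))
  refine h1.mono' (hgm.comp (continuous_tailIntegral hv.integrable).measurable).aestronglyMeasurable
    (Eventually.of_forall fun z => ?_)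
  rw [indicator_apply]
  split_ifs with hz
  · exact hC _ (abs_tailIntegral_le hv.integrable z)
  · simp [tailIntegral_eq_zero_of_notMem_Ioc hv hsuppn hz, hg]

lemma exists_bound_abs_le_of_continuous {g : ℝ → ℂ} (hg : Continuous g) (R : ℝ) :
    ∃ C, ∀ s, |s| ≤ R → ‖g s‖ ≤ C := by
  obtain ⟨C, hC⟩ := (isCompact_Icc (a := -R) (b := R)).exists_bound_of_continuousOn hg.continuousOn
  exact ⟨C, fun s hs => hC s (abs_le.1 hs)⟩

lemma timeDeriv_zero {ψ : ℝ → ℝ → ℂ} (h0 : ∀ t, 0 ≤ t → ψ t 0 = 0) {t : ℝ} (ht : 0 ≤ t) :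
    timeDeriv ψ t 0 = 0 := by
  have : HasDerivWithinAt (fun s => ψ s 0) 0 (Ici 0) t :=
    (hasDerivWithinAt_const t (Ici 0) (0 : ℂ)).congr (fun s hs => h0 s hs) (h0 t ht)
  exact this.derivWithin (uniqueDiffOn_Ici 0 t ht)

/-- Differentiation in time under the integral sign; the local bound of the time derivative supplies
the domination. -/
lemma hasDerivWithinAt_integral_comp_tailIntegral {ψ : ℝ → ℝ → ℂ}
    (hDiff : ∀ lam : ℝ, DifferentiableOn ℝ (fun t : ℝ => ψ t lam) (Ici 0))
    (hBdd : TimeDerivLocallyBounded ψ) (hc : ∀ t, 0 ≤ t → Continuous (ψ t))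
    (h0 : ∀ t, 0 ≤ t → ψ t 0 = 0) {v : ℝ → ℝ} (hv : IsTestFunction v) {t : ℝ} (ht : 0 ≤ t) :
    HasDerivWithinAt (fun s => ∫ z, ψ s (tailIntegral v z))
      (∫ z, timeDeriv ψ t (tailIntegral v z)) (Ici 0) t := by
  obtain ⟨n, hn, hsupp⟩ := hv.exists_support
  have hsuppn : ∀ y, y ∉ Icc (-(n : ℝ)) n → v y = 0 := fun y hy =>
    hsupp y fun h => hy (Ioo_subset_Icc_self h)
  have hVm := (continuous_tailIntegral hv.integrable).measurable
  obtain ⟨C, hC0, hC⟩ := hBdd.exists_lipschitz hDiff (t + 1) (∫ y, |v y|)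
  have hint : ∀ s, 0 ≤ s → Integrable fun z => ψ s (tailIntegral v z) := fun s hs =>
    integrable_comp_tailIntegral hv (h0 s hs) (hc s hs).measurable
      (exists_bound_abs_le_of_continuous (hc s hs))
  rw [hasDerivWithinAt_iff_tendsto_slope, integral_comp_tailIntegral hv hsuppn
    (timeDeriv_zero h0 ht)]
  have hev : ∀ᶠ s in 𝓝[Ici 0 \ {t}] t, s ∈ Icc 0 (t + 1) ∧ s ≠ t := by
    filter_upwards [self_mem_nhdsWithin,
      mem_nhdsWithin_of_mem_nhds (Iic_mem_nhds (lt_add_one t))] with s hs hs'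
    exact ⟨⟨hs.1, hs'⟩, hs.2⟩
  have hlim : Tendsto (fun s => ∫ z in -(n : ℝ)..n,
      slope (fun s => ψ s (tailIntegral v z)) t s) (𝓝[Ici 0 \ {t}] t)
      (𝓝 (∫ z in -(n : ℝ)..n, timeDeriv ψ t (tailIntegral v z))) := by
    refine intervalIntegral.tendsto_integral_filter_of_dominated_convergence (fun _ => C)
      ?_ ?_ intervalIntegrable_const (Eventually.of_forall fun z _ =>
        hasDerivWithinAt_iff_tendsto_slope.1 (hasDerivWithinAt_timeDeriv hDiff ht _))
    · filter_upwards [hev] with s hs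
      have h1 := (hc s hs.1.1).measurable.comp hVm
      have h2 := (hc t ht).measurable.comp hVm
      simp only [slope_def_module]
      exact ((h1.sub h2).const_smul _).aestronglyMeasurable
    · filter_upwards [hev] with s hs
      refine Eventually.of_forall fun z _ => ?_
      have hst : 0 < |s - t| := abs_pos.2 (sub_ne_zero.2 hs.2)
      rw [slope_def_module, norm_smul, norm_inv, Real.norm_eq_abs, inv_mul_le_iff₀ hst, mul_comm]
      exact hC s hs.1 t ⟨ht, by linarith⟩ _ (abs_tailIntegral_le hv.integrable z)
  refine hlim.congr' ?_
  filter_upwards [hev] with s hs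
  simp only [slope_def_module]
  rw [intervalIntegral.integral_smul, intervalIntegral.integral_sub
    (hint s hs.1.1).intervalIntegrable (hint t ht).intervalIntegrable,
    integral_comp_tailIntegral hv hsuppn (h0 s hs.1.1), integral_comp_tailIntegral hv hsuppn
    (h0 t ht)]

/-! ### The evolution equation and the equation of the exponents -/

/-- The plateau function that is `w` on `[0, L]` and vanishes outside `[-1, L + 1]`. -/
def plateau (w L z : ℝ) : ℝ :=
  w * (Real.smoothTransition (z + 1) * Real.smoothTransition (L + 1 - z))

lemma contDiff_plateau (w L : ℝ) : ContDiff ℝ ∞ (plateau w L) := by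
  have h := Real.smoothTransition.contDiff (n := ⊤)
  exact contDiff_const.mul ((h.comp (contDiff_id.add contDiff_const)).mul
    (h.comp (contDiff_const.sub contDiff_id)))

lemma plateau_eq_zero {w L z : ℝ} (hz : z ∉ Ioc (-1) (L + 1)) : plateau w L z = 0 := by
  by_cases h : z ≤ -1
  · rw [plateau, Real.smoothTransition.zero_of_nonpos (by linarith)]; ring
  · have : L + 1 < z := by
      by_contra h'; exact hz ⟨not_le.1 h, not_lt.1 h'⟩
    rw [plateau, Real.smoothTransition.zero_of_nonpos (x := L + 1 - z) (by linarith)]; ring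

lemma hasCompactSupport_plateau (w L : ℝ) : HasCompactSupport (plateau w L) :=
  HasCompactSupport.of_support_subset_isCompact (isCompact_Icc (a := -1) (b := L + 1))
    fun z hz => by
      by_contra h
      exact hz (plateau_eq_zero fun h' => h (Ioc_subset_Icc_self h'))

lemma isTestFunction_deriv_plateau (w L : ℝ) :
    IsTestFunction (fun z => -deriv (plateau w L) z) ∧
      tailIntegral (fun z => -deriv (plateau w L) z) = plateau w L := by
  have h1 := contDiff_plateau w L
  have h2 := hasCompactSupport_plateau w L
  have hi : Integrable (deriv (plateau w L)) :=
    (h1.continuous_deriv (by norm_num)).integrable_of_hasCompactSupport h2.deriv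
  have h3 : ∀ b, ∫ x in Ioi b, deriv (plateau w L) x = -plateau w L b := fun b =>
    h2.integral_Ioi_deriv_eq (h1.of_le (by exact_mod_cast le_top)) b
  refine ⟨⟨?_, ?_, ?_⟩, funext fun z => ?_⟩
  · exact ((contDiff_infty_iff_deriv.1 h1).2).neg
  · exact h2.deriv.neg
  · rw [integral_neg, ← intervalIntegral.integral_Iic_add_Ioi (b := 0) hi.integrableOn
      hi.integrableOn, h3, h2.integral_Iic_deriv_eq (h1.of_le (by exact_mod_cast le_top)) 0]
    simp
  · rw [tailIntegral, integral_neg, h3, neg_neg]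

/-- A function of one variable vanishes as soon as its integrals along all smooth compactly
supported `V` vanish: lengthening a plateau of height `w` by one unit adds `F w`. -/
lemma eq_zero_of_integral_comp_tailIntegral_eq_zero {F : ℝ → ℂ} (hF0 : F 0 = 0)
    (hFm : Measurable F) (hFb : ∀ R, ∃ C, ∀ s, |s| ≤ R → ‖F s‖ ≤ C)
    (h : ∀ v, IsTestFunction v → ∫ z, F (tailIntegral v z) = 0) (w : ℝ) : F w = 0 := by
  have hσ := Real.smoothTransition.continuous
  have hint : ∀ L, Integrable fun z => F (plateau w L z) := fun L => by
    have := integrable_comp_tailIntegral (isTestFunction_deriv_plateau w L).1 hF0 hFm hFb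
    rwa [(isTestFunction_deriv_plateau w L).2] at this
  have key : ∀ L : ℝ, 0 ≤ L → (∫ z in (-1 : ℝ)..0, F (w * Real.smoothTransition (z + 1)))
      + L * F w + ∫ z in (0 : ℝ)..1, F (w * Real.smoothTransition (1 - z)) = 0 := by
    intro L hL
    have h1 := h _ (isTestFunction_deriv_plateau w L).1
    rw [(isTestFunction_deriv_plateau w L).2,
      ← intervalIntegral.integral_eq_integral_of_support_subset (a := -1) (b := L + 1)
        (fun x hx => by
          by_contra h'
          exact hx (by simp [plateau_eq_zero h', hF0])),
      ← intervalIntegral.integral_add_adjacent_intervals (b := 0) (hint L).intervalIntegrable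
        (hint L).intervalIntegrable,
      ← intervalIntegral.integral_add_adjacent_intervals (a := 0) (b := L)
        (hint L).intervalIntegrable (hint L).intervalIntegrable, ← add_assoc] at h1
    have e1 : ∫ z in (-1 : ℝ)..0, F (plateau w L z)
        = ∫ z in (-1 : ℝ)..0, F (w * Real.smoothTransition (z + 1)) := by
      refine intervalIntegral.integral_congr fun z hz => ?_
      rw [uIcc_of_le (by norm_num)] at hz
      simp only [plateau]
      rw [Real.smoothTransition.one_of_one_le (x := L + 1 - z) (by linarith [hz.2]), mul_one]
    have e2 : ∫ z in (0 : ℝ)..L, F (plateau w L z) = L * F w := by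
      have : ∫ z in (0 : ℝ)..L, F (plateau w L z) = ∫ z in (0 : ℝ)..L, F w := by
        refine intervalIntegral.integral_congr fun z hz => ?_
        rw [uIcc_of_le hL] at hz
        simp only [plateau]
        rw [Real.smoothTransition.one_of_one_le (x := L + 1 - z) (by linarith [hz.2]),
          Real.smoothTransition.one_of_one_le (x := z + 1) (by linarith [hz.1]), mul_one, mul_one]
      rw [this, intervalIntegral.integral_const, sub_zero, Complex.real_smul]
    have e3 : ∫ z in L..(L + 1), F (plateau w L z)
        = ∫ z in (0 : ℝ)..1, F (w * Real.smoothTransition (1 - z)) := by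
      have := intervalIntegral.integral_comp_add_right (a := 0) (b := 1)
        (fun z => F (plateau w L z)) L
      rw [zero_add, add_comm 1 L] at this
      rw [← this]
      refine intervalIntegral.integral_congr fun z hz => ?_
      rw [uIcc_of_le (by norm_num)] at hz
      simp only [plateau]
      rw [Real.smoothTransition.one_of_one_le (x := z + L + 1) (by linarith [hz.1]), one_mul]
      congr 3
      ring
    rw [e1, e2, e3] at h1
    exact h1
  have k0 := key 0 le_rfl
  have k1 := key 1 zero_le_one
  push_cast at k0 k1
  linear_combination k1 - k0

/-- As `μ̂(v) = exp ∫ ψ(V)` does not vanish, both sides of the evolution equation can be divided by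
it, which leaves an equation between integrals along `V`. -/
theorem isIntrinsicStatisticalSolution_iff
    (ψ : ℝ → ℝ → ℂ) (μ : ℝ → Measure CadlagPath)
    (hLevy : ∀ t : ℝ, 0 ≤ t → IsLevyLaw (μ t)) (hVar : ∀ t : ℝ, 0 ≤ t → HasFiniteVariance (μ t))
    (hExp : ∀ t : ℝ, 0 ≤ t → HasCharExponent (μ t) (ψ t))
    (hDiff : ∀ lam : ℝ, DifferentiableOn ℝ (fun t : ℝ => ψ t lam) (Ici 0))
    (hBdd : TimeDerivLocallyBounded ψ) :
    IsIntrinsicStatisticalSolution μ ↔ SolvesCharExponentEq ψ := by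
  have hc : ∀ t, 0 ≤ t → Continuous (ψ t) := fun t ht =>
    ((hExp t ht).contDiff (hLevy t ht) (hVar t ht)).continuous
  have h0 : ∀ t, 0 ≤ t → ψ t 0 = 0 := fun t ht => (hExp t ht).zero (hLevy t ht)
  have hψ'c : ∀ t, 0 ≤ t → Continuous (deriv (ψ t)) := fun t ht =>
    (hExp t ht).continuous_deriv (hLevy t ht) (hVar t ht)
  have hchar : ∀ v, IsTestFunction v → ∀ t, 0 ≤ t →
      charFunctional (μ t) v = Complex.exp (∫ z, ψ t (tailIntegral v z)) := by
    intro v hv t ht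
    obtain ⟨n, hn, hsupp⟩ := hv.exists_support
    have hsuppn : ∀ y, y ∉ Icc (-(n : ℝ)) n → v y = 0 := fun y hy =>
      hsupp y fun h => hy (Ioo_subset_Icc_self h)
    rw [(hExp t ht).charFunctional_eq (hLevy t ht) (hc t ht) hn hv hsuppn,
      integral_comp_tailIntegral hv hsuppn (h0 t ht)]
  have hderiv : ∀ v, IsTestFunction v → ∀ t, 0 ≤ t →
      HasDerivWithinAt (fun s => charFunctional (μ s) v)
        (charFunctional (μ t) v * ∫ z, timeDeriv ψ t (tailIntegral v z)) (Ici 0) t := by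
    intro v hv t ht
    rw [hchar v hv t ht]
    exact (hasDerivWithinAt_integral_comp_tailIntegral hDiff hBdd hc h0 hv ht).cexp.congr
      (fun s hs => hchar v hv s hs) (hchar v hv t ht)
  -- the integral over the line of the right-hand side of the equation of the exponents
  have hrhs : ∀ v, IsTestFunction v → ∀ t, 0 ≤ t →
      Integrable (fun z => Complex.I * deriv (ψ t) (tailIntegral v z) * ψ t (tailIntegral v z)
        - ((tailIntegral v z ^ 2 / 2 : ℝ) : ℂ)) ∧
      ∫ z, (Complex.I * deriv (ψ t) (tailIntegral v z) * ψ t (tailIntegral v z)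
        - ((tailIntegral v z ^ 2 / 2 : ℝ) : ℂ))
      = Complex.I * (∫ z, ψ t (tailIntegral v z) * deriv (ψ t) (tailIntegral v z))
        - ((1 / 2 * forcingEnergy v : ℝ) : ℂ) := by
    intro v hv t ht
    have i1 : Integrable fun z => ψ t (tailIntegral v z) * deriv (ψ t) (tailIntegral v z) := by
      have hcont : Continuous fun s => ψ t s * deriv (ψ t) s := (hc t ht).mul (hψ'c t ht)
      exact integrable_comp_tailIntegral hv (g := fun s => ψ t s * deriv (ψ t) s)
        (by simp [h0 t ht]) hcont.measurable (exists_bound_abs_le_of_continuous hcont)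
    have i2 : Integrable fun z => ((tailIntegral v z ^ 2 / 2 : ℝ) : ℂ) := by
      have hcont : Continuous fun s : ℝ => ((s ^ 2 / 2 : ℝ) : ℂ) := by fun_prop
      exact integrable_comp_tailIntegral hv (g := fun s => ((s ^ 2 / 2 : ℝ) : ℂ))
        (by simp) hcont.measurable (exists_bound_abs_le_of_continuous hcont)
    have e : ∀ z, Complex.I * deriv (ψ t) (tailIntegral v z) * ψ t (tailIntegral v z)
        = Complex.I * (ψ t (tailIntegral v z) * deriv (ψ t) (tailIntegral v z)) := fun z => by ring
    simp_rw [e]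
    refine ⟨(i1.const_mul _).sub i2, ?_⟩
    rw [integral_sub (i1.const_mul _) i2, integral_const_mul, integral_complex_ofReal,
      integral_div, forcingEnergy_eq hv]
    push_cast
    ring
  constructor
  · intro hsol t ht w
    refine ⟨((hExp t ht).hasDerivAt (hLevy t ht) (hVar t ht) w).differentiableAt, ?_⟩
    have key : timeDeriv ψ t w
        - (Complex.I * deriv (ψ t) w * ψ t w - ((w ^ 2 / 2 : ℝ) : ℂ)) = 0 := by
      have hGc : Continuous fun s : ℝ =>
          Complex.I * deriv (ψ t) s * ψ t s - ((s ^ 2 / 2 : ℝ) : ℂ) := by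
        have := hc t ht
        have := hψ'c t ht
        fun_prop
      have hDb : ∀ R, ∃ C, ∀ s, |s| ≤ R → ‖timeDeriv ψ t s‖ ≤ C := fun R => by
        obtain ⟨C, hC⟩ := hBdd t R
        exact ⟨C, fun s hs => hC t ⟨ht, le_rfl⟩ s (abs_le.1 hs)⟩
      refine eq_zero_of_integral_comp_tailIntegral_eq_zero
        (F := fun s => timeDeriv ψ t s
          - (Complex.I * deriv (ψ t) s * ψ t s - ((s ^ 2 / 2 : ℝ) : ℂ))) ?_ ?_ ?_ ?_ w
      · simp [timeDeriv_zero h0 ht, h0 t ht]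
      · exact (measurable_timeDeriv hDiff hc ht).sub hGc.measurable
      · intro R
        obtain ⟨C, hC⟩ := hDb R
        obtain ⟨D, hD⟩ := exists_bound_abs_le_of_continuous hGc R
        exact ⟨C + D, fun s hs => (norm_sub_le _ _).trans (add_le_add (hC s hs) (hD s hs))⟩
      · intro v hv
        obtain ⟨L, hL, hev⟩ := hsol.evolution v hv t ht
        have hLeq := tendsto_nhds_unique hL
          ((hExp t ht).tendsto_integral_centredFlux (hLevy t ht) (hVar t ht) hv)
        have heq := (uniqueDiffOn_Ici (0 : ℝ) t ht).eq_deriv _ hev (hderiv v hv t ht)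
        have hne : charFunctional (μ t) v ≠ 0 := by
          rw [hchar v hv t ht]; exact Complex.exp_ne_zero _
        rw [integral_sub (integrable_comp_tailIntegral hv (timeDeriv_zero h0 ht)
          (measurable_timeDeriv hDiff hc ht) hDb) (hrhs v hv t ht).1, (hrhs v hv t ht).2]
        refine mul_left_cancel₀ hne ?_
        rw [hLeq] at heq
        linear_combination -heq
    rw [← sub_eq_zero.1 key]
    exact hasDerivWithinAt_timeDeriv hDiff ht w
  · intro hsol
    refine ⟨fun t ht => (hLevy t ht).isProbability, fun v hv t ht a b hab =>
      integrable_centredFlux (hLevy t ht) (hVar t ht) (hExp t ht) hab hv, fun v hv t ht =>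
      ⟨_, (hExp t ht).tendsto_integral_centredFlux (hLevy t ht) (hVar t ht) hv, ?_⟩⟩
    refine (hderiv v hv t ht).congr_deriv ?_
    have : ∀ z, timeDeriv ψ t (tailIntegral v z)
        = Complex.I * deriv (ψ t) (tailIntegral v z) * ψ t (tailIntegral v z)
          - ((tailIntegral v z ^ 2 / 2 : ℝ) : ℂ) := fun z =>
      (hsol t ht _).2.derivWithin (uniqueDiffOn_Ici 0 t ht)
    simp_rw [this]
    rw [(hrhs v hv t ht).2]
    ring

/-! ### Exponential moments of increments without upward jumps -/

/-- Truncated second moments are controlled by the characteristic function near `0`. -/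
lemma integral_min_one_sq_le {ν : Measure ℝ} [IsProbabilityMeasure ν] {η : ℝ}
    (h : ∀ lam : ℝ, |lam| ≤ 2 → ‖1 - charFun ν lam‖ ≤ η) :
    |∫ x, Real.sin x ∂ν| ≤ η ∧ ∫ x, min 1 (x ^ 2) ∂ν ≤ 7 * η := by
  have hcos : Integrable Real.cos ν := Integrable.of_bound (C := 1)
    Real.continuous_cos.aestronglyMeasurable (Eventually.of_forall fun x => Real.abs_cos_le_one x)
  have hsin : Integrable Real.sin ν := Integrable.of_bound (C := 1)
    Real.continuous_sin.aestronglyMeasurable (Eventually.of_forall fun x => Real.abs_sin_le_one x)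
  have h1 : charFun ν 1 = ((∫ x, Real.cos x ∂ν : ℝ) : ℂ)
      + (∫ x, Real.sin x ∂ν : ℝ) * Complex.I := by
    rw [charFun_apply_real, ← integral_complex_ofReal, ← integral_complex_ofReal,
      ← integral_mul_const, ← integral_add hcos.ofReal (hsin.ofReal.mul_const _)]
    congr 1 with x
    rw [Complex.ofReal_one, one_mul, Complex.exp_mul_I, Complex.ofReal_cos, Complex.ofReal_sin]
  have h2 := h 1 (by norm_num)
  rw [h1] at h2
  have hs : |∫ x, Real.sin x ∂ν| ≤ η := by
    refine le_trans ?_ h2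
    refine le_trans (le_of_eq ?_) (Complex.abs_im_le_norm _)
    simp
  have hc : 1 - ∫ x, Real.cos x ∂ν ≤ η := by
    refine le_trans ?_ h2
    refine le_trans (le_trans (le_abs_self _) (le_of_eq ?_)) (Complex.abs_re_le_norm _)
    simp
  have hη : 0 ≤ η := (norm_nonneg _).trans h2
  have htail : ν.real {x | 1 < |x|} ≤ 2 * η := by
    refine (measureReal_abs_gt_le_integral_charFun one_pos).trans ?_
    have : ‖∫ t in (-2 * (1 : ℝ)⁻¹)..(2 * (1 : ℝ)⁻¹), 1 - charFun ν t‖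
        ≤ η * |2 * (1 : ℝ)⁻¹ - -2 * (1 : ℝ)⁻¹| := by
      refine intervalIntegral.norm_integral_le_of_norm_le_const fun t ht => h t ?_
      rw [uIoc_of_le (by norm_num)] at ht
      exact abs_le.2 ⟨by linarith [ht.1], by linarith [ht.2]⟩
    norm_num at this ⊢
    linarith
  refine ⟨hs, ?_⟩
  have hm : MeasurableSet {x : ℝ | 1 < |x|} := measurableSet_lt measurable_const measurable_norm
  have hpt : ∀ x : ℝ, min 1 (x ^ 2) ≤ 5 * (1 - Real.cos x) + {x : ℝ | 1 < |x|}.indicator 1 x := by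
    intro x
    by_cases hx : 1 < |x|
    · rw [indicator_of_mem (by exact hx)]
      have := Real.cos_le_one x
      simp only [Pi.one_apply]
      linarith [min_le_left 1 (x ^ 2)]
    · rw [indicator_of_notMem (by exact hx), add_zero]
      refine (min_le_right _ _).trans ?_
      have h3 := Real.cos_le_one_sub_mul_cos_sq (x := x)
        (by linarith [Real.pi_gt_three, not_lt.1 hx])
      have h4 : 1 / 5 ≤ 2 / Real.pi ^ 2 := by
        rw [div_le_div_iff₀ (by norm_num) (by positivity)]
        nlinarith [Real.pi_lt_d2, Real.pi_pos]
      nlinarith [sq_nonneg x]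
  have hi1 : Integrable (fun x : ℝ => min 1 (x ^ 2)) ν := Integrable.of_bound (C := 1)
    (by fun_prop) (Eventually.of_forall fun x => by
      rw [Real.norm_of_nonneg (le_min zero_le_one (sq_nonneg x))]; exact min_le_left _ _)
  have hi2 : Integrable ({x : ℝ | 1 < |x|}.indicator (1 : ℝ → ℝ)) ν :=
    (integrable_const (1 : ℝ)).indicator hm
  have hi3 : Integrable (fun x => 5 * (1 - Real.cos x)) ν :=
    ((integrable_const 1).sub hcos).const_mul 5
  refine (integral_mono hi1 (hi3.add hi2) hpt).trans ?_
  simp only [Pi.add_apply]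
  rw [integral_add hi3 hi2, integral_const_mul, integral_sub (integrable_const _) hcos,
    integral_indicator_one hm]
  simp only [integral_const, probReal_univ, smul_eq_mul, mul_one]
  linarith

/-- The constant in the second-order expansion of the exponential at frequencies of modulus at
most `R`. -/
def expConst (R : ℝ) : ℝ := R ^ 2 * Real.exp R + R + 2

/-- Second-order expansion of the exponential with a remainder that is bounded on `(-∞, 1]`; the
sine replaces the linear term, whose expectation is not controlled by the characteristic
function. -/
lemma norm_exp_sub_sub_le {R : ℝ} {z : ℂ} (hz : ‖z‖ ≤ R) (him : z.im ≤ 0) {x : ℝ} (hx : x ≤ 1) :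
    ‖Complex.exp (Complex.I * z * x) - 1 - Complex.I * z * Real.sin x‖
      ≤ expConst R * min 1 (x ^ 2) := by
  have hR : 0 ≤ R := (norm_nonneg z).trans hz
  rcases lt_or_ge x (-1) with h | h
  · rw [min_eq_left (by nlinarith), mul_one]
    have h1 : ‖Complex.exp (Complex.I * z * x)‖ ≤ 1 := by
      rw [Complex.norm_exp, Real.exp_le_one_iff]
      simp
      nlinarith
    have h2 : ‖Complex.I * z * (Real.sin x : ℂ)‖ ≤ R := by
      rw [norm_mul, norm_mul, Complex.norm_I, one_mul, Complex.norm_real]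
      exact (mul_le_of_le_one_right (norm_nonneg _) (Real.abs_sin_le_one x)).trans hz
    calc _ ≤ ‖Complex.exp (Complex.I * z * x)‖ + ‖(1 : ℂ)‖ + ‖Complex.I * z * (Real.sin x : ℂ)‖ :=
          (norm_sub_le _ _).trans (add_le_add_left (norm_sub_le _ _) _)
      _ ≤ 1 + 1 + R := by rw [norm_one]; gcongr
      _ ≤ expConst R := by rw [expConst]; nlinarith [Real.exp_pos R, sq_nonneg R]
  · have hx1 : |x| ≤ 1 := abs_le.2 ⟨h, hx⟩
    rw [min_eq_right (by nlinarith [sq_abs x, abs_nonneg x])]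
    have h1 := Complex.norm_exp_sub_sum_le_norm_mul_exp (Complex.I * z * x) 2
    have hy : ‖Complex.I * z * x‖ ≤ R * |x| := by
      rw [norm_mul, norm_mul, Complex.norm_I, one_mul, Complex.norm_real, Real.norm_eq_abs]
      gcongr
    have h2 : ‖Complex.exp (Complex.I * z * x) - 1 - Complex.I * z * x‖
        ≤ x ^ 2 * (R ^ 2 * Real.exp R) := by
      refine le_trans (le_of_eq ?_) (h1.trans ?_)
      · simp [Finset.sum_range_succ, sub_sub]
      · calc _ ≤ (R * |x|) ^ 2 * Real.exp R := by
              gcongr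
              exact hy.trans (mul_le_of_le_one_right hR hx1)
          _ = _ := by rw [mul_pow, sq_abs]; ring
    have h3 : |x - Real.sin x| ≤ x ^ 2 := by
      have hb := Real.sin_bound hx1
      have e : x - Real.sin x = -(Real.sin x - (x - x ^ 3 / 6)) + x ^ 3 / 6 := by ring
      rw [e]
      refine (abs_add_le _ _).trans ?_
      rw [abs_neg, abs_div, abs_pow, abs_of_pos (by norm_num : (0 : ℝ) < 6)]
      have : |x| ^ 3 ≤ x ^ 2 := by
        rw [← sq_abs]; exact pow_le_pow_of_le_one (abs_nonneg x) hx1 (by norm_num)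
      have : |x| ^ 5 ≤ x ^ 2 := by
        rw [← sq_abs]; exact pow_le_pow_of_le_one (abs_nonneg x) hx1 (by norm_num)
      nlinarith [sq_nonneg x]
    have h4 : ‖Complex.I * z * ((x - Real.sin x : ℝ) : ℂ)‖ ≤ x ^ 2 * R := by
      rw [norm_mul, norm_mul, Complex.norm_I, one_mul, Complex.norm_real,
        Real.norm_eq_abs, mul_comm]
      gcongr
    have e : Complex.exp (Complex.I * z * x) - 1 - Complex.I * z * Real.sin x
        = (Complex.exp (Complex.I * z * x) - 1 - Complex.I * z * x)
          + Complex.I * z * ((x - Real.sin x : ℝ) : ℂ) := by push_cast; ring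
    rw [e]
    refine (norm_add_le _ _).trans ((add_le_add h2 h4).trans ?_)
    rw [expConst]
    nlinarith [sq_nonneg x]

lemma abs_exp_sub_sub_le {w : ℝ} (hw : 0 ≤ w) {x : ℝ} (hx : x ≤ 1) :
    |Real.exp (w * x) - 1 - w * Real.sin x| ≤ expConst w * min 1 (x ^ 2) := by
  have h := norm_exp_sub_sub_le (R := w) (z := -Complex.I * w) (by simp [abs_of_nonneg hw])
    (by simpa using hw) hx
  have e : Complex.I * (-Complex.I * w) = w := by
    linear_combination (-(w : ℂ)) * Complex.I_sq
  rw [e] at h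
  rw [← Real.norm_eq_abs, ← Complex.norm_real]
  push_cast
  exact_mod_cast h

lemma expConst_nonneg {R : ℝ} (hR : 0 ≤ R) : 0 ≤ expConst R := by
  rw [expConst]; positivity

lemma add_two_le_expConst {R : ℝ} : R + 2 ≤ expConst R := by
  rw [expConst]
  nlinarith [mul_nonneg (sq_nonneg R) (Real.exp_pos R).le]

/-- Exponential moments truncated at large positive increments. -/
lemma integral_indicator_exp_le {ν : Measure ℝ} [IsProbabilityMeasure ν] {η : ℝ}
    (h : ∀ lam : ℝ, |lam| ≤ 2 → ‖1 - charFun ν lam‖ ≤ η) {w : ℝ} (hw : 0 ≤ w) :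
    ∫ x, (Iic 1).indicator (fun x => Real.exp (w * x)) x ∂ν ≤ 1 + (w + 7 * expConst w) * η := by
  obtain ⟨h1, h2⟩ := integral_min_one_sq_le h
  have hsin : Integrable Real.sin ν := Integrable.of_bound (C := 1)
    Real.continuous_sin.aestronglyMeasurable (Eventually.of_forall fun x => Real.abs_sin_le_one x)
  have hq : Integrable (fun x : ℝ => min 1 (x ^ 2)) ν := Integrable.of_bound (C := 1)
    (by fun_prop) (Eventually.of_forall fun x => by
      rw [Real.norm_of_nonneg (le_min zero_le_one (sq_nonneg x))]; exact min_le_left _ _)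
  have hi : Integrable ((Iic 1).indicator (fun x => Real.exp (w * x))) ν := by
    refine Integrable.of_bound (C := Real.exp w)
      ((by fun_prop : Measurable fun x => Real.exp (w * x)).indicator
        measurableSet_Iic).aestronglyMeasurable (Eventually.of_forall fun x => ?_)
    rw [indicator_apply]
    split_ifs with hx
    · rw [Real.norm_of_nonneg (Real.exp_pos _).le, Real.exp_le_exp]
      exact mul_le_of_le_one_right hw hx
    · simpa using (Real.exp_pos w).le
  have hpt : ∀ x, (Iic 1).indicator (fun x => Real.exp (w * x)) x
      ≤ (1 + w * Real.sin x) + expConst w * min 1 (x ^ 2) := by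
    intro x
    rw [indicator_apply]
    split_ifs with hx
    · linarith [(abs_le.1 (abs_exp_sub_sub_le hw hx)).2]
    · have hx : 1 < x := by simpa using hx
      rw [min_eq_left (by nlinarith)]
      have := add_two_le_expConst (R := w)
      nlinarith [Real.neg_one_le_sin x]
  have hi' : Integrable (fun x => 1 + w * Real.sin x) ν :=
    (integrable_const 1).add (hsin.const_mul w)
  refine (integral_mono hi (hi'.add (hq.const_mul _)) hpt).trans ?_
  simp only [Pi.add_apply]
  rw [integral_add hi' (hq.const_mul _), integral_add (integrable_const 1) (hsin.const_mul w),
    integral_const_mul, integral_const_mul]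
  simp only [integral_const, probReal_univ, smul_eq_mul, mul_one]
  have := expConst_nonneg hw
  nlinarith [(abs_le.1 h1).2]

/-- A càdlàg path without upward jumps has uniformly small upward oscillation. -/
lemma IsCadlag.exists_increment_le_one {u : ℝ → ℝ} (hu : IsCadlag u)
    (hneg : ∀ x l : ℝ, Tendsto u (𝓝[<] x) (𝓝 l) → u x ≤ l) (a b : ℝ) :
    ∃ δ > 0, ∀ s ∈ Icc a b, ∀ t, s ≤ t → t < s + δ → u t - u s ≤ 1 := by
  have hloc : ∀ x : ℝ, ∃ ε > 0, ∀ s ∈ Metric.ball x ε, ∀ t ∈ Metric.ball x ε, s ≤ t →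
      u t - u s ≤ 1 := by
    intro x
    obtain ⟨hr, l, hl⟩ := hu x
    have hxl := hneg x l hl
    have h1 : ∀ᶠ y in 𝓝 x, x ≤ y → dist (u y) (u x) < 1 / 2 :=
      eventually_nhdsWithin_iff.1 (hr.eventually (Metric.ball_mem_nhds _ (by norm_num)))
    have h2 : ∀ᶠ y in 𝓝 x, y < x → dist (u y) l < 1 / 2 :=
      eventually_nhdsWithin_iff.1 (hl.eventually (Metric.ball_mem_nhds _ (by norm_num)))
    obtain ⟨ε, hε, hball⟩ := Metric.eventually_nhds_iff_ball.1 (h1.and h2)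
    refine ⟨ε, hε, fun s hs t ht hst => ?_⟩
    have hs1 := (hball s hs).1
    have hs2 := (hball s hs).2
    have ht1 := (hball t ht).1
    have ht2 := (hball t ht).2
    simp only [Real.dist_eq, abs_lt] at hs1 hs2 ht1 ht2
    rcases lt_or_ge s x with h | h <;> rcases lt_or_ge t x with h' | h'
    · linarith [(hs2 h).1, (ht2 h').2]
    · linarith [(hs2 h).1, (ht1 h').2]
    · linarith
    · linarith [(hs1 h).1, (ht1 h').2]
  choose ε hε hloc using hloc
  obtain ⟨δ, hδ, hcov⟩ := lebesgue_number_lemma_of_metric (isCompact_Icc (a := a) (b := b))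
    (c := fun x => Metric.ball x (ε x)) (fun x => Metric.isOpen_ball)
    (fun x _ => mem_iUnion.2 ⟨x, Metric.mem_ball_self (hε x)⟩)
  refine ⟨δ, hδ, fun s hs t hst hts => ?_⟩
  obtain ⟨x, hx⟩ := hcov s hs
  refine hloc x s (hx (Metric.mem_ball_self hδ)) t (hx ?_) hst
  rw [Metric.mem_ball, Real.dist_eq, abs_of_nonneg (by linarith)]
  linarith

/-- The factor `2` covers the range `h ‖ψ‖ > 1`, where the left-hand side is merely at most `2`. -/
lemma HasCharExponent.norm_one_sub_charFun_le {μ : Measure CadlagPath} {ψ : ℝ → ℂ}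
    (hμ : IsLevyLaw μ) (hψ : HasCharExponent μ ψ) {B : ℝ} {lam : ℝ} (hB : ‖ψ lam‖ ≤ B) {h : ℝ}
    (hh : 0 < h) : ‖1 - charFun (incrLaw μ h) lam‖ ≤ 2 * h * B := by
  have := hμ.isProbabilityMeasure_incrLaw h
  rcases le_or_gt (h * ‖ψ lam‖) 1 with h1 | h1
  · rw [hψ.charFun_incrLaw hh, norm_sub_rev]
    have h2 : ‖(h : ℂ) * ψ lam‖ = h * ‖ψ lam‖ := by
      rw [norm_mul, Complex.norm_real, Real.norm_of_nonneg hh.le]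
    refine (Complex.norm_exp_sub_one_le (by rw [h2]; exact h1)).trans ?_
    rw [h2]
    nlinarith
  · refine norm_one_sub_charFun_le_two.trans ?_
    nlinarith

/-- The exponential moments of the increments. The increment over an interval is cut into many
small ones, which eventually are all at most `1`; Fatou's lemma and independence conclude. -/
lemma lintegral_exp_increment_le {μ : Measure CadlagPath} {ψ : ℝ → ℂ}
    (hμ : IsLevyLaw μ) (hψ : HasCharExponent μ ψ) (hneg : HasNegativeJumps μ) {B : ℝ}
    (hB : ∀ lam : ℝ, |lam| ≤ 2 → ‖ψ lam‖ ≤ B) {w : ℝ} (hw : 0 ≤ w) {h : ℝ} (hh : 0 < h) :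
    ∫⁻ u : CadlagPath, ENNReal.ofReal (Real.exp (w * (u h - u 0))) ∂μ
      ≤ ENNReal.ofReal (Real.exp (h * ((w + 7 * expConst w) * (2 * B)))) := by
  have := hμ.isProbability
  set K := (w + 7 * expConst w) * (2 * B) with hK
  have hB0 : 0 ≤ B := (norm_nonneg _).trans (hB 0 (by norm_num))
  have hK0 : 0 ≤ K := by
    have := expConst_nonneg hw
    positivity
  set f : ℝ → ℝ := (Iic 1).indicator (fun x => Real.exp (w * x)) with hf
  have hfm : Measurable f := (by fun_prop : Measurable fun x => Real.exp (w * x)).indicator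
    measurableSet_Iic
  have hf0 : ∀ x, 0 ≤ f x := fun x => indicator_nonneg (fun _ _ => (Real.exp_pos _).le) x
  have hf1 : ∀ x, f x ≤ Real.exp w := fun x => by
    rw [hf, indicator_apply]
    split_ifs with hx
    · rw [Real.exp_le_exp]; exact mul_le_of_le_one_right hw hx
    · exact (Real.exp_pos w).le
  -- `p n k` are the nodes of the subdivision of `[0, h]` into `n + 1` equal intervals, and `G n` is
  -- the exponential of the increment, killed if some increment over a subinterval exceeds `1`
  let p : ℕ → ℕ → ℝ := fun n k => k * (h / (n + 1))
  have hstep : ∀ n : ℕ, 0 < h / ((n : ℝ) + 1) := fun n => by positivity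
  have hp_succ : ∀ n k, p n (k + 1) - p n k = h / (n + 1) := fun n k => by
    simp only [p]; push_cast; ring
  have hp_mono : ∀ n, Monotone (p n) := fun n => monotone_nat_of_le_succ fun k => by
    linarith [hp_succ n k, hstep n]
  have hp_zero : ∀ n, p n 0 = 0 := fun n => by simp [p]
  have hp_last : ∀ n, p n (n + 1) = h := fun n => by
    simp only [p]
    have : (n : ℝ) + 1 ≠ 0 := by positivity
    push_cast
    field_simp
  let G : ℕ → CadlagPath → ℝ := fun n u => ∏ k : Fin (n + 1), f (u (p n (k + 1)) - u (p n k))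
  have hGm : ∀ n, Measurable (G n) := fun n =>
    Finset.measurable_fun_prod _ fun k _ => hfm.comp (measurable_increment _ _)
  have hG0 : ∀ n u, 0 ≤ G n u := fun n u => Finset.prod_nonneg fun k _ => hf0 _
  have hG : ∀ n, ∫⁻ u, ENNReal.ofReal (G n u) ∂μ ≤ ENNReal.ofReal (Real.exp (h * K)) := by
    intro n
    have hGi : Integrable (G n) μ := by
      refine Integrable.of_bound (C := ∏ _k : Fin (n + 1), Real.exp w) (hGm n).aestronglyMeasurable
        (Eventually.of_forall fun u => ?_)
      rw [Real.norm_of_nonneg (hG0 n u)]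
      exact Finset.prod_le_prod (fun k _ => hf0 _) fun k _ => hf1 _
    rw [← ofReal_integral_eq_lintegral_ofReal hGi (Eventually.of_forall (hG0 n))]
    refine ENNReal.ofReal_le_ofReal ?_
    have hind := (hμ.indep.nat (hp_mono n)).precomp
      (g := fun i : Fin (n + 1) => (i : ℕ)) Fin.val_injective
    have h1 := hind.integral_fun_prod_comp (𝕜 := ℝ) (f := fun (_ : Fin (n + 1)) => f)
      (fun i => (measurable_increment _ _).aemeasurable) (fun i => hfm.aestronglyMeasurable)
    have h2 : ∀ k : Fin (n + 1), ∫ u : CadlagPath, f (u (p n (k + 1)) - u (p n k)) ∂μ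
        ≤ Real.exp (h / (n + 1) * K) := by
      intro k
      have e1 : ∫ u : CadlagPath, f (u (p n (k + 1)) - u (p n k)) ∂μ
          = ∫ x, f x ∂(incrLaw μ (h / (n + 1))) := by
        rw [← hp_succ n k, ← hμ.map_increment, integral_map
          (measurable_increment _ _).aemeasurable hfm.aestronglyMeasurable]
      have := hμ.isProbabilityMeasure_incrLaw (h / (n + 1))
      rw [e1]
      refine (integral_indicator_exp_le (fun lam hlam =>
        hψ.norm_one_sub_charFun_le hμ (hB lam hlam) (hstep n)) hw).trans ?_
      refine le_trans (le_of_eq ?_) (Real.add_one_le_exp _)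
      rw [hK]; ring
    calc ∫ u, G n u ∂μ =
          ∏ k : Fin (n + 1), ∫ u : CadlagPath, f (u (p n (k + 1)) - u (p n k)) ∂μ := h1
      _ ≤ ∏ _k : Fin (n + 1), Real.exp (h / (n + 1) * K) :=
        Finset.prod_le_prod (fun k _ => integral_nonneg fun u => hf0 _) fun k _ => h2 k
      _ = Real.exp (h * K) := by
        rw [Finset.prod_const, Finset.card_univ, Fintype.card_fin, ← Real.exp_nat_mul]
        congr 1
        have : (n : ℝ) + 1 ≠ 0 := by positivity
        push_cast
        field_simp
  have hev : ∀ᵐ u : CadlagPath ∂μ, ENNReal.ofReal (Real.exp (w * (u h - u 0)))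
      = liminf (fun n => ENNReal.ofReal (G n u)) atTop := by
    filter_upwards [hneg] with u hu
    obtain ⟨δ, hδ, hosc⟩ := u.cadlag.exists_increment_le_one hu 0 h
    have h1 : Tendsto (fun n : ℕ => h / ((n : ℝ) + 1)) atTop (𝓝 0) := by
      simpa using (tendsto_one_div_add_atTop_nhds_zero_nat (𝕜 := ℝ)).const_mul h |>.congr
        fun n => by ring
    -- once the mesh is fine enough nothing is killed, and the product telescopes
    have h2 : ∀ᶠ n : ℕ in atTop, ENNReal.ofReal (Real.exp (w * (u h - u 0)))
        = ENNReal.ofReal (G n u) := by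
      filter_upwards [h1.eventually (Iio_mem_nhds hδ)] with n hn
      congr 1
      have h3 : ∀ k : Fin (n + 1), f (u (p n (k + 1)) - u (p n k))
          = Real.exp (w * (u (p n (k + 1)) - u (p n k))) := by
        intro k
        refine indicator_of_mem ?_ _
        refine hosc _ ⟨?_, ?_⟩ _ (hp_mono n (Nat.le_succ _)) ?_
        · rw [← hp_zero n]; exact hp_mono n (Nat.zero_le _)
        · rw [← hp_last n]; exact hp_mono n k.2.le
        · have := hp_succ n k
          have hn : h / ((n : ℝ) + 1) < δ := hn
          linarith
      simp only [G, h3]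
      rw [← Real.exp_sum, ← Finset.mul_sum, Fin.sum_univ_eq_sum_range
        (fun k => u (p n (k + 1)) - u (p n k)) (n + 1),
        Finset.sum_range_sub (fun k => u (p n k)), hp_last, hp_zero]
    exact (Tendsto.liminf_eq ((tendsto_congr' h2).1 tendsto_const_nhds)).symm
  rw [lintegral_congr_ae hev]
  refine (lintegral_liminf_le fun n => (hGm n).ennreal_ofReal).trans ?_
  refine (liminf_le_liminf (Eventually.of_forall hG)).trans ?_
  simp

/-! ### Holomorphic functions on the lower half-plane -/

/-- The open lower half-plane. -/
def lowerHalf : Set ℂ := {z : ℂ | z.im < 0}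

lemma isOpen_lowerHalf : IsOpen lowerHalf := isOpen_lt Complex.continuous_im continuous_const

lemma closure_lowerHalf : closure lowerHalf = {z : ℂ | z.im ≤ 0} :=
  Complex.closure_setOfPred_im_lt 0

/-- A two-constants estimate: a function on the lower half-plane that is small on the real axis is
small inside. The maximum principle is applied to the product of the four functions obtained by
rotating the square centred at `c` with one side on the real axis. -/
lemma norm_pow_four_le {D : ℂ → ℂ} (hD : DiffContOnCl ℂ D lowerHalf) {c : ℂ} (hc : c.im < 0)
    {M ε : ℝ} (hM : ∀ z : ℂ, z.im ≤ 0 → ‖z‖ ≤ 3 * ‖c‖ → ‖D z‖ ≤ M)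
    (hε : ∀ x : ℝ, |x| ≤ 3 * ‖c‖ → ‖D x‖ ≤ ε) : ‖D c‖ ^ 4 ≤ ε * M ^ 3 := by
  set d : ℝ := -c.im with hd
  have hd0 : 0 < d := by linarith
  set U : Set ℂ := Ioo (c.re - d) (c.re + d) ×ℂ Ioo (c.im - d) (c.im + d) with hU
  have hUb : Bornology.IsBounded U := (Metric.isBounded_Ioo _ _).reProdIm (Metric.isBounded_Ioo _ _)
  have hUo : IsOpen U := isOpen_Ioo.reProdIm isOpen_Ioo
  have hUcl : closure U = Icc (c.re - d) (c.re + d) ×ℂ Icc (c.im - d) (c.im + d) := by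
    rw [hU, Complex.closure_reProdIm, closure_Ioo (by linarith), closure_Ioo (by linarith)]
  have hcU : c ∈ U := by
    simp only [hU, Complex.mem_reProdIm, mem_Ioo]
    refine ⟨⟨?_, ?_⟩, ?_, ?_⟩ <;> linarith
  let ρ : ℕ → ℂ → ℂ := fun k z => c + Complex.I ^ k * (z - c)
  have hρ0 : ∀ z, ρ 0 z = z := fun z => by simp [ρ]
  have hρ1 : ∀ z, (ρ 1 z).re = c.re - (z.im - c.im) ∧ (ρ 1 z).im = c.im + (z.re - c.re) := by
    intro z; simp [ρ]; ring
  have hρ2 : ∀ z, (ρ 2 z).re = c.re - (z.re - c.re) ∧ (ρ 2 z).im = c.im - (z.im - c.im) := by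
    intro z; simp [ρ, Complex.I_sq]; constructor <;> ring
  have hρ3 : ∀ z, (ρ 3 z).re = c.re + (z.im - c.im) ∧ (ρ 3 z).im = c.im - (z.re - c.re) := by
    intro z; simp [ρ, pow_succ]; ring
  -- the rotations preserve the closed square and hence the closed half-plane
  have hρcl : ∀ k ∈ Finset.range 4, ∀ z ∈ closure U, ρ k z ∈ closure U := by
    intro k hk z hz
    rw [hUcl, Complex.mem_reProdIm, mem_Icc, mem_Icc] at hz ⊢
    obtain ⟨⟨h1, h2⟩, h3, h4⟩ := hz
    have hk4 := Finset.mem_range.1 hk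
    interval_cases k
    · rw [hρ0]; exact ⟨⟨h1, h2⟩, h3, h4⟩
    · rw [(hρ1 z).1, (hρ1 z).2]; refine ⟨⟨?_, ?_⟩, ?_, ?_⟩ <;> linarith
    · rw [(hρ2 z).1, (hρ2 z).2]; refine ⟨⟨?_, ?_⟩, ?_, ?_⟩ <;> linarith
    · rw [(hρ3 z).1, (hρ3 z).2]; refine ⟨⟨?_, ?_⟩, ?_, ?_⟩ <;> linarith
  have hρU : ∀ k ∈ Finset.range 4, ∀ z ∈ U, ρ k z ∈ lowerHalf := by
    intro k hk z hz
    rw [hU, Complex.mem_reProdIm, mem_Ioo, mem_Ioo] at hz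
    obtain ⟨⟨h1, h2⟩, h3, h4⟩ := hz
    have hk4 := Finset.mem_range.1 hk
    change (ρ k z).im < 0
    interval_cases k
    · rw [hρ0]; linarith
    · rw [(hρ1 z).2]; linarith
    · rw [(hρ2 z).2]; linarith
    · rw [(hρ3 z).2]; linarith
  have hclim : ∀ z ∈ closure U, z.im ≤ 0 ∧ ‖z‖ ≤ 3 * ‖c‖ := by
    intro z hz
    rw [hUcl, Complex.mem_reProdIm, mem_Icc, mem_Icc] at hz
    obtain ⟨⟨h1, h2⟩, h3, h4⟩ := hz
    refine ⟨by linarith, ?_⟩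
    have hdc : d ≤ ‖c‖ := by
      have := Complex.abs_im_le_norm c
      rw [abs_of_neg hc] at this
      exact this
    have h5 : ‖z - c‖ ≤ |(z - c).re| + |(z - c).im| := Complex.norm_le_abs_re_add_abs_im _
    have h6 : |(z - c).re| ≤ d := by rw [Complex.sub_re, abs_le]; constructor <;> linarith
    have h7 : |(z - c).im| ≤ d := by rw [Complex.sub_im, abs_le]; constructor <;> linarith
    have h8 : ‖z‖ ≤ ‖z - c‖ + ‖c‖ := by simpa using norm_add_le (z - c) c
    linarith
  set g : ℂ → ℂ := fun z => ∏ k ∈ Finset.range 4, D (ρ k z) with hg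
  have hfac : ∀ k ∈ Finset.range 4, DiffContOnCl ℂ (fun z => D (ρ k z)) U := by
    intro k hk
    have h1 : DiffContOnCl ℂ (ρ k) U := by
      have : Differentiable ℂ (ρ k) := by fun_prop
      exact this.diffContOnCl
    exact hD.comp h1 (fun z hz => hρU k hk z hz)
  have hgd : DiffContOnCl ℂ g U := by
    have e : g = fun z => D (ρ 0 z) * D (ρ 1 z) * D (ρ 2 z) * D (ρ 3 z) := by
      ext z; simp [hg, Finset.prod_range_succ]
    rw [e]
    have f0 := hfac 0 (by simp)
    have f1 := hfac 1 (by simp)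
    have f2 := hfac 2 (by simp)
    have f3 := hfac 3 (by simp)
    exact ⟨((f0.1.fun_mul f1.1).fun_mul f2.1).fun_mul f3.1,
      ((f0.2.mul f1.2).mul f2.2).mul f3.2⟩
  have hM0 : 0 ≤ M := (norm_nonneg _).trans (hM c hc.le (by linarith [norm_nonneg c]))
  have hε0 : 0 ≤ ε := (norm_nonneg _).trans (hε 0 (by simp))
  have hfront : ∀ z ∈ frontier U, ‖g z‖ ≤ ε * M ^ 3 := by
    intro z hz
    have hzcl : z ∈ closure U := frontier_subset_closure hz
    have hznot : z ∉ U := fun h => by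
      rw [hUo.frontier_eq] at hz; exact hz.2 h
    have hall : ∀ k ∈ Finset.range 4, ‖D (ρ k z)‖ ≤ M := fun k hk =>
      hM _ (hclim _ (hρcl k hk z hzcl)).1 (hclim _ (hρcl k hk z hzcl)).2
    -- one of the rotations takes the side containing `z` to the side on the real axis
    have hex : ∃ k ∈ Finset.range 4, (ρ k z).im = 0 := by
      have hzcl' := hzcl
      rw [hUcl, Complex.mem_reProdIm, mem_Icc, mem_Icc] at hzcl'
      obtain ⟨⟨h1, h2⟩, h3, h4⟩ := hzcl'
      by_contra! hno
      apply hznot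
      have n0 := hno 0 (by simp)
      have n1 := hno 1 (by simp)
      have n2 := hno 2 (by simp)
      have n3 := hno 3 (by simp)
      rw [hρ0] at n0
      rw [(hρ1 z).2] at n1
      rw [(hρ2 z).2] at n2
      rw [(hρ3 z).2] at n3
      rw [hU, Complex.mem_reProdIm, mem_Ioo, mem_Ioo]
      refine ⟨⟨lt_of_le_of_ne h1 fun h => n3 ?_, lt_of_le_of_ne h2 fun h => n1 ?_⟩,
        lt_of_le_of_ne h3 fun h => n2 ?_, lt_of_le_of_ne h4 fun h => n0 ?_⟩ <;> linarith
    obtain ⟨k, hk, hk0⟩ := hex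
    have hsmall : ‖D (ρ k z)‖ ≤ ε := by
      have e : ρ k z = ((ρ k z).re : ℂ) := by
        apply Complex.ext <;> simp [hk0]
      rw [e]
      refine hε _ ?_
      exact (Complex.abs_re_le_norm _).trans (hclim _ (hρcl k hk z hzcl)).2
    rw [hg]
    simp only
    rw [norm_prod, ← Finset.mul_prod_erase _ _ hk]
    refine mul_le_mul hsmall ?_ (Finset.prod_nonneg fun _ _ => norm_nonneg _) hε0
    refine (Finset.prod_le_prod (fun _ _ => norm_nonneg _) fun j hj =>
      hall j (Finset.mem_of_mem_erase hj)).trans (le_of_eq ?_)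
    rw [Finset.prod_const, Finset.card_erase_of_mem hk, Finset.card_range]
  have := Complex.norm_le_of_forall_mem_frontier_norm_le hUb hgd hfront (subset_closure hcU)
  have hgc : ‖g c‖ = ‖D c‖ ^ 4 := by
    simp [hg, ρ]
  rwa [hgc] at this

lemma exists_bound_of_diffContOnCl {D : ℂ → ℂ} (hD : DiffContOnCl ℂ D lowerHalf) (R : ℝ) :
    ∃ M : ℝ, ∀ z : ℂ, z.im ≤ 0 → ‖z‖ ≤ R → ‖D z‖ ≤ M := by
  have hcomp : IsCompact ({z : ℂ | z.im ≤ 0} ∩ Metric.closedBall 0 R) :=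
    (isCompact_closedBall 0 R).inter_left (isClosed_le Complex.continuous_im continuous_const)
  have hcont : ContinuousOn D ({z : ℂ | z.im ≤ 0} ∩ Metric.closedBall 0 R) := by
    have := hD.continuousOn
    rw [closure_lowerHalf] at this
    exact this.mono inter_subset_left
  obtain ⟨M, hM⟩ := hcomp.exists_bound_of_continuousOn hcont
  exact ⟨M, fun z hz hzR => hM z ⟨hz, by simpa using hzR⟩⟩

/-- A function on the closed lower half-plane is determined by its values on the real axis. -/
lemma eq_of_eq_on_real {f g : ℂ → ℂ} (hf : DiffContOnCl ℂ f lowerHalf)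
    (hg : DiffContOnCl ℂ g lowerHalf) (h : ∀ x : ℝ, f x = g x) {z : ℂ} (hz : z.im ≤ 0) :
    f z = g z := by
  rcases eq_or_lt_of_le hz with h0 | h0
  · have e : z = (z.re : ℂ) := by apply Complex.ext <;> simp [h0]
    rw [e]; exact h _
  · obtain ⟨M, hM⟩ := exists_bound_of_diffContOnCl (hf.sub hg) (3 * ‖z‖)
    have := norm_pow_four_le (hf.sub hg) h0 (ε := 0) hM (fun x _ => by simp [h x])
    rw [zero_mul] at this
    have h1 : ‖(f - g) z‖ = 0 := pow_eq_zero_iff (by norm_num) |>.1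
      (le_antisymm this (by positivity))
    exact sub_eq_zero.1 (norm_eq_zero.1 h1)

/-! ### The characteristic function in the lower half-plane -/

/-- The extension `z ↦ E exp (i z X)` of the characteristic function to complex frequencies. -/
def charFunExt (ν : Measure ℝ) (z : ℂ) : ℂ := ∫ x, Complex.exp (Complex.I * z * x) ∂ν

lemma norm_exp_I_mul (z : ℂ) (x : ℝ) :
    ‖Complex.exp (Complex.I * z * x)‖ = Real.exp (-z.im * x) := by
  rw [Complex.norm_exp]; simp

lemma charFunExt_ofReal (ν : Measure ℝ) (x : ℝ) : charFunExt ν x = charFun ν x := by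
  rw [charFun_apply_real, charFunExt]
  congr 1 with y
  congr 1
  ring

lemma charFunExt_neg_I_mul (ν : Measure ℝ) (w : ℝ) :
    charFunExt ν (-Complex.I * w) = ((∫ x, Real.exp (w * x) ∂ν : ℝ) : ℂ) := by
  rw [charFunExt, ← integral_complex_ofReal]
  congr 1 with x
  push_cast
  congr 1
  linear_combination (-(w : ℂ) * x) * Complex.I_sq

/-- All exponential moments `E exp (w X)`, `w ≥ 0`, are finite. -/
def HasExpMoments (ν : Measure ℝ) : Prop :=
  ∀ w : ℝ, 0 ≤ w → Integrable (fun x => Real.exp (w * x)) ν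

lemma HasExpMoments.integrable_charFunExt {ν : Measure ℝ} (hν : HasExpMoments ν) {z : ℂ}
    (hz : z.im ≤ 0) : Integrable (fun x : ℝ => Complex.exp (Complex.I * z * x)) ν :=
  (hν (-z.im) (by linarith)).mono' (by fun_prop)
    (Eventually.of_forall fun x => (norm_exp_I_mul z x).le)

lemma HasExpMoments.mem_interior {ν : Measure ℝ} (hν : HasExpMoments ν) {w : ℝ} (hw : 0 < w) :
    w ∈ interior (integrableExpSet id ν) := by
  have hsub : Ioi (0 : ℝ) ⊆ integrableExpSet id ν := fun s hs => by
    simpa [integrableExpSet] using hν s (le_of_lt (mem_Ioi.1 hs))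
  exact interior_mono hsub (by rw [interior_Ioi]; exact mem_Ioi.2 hw)

lemma HasExpMoments.hasDerivAt_charFunExt {ν : Measure ℝ} (hν : HasExpMoments ν) {z : ℂ}
    (hz : z.im < 0) : HasDerivAt (charFunExt ν)
      (Complex.I * ∫ x : ℝ, x * Complex.exp (Complex.I * z * x) ∂ν) z := by
  have h1 : HasDerivAt (complexMGF id ν)
      (∫ x : ℝ, x * Complex.exp (Complex.I * z * x) ∂ν) (Complex.I * z) :=
    hasDerivAt_complexMGF (hν.mem_interior (by simpa using hz))
  have h2 : HasDerivAt (fun z : ℂ => Complex.I * z) Complex.I z := by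
    simpa using (hasDerivAt_id z).const_mul Complex.I
  exact (h1.comp z h2).congr_deriv (by ring)

lemma HasExpMoments.continuousOn_charFunExt {ν : Measure ℝ} [IsFiniteMeasure ν]
    (hν : HasExpMoments ν) :
    ContinuousOn (charFunExt ν) {z : ℂ | z.im ≤ 0} := by
  intro z hz
  refine continuousWithinAt_of_dominated (bound := fun x => 1 + Real.exp ((‖z‖ + 1) * x))
    (Eventually.of_forall fun _ => by fun_prop) ?_
    ((integrable_const _).add (hν _ (by positivity)))
    (Eventually.of_forall fun x => Continuous.continuousWithinAt (by fun_prop))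
  filter_upwards [self_mem_nhdsWithin, mem_nhdsWithin_of_mem_nhds
    (Metric.ball_mem_nhds z one_pos)] with y hy hyz
  refine Eventually.of_forall fun x => ?_
  rw [norm_exp_I_mul]
  have hy0 : y.im ≤ 0 := hy
  rcases le_or_gt x 0 with hx | hx
  · have : Real.exp (-y.im * x) ≤ 1 := Real.exp_le_one_iff.2 (by nlinarith)
    linarith [Real.exp_pos ((‖z‖ + 1) * x)]
  · have h1 : -y.im ≤ ‖z‖ + 1 := by
      have h2 : -y.im ≤ ‖y‖ := (neg_le_abs _).trans (Complex.abs_im_le_norm y)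
      have h3 : ‖y‖ ≤ ‖y - z‖ + ‖z‖ := by simpa using norm_add_le (y - z) z
      rw [Metric.mem_ball, dist_eq_norm] at hyz
      linarith
    have : Real.exp (-y.im * x) ≤ Real.exp ((‖z‖ + 1) * x) :=
      Real.exp_le_exp.2 (mul_le_mul_of_nonneg_right h1 hx.le)
    linarith

lemma HasExpMoments.diffContOnCl {ν : Measure ℝ} [IsFiniteMeasure ν] (hν : HasExpMoments ν) :
    DiffContOnCl ℂ (charFunExt ν) lowerHalf :=
  ⟨fun _ hz => (hν.hasDerivAt_charFunExt hz).differentiableAt.differentiableWithinAt, by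
    rw [closure_lowerHalf]; exact hν.continuousOn_charFunExt⟩

/-- The exponential moments of the increments are finite, and close to `1` for short intervals,
uniformly in terms of a bound of the exponent near the origin. -/
lemma exists_norm_charFunExt_sub_one_le (B : ℝ) {R : ℝ} (hR : 0 ≤ R) :
    ∃ C : ℝ, 0 ≤ C ∧ ∀ (μ : Measure CadlagPath) (ψ : ℝ → ℂ), IsLevyLaw μ → HasCharExponent μ ψ →
      HasNegativeJumps μ → (∀ lam : ℝ, |lam| ≤ 2 → ‖ψ lam‖ ≤ B) → ∀ h ∈ Ioc (0 : ℝ) 1,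
      HasExpMoments (incrLaw μ h) ∧
      ∀ z : ℂ, z.im ≤ 0 → ‖z‖ ≤ R → ‖charFunExt (incrLaw μ h) z - 1‖ ≤ C * h := by
  set B' := max B 0 with hB'
  have hB'0 : 0 ≤ B' := le_max_right _ _
  set E := expConst R with hE
  have hE0 : 0 ≤ E := expConst_nonneg hR
  set K := (R + 7 * E) * (2 * B') with hK
  have hK0 : 0 ≤ K := by positivity
  refine ⟨R * (2 * B') + E * (7 * (2 * B')) + (2 + R) * (K * Real.exp K + R * (2 * B')
    + E * (7 * (2 * B'))), by positivity, fun μ ψ hμ hψ hneg hB h hh => ?_⟩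
  have hB2 : ∀ lam : ℝ, |lam| ≤ 2 → ‖ψ lam‖ ≤ B' := fun lam hlam =>
    (hB lam hlam).trans (le_max_left _ _)
  set ν := incrLaw μ h with hν
  have : IsProbabilityMeasure ν := hμ.isProbabilityMeasure_incrLaw h
  have hη : ∀ lam : ℝ, |lam| ≤ 2 → ‖1 - charFun ν lam‖ ≤ 2 * h * B' := fun lam hlam =>
    hψ.norm_one_sub_charFun_le hμ (hB2 lam hlam) hh.1
  have hlint : ∀ w : ℝ, 0 ≤ w → ∫⁻ x, ENNReal.ofReal (Real.exp (w * x)) ∂ν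
      ≤ ENNReal.ofReal (Real.exp (h * ((w + 7 * expConst w) * (2 * B')))) := by
    intro w hw
    rw [hν, incrLaw, lintegral_map (by fun_prop) (measurable_increment _ _)]
    exact lintegral_exp_increment_le hμ hψ hneg hB2 hw hh.1
  have hmom : HasExpMoments ν := by
    intro w hw
    refine ⟨by fun_prop, ?_⟩
    rw [hasFiniteIntegral_iff_ofReal (Eventually.of_forall fun x => (Real.exp_pos _).le)]
    exact (hlint w hw).trans_lt ENNReal.ofReal_lt_top
  refine ⟨hmom, fun z hz hzR => ?_⟩
  have hexpR : ∫ x, Real.exp (R * x) ∂ν ≤ Real.exp (h * K) := by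
    have := hlint R hR
    rw [← ofReal_integral_eq_lintegral_ofReal (hmom R hR)
      (Eventually.of_forall fun x => (Real.exp_pos _).le)] at this
    exact (ENNReal.ofReal_le_ofReal_iff (Real.exp_pos _).le).1 this
  obtain ⟨hs, hq⟩ := integral_min_one_sq_le hη
  have hsin : Integrable Real.sin ν := Integrable.of_bound (C := 1)
    Real.continuous_sin.aestronglyMeasurable (Eventually.of_forall fun x => Real.abs_sin_le_one x)
  have hqi : Integrable (fun x : ℝ => min 1 (x ^ 2)) ν := Integrable.of_bound (C := 1)
    (by fun_prop) (Eventually.of_forall fun x => by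
      rw [Real.norm_of_nonneg (le_min zero_le_one (sq_nonneg x))]; exact min_le_left _ _)
  -- the remainder is dominated by a nonnegative function with a small integral
  have hpt : ∀ x : ℝ, ‖Complex.exp (Complex.I * z * x) - 1 - Complex.I * z * Real.sin x‖
      ≤ E * min 1 (x ^ 2)
        + (2 + R) * (Real.exp (R * x) - 1 - R * Real.sin x + E * min 1 (x ^ 2)) := by
    intro x
    have hq0 : 0 ≤ min 1 (x ^ 2) := le_min zero_le_one (sq_nonneg x)
    rcases le_or_gt x 1 with hx | hx
    · have h1 := norm_exp_sub_sub_le hzR hz hx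
      have h2 := (abs_le.1 (abs_exp_sub_sub_le hR hx)).1
      have : 0 ≤ (2 + R) * (Real.exp (R * x) - 1 - R * Real.sin x + E * min 1 (x ^ 2)) :=
        mul_nonneg (by linarith) (by linarith)
      linarith
    · have hE2 : R + 2 ≤ E := add_two_le_expConst
      rw [min_eq_left (by nlinarith), mul_one]
      have h1 : ‖Complex.exp (Complex.I * z * x)‖ ≤ Real.exp (R * x) := by
        rw [norm_exp_I_mul, Real.exp_le_exp]
        have : -z.im ≤ R := ((neg_le_abs _).trans (Complex.abs_im_le_norm z)).trans hzR
        nlinarith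
      have h2 : ‖Complex.I * z * (Real.sin x : ℂ)‖ ≤ R := by
        rw [norm_mul, norm_mul, Complex.norm_I, one_mul, Complex.norm_real]
        exact (mul_le_of_le_one_right (norm_nonneg _) (Real.abs_sin_le_one x)).trans hzR
      have h3 : 1 ≤ Real.exp (R * x) := Real.one_le_exp (by nlinarith)
      have h4 : R * Real.sin x ≤ R := mul_le_of_le_one_right hR (Real.sin_le_one x)
      calc ‖Complex.exp (Complex.I * z * x) - 1 - Complex.I * z * Real.sin x‖
          ≤ ‖Complex.exp (Complex.I * z * x)‖ + ‖(1 : ℂ)‖ + ‖Complex.I * z * (Real.sin x : ℂ)‖ :=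
            (norm_sub_le _ _).trans (add_le_add_left (norm_sub_le _ _) _)
        _ ≤ Real.exp (R * x) + 1 + R := by rw [norm_one]; gcongr
        _ ≤ (2 + R) * Real.exp (R * x) := by nlinarith
        _ ≤ E + (2 + R) * (Real.exp (R * x) - 1 - R * Real.sin x + E) := by nlinarith
  have hexpi := hmom R hR
  have hdom0 : Integrable (fun x => Real.exp (R * x) - 1) ν := hexpi.sub (integrable_const _)
  have hdom1 : Integrable (fun x => Real.exp (R * x) - 1 - R * Real.sin x) ν :=
    hdom0.sub (hsin.const_mul R)
  have hdom2 : Integrable (fun x => Real.exp (R * x) - 1 - R * Real.sin x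
      + E * min 1 (x ^ 2)) ν := hdom1.add (hqi.const_mul E)
  have hzi := hmom.integrable_charFunExt hz
  have hzi1 : Integrable (fun x : ℝ => Complex.exp (Complex.I * z * x) - 1) ν :=
    hzi.sub (integrable_const _)
  have hsini : Integrable (fun x : ℝ => Complex.I * z * Real.sin x) ν :=
    hsin.ofReal.const_mul _
  have e : charFunExt ν z - 1 = (∫ x : ℝ, (Complex.exp (Complex.I * z * x) - 1
      - Complex.I * z * Real.sin x) ∂ν) + Complex.I * z * ((∫ x, Real.sin x ∂ν : ℝ) : ℂ) := by
    rw [integral_sub hzi1 hsini, integral_sub hzi (integrable_const _), integral_const_mul,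
      integral_complex_ofReal, charFunExt]
    simp
  have hI1 : ‖∫ x : ℝ, (Complex.exp (Complex.I * z * x) - 1 - Complex.I * z * Real.sin x) ∂ν‖
      ≤ E * (7 * (2 * h * B')) + (2 + R) * ((Real.exp (h * K) - 1) + R * (2 * h * B')
        + E * (7 * (2 * h * B'))) := by
    refine (norm_integral_le_integral_norm _).trans ((integral_mono (hzi1.sub hsini).norm
      ((hqi.const_mul E).add (hdom2.const_mul (2 + R))) hpt).trans ?_)
    simp only [Pi.add_apply]
    rw [integral_add (hqi.const_mul E) (hdom2.const_mul (2 + R)), integral_const_mul,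
      integral_const_mul, integral_add hdom1 (hqi.const_mul E), integral_const_mul,
      integral_sub hdom0 (hsin.const_mul R), integral_const_mul,
      integral_sub hexpi (integrable_const _)]
    simp only [integral_const, probReal_univ, smul_eq_mul, mul_one]
    have hs' := (abs_le.1 hs).1
    gcongr
    nlinarith
  have hI2 : ‖Complex.I * z * ((∫ x, Real.sin x ∂ν : ℝ) : ℂ)‖ ≤ R * (2 * h * B') := by
    rw [norm_mul, norm_mul, Complex.norm_I, one_mul, Complex.norm_real, Real.norm_eq_abs]
    gcongr
  have hexp1 : Real.exp (h * K) - 1 ≤ h * (K * Real.exp K) := by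
    have h1 := Real.add_one_le_exp (-(h * K))
    have h2 : Real.exp (h * K) ≤ Real.exp K := Real.exp_le_exp.2 (by nlinarith [hh.2])
    have h3 : Real.exp (h * K) * Real.exp (-(h * K)) = 1 := by rw [← Real.exp_add]; simp
    have h4 : 0 ≤ h * K := mul_nonneg hh.1.le hK0
    nlinarith [Real.exp_pos (h * K)]
  rw [e]
  refine (norm_add_le _ _).trans ((add_le_add hI1 hI2).trans ?_)
  have : (2 + R) * ((Real.exp (h * K) - 1) + R * (2 * h * B') + E * (7 * (2 * h * B')))
      ≤ (2 + R) * (h * (K * Real.exp K) + R * (2 * h * B') + E * (7 * (2 * h * B'))) := by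
    gcongr
  linarith

/-! ### The extension of the characteristic exponent -/

lemma exists_norm_le_of_abs_le_two {ψ : ℝ → ℂ} (hc : Continuous ψ) :
    ∃ B : ℝ, ∀ lam : ℝ, |lam| ≤ 2 → ‖ψ lam‖ ≤ B := by
  obtain ⟨B, hB⟩ := (isCompact_Icc (a := (-2 : ℝ)) (b := 2)).exists_bound_of_continuousOn
    hc.continuousOn
  exact ⟨B, fun lam hlam => hB lam (abs_le.1 hlam)⟩

lemma HasCharExponent.hasExpMoments {μ : Measure CadlagPath} {ψ : ℝ → ℂ}
    (hψ : HasCharExponent μ ψ) (hμ : IsLevyLaw μ) (hneg : HasNegativeJumps μ) (hc : Continuous ψ)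
    {h : ℝ} (hh : h ∈ Ioc (0 : ℝ) 1) : HasExpMoments (incrLaw μ h) := by
  obtain ⟨B, hB⟩ := exists_norm_le_of_abs_le_two hc
  obtain ⟨C, _, hC⟩ := exists_norm_charFunExt_sub_one_le B le_rfl
  exact (hC μ ψ hμ hψ hneg hB h hh).1

lemma HasCharExponent.charFunExt_two_mul {μ : Measure CadlagPath} {ψ : ℝ → ℂ}
    (hψ : HasCharExponent μ ψ) (hμ : IsLevyLaw μ) (hneg : HasNegativeJumps μ) (hc : Continuous ψ)
    {h : ℝ} (hh : 0 < h) (hh' : 2 * h ≤ 1) {z : ℂ} (hz : z.im ≤ 0) :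
    charFunExt (incrLaw μ (2 * h)) z = charFunExt (incrLaw μ h) z ^ 2 := by
  have := hμ.isProbabilityMeasure_incrLaw h
  have := hμ.isProbabilityMeasure_incrLaw (2 * h)
  have h1 := (hψ.hasExpMoments hμ hneg hc (h := h) ⟨hh, by linarith⟩).diffContOnCl
  have h2 := (hψ.hasExpMoments hμ hneg hc (h := 2 * h) ⟨by linarith, hh'⟩).diffContOnCl
  have h3 : DiffContOnCl ℂ (fun z => charFunExt (incrLaw μ h) z ^ 2) lowerHalf :=
    ⟨h1.1.fun_pow 2, h1.2.pow 2⟩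
  refine eq_of_eq_on_real h2 h3 (fun x => ?_) hz
  simp only [charFunExt_ofReal]
  rw [hψ.charFun_incrLaw (by linarith), hψ.charFun_incrLaw hh, ← Complex.exp_nat_mul]
  congr 1
  push_cast
  ring

/-- Any extension of the exponent to the lower half-plane is a logarithm of the extended
characteristic function. -/
lemma HasCharExponent.exp_mul_eq_charFunExt {μ : Measure CadlagPath} {ψ : ℝ → ℂ}
    (hψ : HasCharExponent μ ψ) (hμ : IsLevyLaw μ) (hneg : HasNegativeJumps μ) (hc : Continuous ψ)
    {Ψ : ℂ → ℂ} (hΨ : DiffContOnCl ℂ Ψ lowerHalf) (hΨr : ∀ lam : ℝ, Ψ lam = ψ lam)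
    {h : ℝ} (hh : h ∈ Ioc (0 : ℝ) 1) {z : ℂ} (hz : z.im ≤ 0) :
    Complex.exp (h * Ψ z) = charFunExt (incrLaw μ h) z := by
  have := hμ.isProbabilityMeasure_incrLaw h
  have h1 := (hψ.hasExpMoments hμ hneg hc hh).diffContOnCl
  have h2 : DiffContOnCl ℂ (fun z => Complex.exp (h * Ψ z)) lowerHalf :=
    ⟨(hΨ.1.const_mul (h : ℂ)).cexp, (hΨ.2.const_mul (h : ℂ)).cexp⟩
  refine eq_of_eq_on_real h2 h1 (fun x => ?_) hz
  rw [charFunExt_ofReal, hψ.charFun_incrLaw hh.1, hΨr]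

/-- A bound of the exponent near the origin of the real axis controls its extension. -/
lemma exists_norm_extension_le (B : ℝ) {R : ℝ} (hR : 0 ≤ R) :
    ∃ C : ℝ, 0 ≤ C ∧ ∀ (μ : Measure CadlagPath) (ψ : ℝ → ℂ) (Ψ : ℂ → ℂ), IsLevyLaw μ →
      HasCharExponent μ ψ → HasNegativeJumps μ → Continuous ψ →
      (∀ lam : ℝ, |lam| ≤ 2 → ‖ψ lam‖ ≤ B) → DiffContOnCl ℂ Ψ lowerHalf →
      (∀ lam : ℝ, Ψ lam = ψ lam) → ∀ z : ℂ, z.im ≤ 0 → ‖z‖ ≤ R → ‖Ψ z‖ ≤ C := by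
  obtain ⟨C, hC0, hC⟩ := exists_norm_charFunExt_sub_one_le B hR
  refine ⟨C, hC0, fun μ ψ Ψ hμ hψ hneg hc hB hΨ hΨr z hz hzR => ?_⟩
  have hd : HasDerivAt (fun h : ℝ => Complex.exp (h * Ψ z)) (Ψ z) 0 := by
    have h1 : HasDerivAt (fun h : ℝ => (h : ℂ) * Ψ z) (Ψ z) 0 := by
      simpa using (Complex.ofRealCLM.hasDerivAt (x := (0 : ℝ))).mul_const (Ψ z)
    simpa using h1.cexp
  have ht := hd.tendsto_slope_zero_right.norm
  refine le_of_tendsto ht ?_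
  filter_upwards [Ioc_mem_nhdsGT (zero_lt_one' ℝ)] with h hh
  have h1 := (hC μ ψ hμ hψ hneg hB h hh).2 z hz hzR
  rw [← hψ.exp_mul_eq_charFunExt hμ hneg hc hΨ hΨr hh hz] at h1
  rw [norm_smul, norm_inv, Real.norm_of_nonneg hh.1.le, inv_mul_le_iff₀ hh.1, mul_comm h]
  simpa using h1

lemma log_sq_of_norm_sub_one_lt {a : ℂ} (ha : ‖a - 1‖ < 1) :
    Complex.log (a ^ 2) = 2 * Complex.log a := by
  have hre : 0 < a.re := by
    have := (abs_le.1 (Complex.abs_re_le_norm (a - 1))).1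
    simp at this
    linarith
  have ha0 : a ≠ 0 := by rintro rfl; simp at hre
  have harg : |a.arg| < Real.pi / 2 := Complex.abs_arg_lt_pi_div_two_iff.2 (Or.inl hre)
  rw [abs_lt] at harg
  conv_lhs => rw [← Complex.exp_log ha0, ← Complex.exp_nat_mul]
  rw [Complex.log_exp] <;> simp [Complex.log_im] <;> linarith

/-- Without positive jumps the characteristic exponent extends to the lower half-plane: on bounded
sets the extension is `2ⁿ log E exp (i z X)`, with `X` the increment over an interval of length
`2⁻ⁿ`, for any large `n`. It is real on the negative imaginary axis. -/
lemma HasCharExponent.exists_extension {μ : Measure CadlagPath} {ψ : ℝ → ℂ}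
    (hψ : HasCharExponent μ ψ) (hμ : IsLevyLaw μ) (hneg : HasNegativeJumps μ) (hc : Continuous ψ)
    (hlog : ∀ R : ℝ, ∀ᶠ h in 𝓝[>] (0 : ℝ), ∀ lam : ℝ, |lam| ≤ R →
      h * ψ lam = Complex.log (charFun (incrLaw μ h) lam)) :
    ∃ Ψ : ℂ → ℂ, DiffContOnCl ℂ Ψ lowerHalf ∧ (∀ lam : ℝ, Ψ lam = ψ lam) ∧
      ∀ w : ℝ, 0 ≤ w → (Ψ (-Complex.I * w)).im = 0 := by
  obtain ⟨B, hB⟩ := exists_norm_le_of_abs_le_two hc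
  let η : ℕ → ℝ := fun n => (1 / 2) ^ n
  have hη : ∀ n, η n ∈ Ioc (0 : ℝ) 1 := fun n =>
    ⟨by positivity, pow_le_one₀ (by norm_num) (by norm_num)⟩
  have hη0 : Tendsto η atTop (𝓝[>] 0) := tendsto_nhdsWithin_iff.2
    ⟨tendsto_pow_atTop_nhds_zero_of_lt_one (by norm_num) (by norm_num),
      Eventually.of_forall fun n => (hη n).1⟩
  have hη2 : ∀ n, 2 * η (n + 1) = η n := fun n => by simp only [η, pow_succ]; ring
  let F : ℕ → ℂ → ℂ := fun n => charFunExt (incrLaw μ (η n))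
  have hF : ∀ n, DiffContOnCl ℂ (F n) lowerHalf := fun n => by
    have := hμ.isProbabilityMeasure_incrLaw (η n)
    exact (hψ.hasExpMoments hμ hneg hc (hη n)).diffContOnCl
  have hev : ∀ R : ℕ, ∃ N : ℕ, ∀ n ≥ N, ∀ z : ℂ, z.im ≤ 0 → ‖z‖ ≤ R → ‖F n z - 1‖ < 1 := by
    intro R
    obtain ⟨C, hC0, hC⟩ := exists_norm_charFunExt_sub_one_le B (Nat.cast_nonneg (α := ℝ) R)
    have h1 : Tendsto (fun n => C * η n) atTop (𝓝 0) := by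
      simpa using (tendsto_nhdsWithin_iff.1 hη0).1.const_mul C
    obtain ⟨N, hN⟩ := eventually_atTop.1 (h1.eventually (Iio_mem_nhds zero_lt_one))
    exact ⟨N, fun n hn z hz hzR => ((hC μ ψ hμ hψ hneg hB _ (hη n)).2 z hz hzR).trans_lt (hN n hn)⟩
  choose N hN using hev
  let L : ℕ → ℂ → ℂ := fun n z => 2 ^ n * Complex.log (F n z)
  have hstep : ∀ (R n : ℕ), N R ≤ n → ∀ z : ℂ, z.im ≤ 0 → ‖z‖ ≤ R → L (n + 1) z = L n z := by
    intro R n hn z hz hzR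
    have h1 : F n z = F (n + 1) z ^ 2 := by
      simp only [F]
      rw [← hψ.charFunExt_two_mul hμ hneg hc (hη _).1 (by rw [hη2]; exact (hη n).2) hz, hη2]
    simp only [L]
    rw [h1, log_sq_of_norm_sub_one_lt (hN R _ (by omega) z hz hzR), pow_succ]
    ring
  have hconst : ∀ (R n : ℕ), N R ≤ n → ∀ z : ℂ, z.im ≤ 0 → ‖z‖ ≤ R → L n z = L (N R) z := by
    intro R n hn z hz hzR
    induction n, hn using Nat.le_induction with
    | base => rfl
    | succ n hn ih => rw [hstep R n hn z hz hzR, ih]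
  let Ψ : ℂ → ℂ := fun z => L (N ⌈‖z‖⌉₊) z
  have hΨ : ∀ (R n : ℕ), (∀ k ∈ Finset.range (R + 1), N k ≤ n) → ∀ z : ℂ, z.im ≤ 0 → ‖z‖ ≤ R →
      Ψ z = L n z := by
    intro R n hn z hz hzR
    refine (hconst _ n (hn _ ?_) z hz (Nat.le_ceil _)).symm
    rw [Finset.mem_range, Nat.lt_succ_iff]
    exact Nat.ceil_le.2 hzR
  have hlarge : ∀ R : ℕ, ∃ n : ℕ, ∀ k ∈ Finset.range (R + 1), N k ≤ n := fun R =>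
    ⟨_, fun k hk => Finset.single_le_sum (f := N) (fun _ _ => Nat.zero_le _) hk⟩
  -- near each point the extension coincides with one of the logarithms
  have hloc : ∀ z : ℂ, z.im ≤ 0 → ∃ n : ℕ, F n z ∈ Complex.slitPlane ∧
      ∀ y ∈ Metric.ball z 1 ∩ {y | y.im ≤ 0}, Ψ y = L n y := by
    intro z hz
    obtain ⟨n, hn⟩ := hlarge ⌈‖z‖ + 1⌉₊
    have hR := Nat.le_ceil (‖z‖ + 1)
    refine ⟨n, ?_, fun y hy => hΨ _ n hn y hy.2 ?_⟩
    · have h1 := hN _ n (hn ⌈‖z‖ + 1⌉₊ (by simp)) z hz (by linarith)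
      have := Complex.mem_slitPlane_of_norm_lt_one h1
      simpa using this
    · have h1 : ‖y - z‖ < 1 := by simpa [dist_eq_norm] using hy.1
      have h2 : ‖y‖ ≤ ‖y - z‖ + ‖z‖ := by simpa using norm_add_le (y - z) z
      linarith
  refine ⟨Ψ, ⟨fun z hz => ?_, ?_⟩, fun lam => ?_, fun w hw => ?_⟩
  · have hz' : z.im < 0 := hz
    obtain ⟨n, hn, hΨn⟩ := hloc z hz'.le
    have h1 : DifferentiableAt ℂ (L n) z :=
      (((hF n).differentiableAt isOpen_lowerHalf hz).clog hn).const_mul _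
    have h2 : Ψ =ᶠ[𝓝 z] L n := by
      filter_upwards [Metric.ball_mem_nhds z one_pos, isOpen_lowerHalf.mem_nhds hz] with y hy hy2
      exact hΨn y ⟨hy, (show y.im < 0 from hy2).le⟩
    exact (h1.congr_of_eventuallyEq h2).differentiableWithinAt
  · rw [closure_lowerHalf]
    intro z hz
    obtain ⟨n, hn, hΨn⟩ := hloc z hz
    have hFc : ContinuousWithinAt (F n) {z : ℂ | z.im ≤ 0} z := by
      have := (hF n).continuousOn
      rw [closure_lowerHalf] at this
      exact this z hz
    have h1 : ContinuousWithinAt (L n) {z : ℂ | z.im ≤ 0} z := (hFc.clog hn).const_mul _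
    refine h1.congr_of_eventuallyEq ?_ (hΨn z ⟨Metric.mem_ball_self one_pos, hz⟩)
    filter_upwards [self_mem_nhdsWithin, mem_nhdsWithin_of_mem_nhds
      (Metric.ball_mem_nhds z one_pos)] with y hy hy2
    exact hΨn y ⟨hy2, hy⟩
  · obtain ⟨n₀, hn₀⟩ := hlarge ⌈|lam|⌉₊
    obtain ⟨n, hn, hn'⟩ := ((hη0.eventually (hlog |lam|)).and (eventually_ge_atTop n₀)).exists
    rw [hΨ ⌈|lam|⌉₊ n (fun k hk => (hn₀ k hk).trans hn') lam (by simp)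
      (by simpa using Nat.le_ceil |lam|)]
    simp only [L, F]
    rw [charFunExt_ofReal, ← hn lam le_rfl]
    simp only [η]
    push_cast
    rw [← mul_assoc, ← mul_pow]
    norm_num
  · simp only [Ψ, L, F]
    have hpow : ∀ k : ℕ, ((2 : ℂ) ^ k) = ((2 ^ k : ℝ) : ℂ) := fun k => by push_cast; rfl
    rw [charFunExt_neg_I_mul, ← Complex.ofReal_log (integral_nonneg fun x => (Real.exp_pos _).le),
      hpow, ← Complex.ofReal_mul, Complex.ofReal_im]

/-! ### Families of holomorphic functions depending on a real parameter -/

/-- Cauchy's estimate on a disc of radius `ε` contained in the lower half-plane, from a bound on a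
half-disc centred at the origin, which serves for all centres in a bounded set. -/
lemma norm_deriv_le_of_lowerHalf {f : ℂ → ℂ} (hf : DifferentiableOn ℂ f lowerHalf) {z : ℂ}
    {ε M : ℝ} (hε : 0 < ε) (hz : z.im < -ε) (hM : ∀ y : ℂ, y.im ≤ 0 → ‖y‖ ≤ ‖z‖ + ε → ‖f y‖ ≤ M) :
    ‖deriv f z‖ ≤ M / ε := by
  have hball : Metric.closedBall z ε ⊆ lowerHalf := by
    intro y hy
    rw [Metric.mem_closedBall, dist_eq_norm] at hy
    have h1 := (abs_le.1 (Complex.abs_im_le_norm (y - z))).2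
    rw [Complex.sub_im] at h1
    change y.im < 0
    linarith
  refine Complex.norm_deriv_le_of_forall_mem_sphere_norm_le hε
    (DifferentiableOn.diffContOnCl (hf.mono ?_)) fun y hy => ?_
  · exact (closure_mono Metric.ball_subset_closedBall).trans
      (by rw [Metric.isClosed_closedBall.closure_eq]; exact hball)
  · have hy' := Metric.sphere_subset_closedBall hy
    refine hM y (le_of_lt (show y.im < 0 from hball hy')) ?_
    rw [Metric.mem_closedBall, dist_eq_norm] at hy'
    have h2 : ‖y‖ ≤ ‖y - z‖ + ‖z‖ := by simpa using norm_add_le (y - z) z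
    linarith

lemma exists_bound_of_continuousOn_prod {g : ℝ → ℂ → ℂ} {a b : ℝ}
    (hg : ContinuousOn (fun p : ℝ × ℂ => g p.1 p.2) (Icc a b ×ˢ {z : ℂ | z.im ≤ 0})) (R : ℝ) :
    ∃ M : ℝ, ∀ r ∈ Icc a b, ∀ z : ℂ, z.im ≤ 0 → ‖z‖ ≤ R → ‖g r z‖ ≤ M := by
  have hcomp : IsCompact (Icc a b ×ˢ ({z : ℂ | z.im ≤ 0} ∩ Metric.closedBall 0 R)) :=
    isCompact_Icc.prod ((isCompact_closedBall 0 R).inter_left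
      (isClosed_le Complex.continuous_im continuous_const))
  obtain ⟨M, hM⟩ := hcomp.exists_bound_of_continuousOn
    (hg.mono (prod_mono subset_rfl inter_subset_left))
  exact ⟨M, fun r hr z hz hzR => hM (r, z) ⟨hr, hz, by simpa using hzR⟩⟩

lemma continuousOn_left_of_prod {g : ℝ → ℂ → ℂ} {S : Set ℝ}
    (hg : ContinuousOn (fun p : ℝ × ℂ => g p.1 p.2) (S ×ˢ {z : ℂ | z.im ≤ 0})) {z : ℂ}
    (hz : z.im ≤ 0) : ContinuousOn (fun r => g r z) S :=
  hg.comp (by fun_prop : Continuous fun r : ℝ => (r, z)).continuousOn fun _ hr => ⟨hr, hz⟩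

/-- Integration of holomorphic functions with respect to a real parameter. -/
lemma integral_param {g : ℝ → ℂ → ℂ} {a b : ℝ} (hab : a ≤ b)
    (hg : ContinuousOn (fun p : ℝ × ℂ => g p.1 p.2) (Icc a b ×ˢ {z : ℂ | z.im ≤ 0}))
    (hd : ∀ r ∈ Icc a b, DifferentiableOn ℂ (g r) lowerHalf)
    (hd' : ∀ z ∈ lowerHalf, ContinuousOn (fun r => deriv (g r) z) (Icc a b)) :
    DiffContOnCl ℂ (fun z => ∫ r in a..b, g r z) lowerHalf ∧
      ∀ z ∈ lowerHalf, HasDerivAt (fun z => ∫ r in a..b, g r z) (∫ r in a..b, deriv (g r) z) z := by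
  have hIoc : uIoc a b = Ioc a b := uIoc_of_le hab
  have hmeas : ∀ z : ℂ, z.im ≤ 0 →
      AEStronglyMeasurable (fun r => g r z) (volume.restrict (uIoc a b)) := fun z hz => by
    rw [hIoc]
    exact ((continuousOn_left_of_prod hg hz).mono Ioc_subset_Icc_self).aestronglyMeasurable
      measurableSet_Ioc
  have hderiv : ∀ z ∈ lowerHalf,
      HasDerivAt (fun z => ∫ r in a..b, g r z) (∫ r in a..b, deriv (g r) z) z := by
    intro z hz
    have hz0 : z.im < 0 := hz
    set ε := -z.im / 3 with hε
    have hε0 : 0 < ε := by rw [hε]; linarith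
    obtain ⟨M, hM⟩ := exists_bound_of_continuousOn_prod hg (‖z‖ + 2 * ε)
    have hball : ∀ y ∈ Metric.ball z ε, y.im < -ε ∧ ‖y‖ ≤ ‖z‖ + ε := by
      intro y hy
      rw [Metric.mem_ball, dist_eq_norm] at hy
      have h1 := (abs_le.1 (Complex.abs_im_le_norm (y - z))).2
      rw [Complex.sub_im] at h1
      have h2 : ‖y‖ ≤ ‖y - z‖ + ‖z‖ := by simpa using norm_add_le (y - z) z
      constructor <;> linarith
    refine (intervalIntegral.hasDerivAt_integral_of_dominated_loc_of_deriv_le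
      (F' := fun y r => deriv (g r) y) (bound := fun _ => M / ε)
      (Metric.ball_mem_nhds z hε0) ?_ ?_ ?_ ?_ intervalIntegrable_const ?_).2
    · filter_upwards [isOpen_lowerHalf.mem_nhds hz] with y hy using hmeas y (le_of_lt hy)
    · refine ContinuousOn.intervalIntegrable ?_
      rw [uIcc_of_le hab]
      exact continuousOn_left_of_prod hg hz0.le
    · rw [hIoc]
      exact ((hd' z hz).mono Ioc_subset_Icc_self).aestronglyMeasurable measurableSet_Ioc
    · refine Eventually.of_forall fun r hr y hy => ?_
      rw [hIoc] at hr
      exact norm_deriv_le_of_lowerHalf (hd r (Ioc_subset_Icc_self hr)) hε0 (hball y hy).1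
        fun x hx hx' => hM r (Ioc_subset_Icc_self hr) x hx (by linarith [(hball y hy).2])
    · refine Eventually.of_forall fun r hr y hy => ?_
      rw [hIoc] at hr
      exact ((hd r (Ioc_subset_Icc_self hr)).differentiableAt (isOpen_lowerHalf.mem_nhds
        (show y.im < 0 by linarith [(hball y hy).1]))).hasDerivAt
  refine ⟨⟨fun z hz => (hderiv z hz).differentiableAt.differentiableWithinAt, ?_⟩, hderiv⟩
  rw [closure_lowerHalf]
  intro z hz
  obtain ⟨M, hM⟩ := exists_bound_of_continuousOn_prod hg (‖z‖ + 1)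
  refine intervalIntegral.continuousWithinAt_of_dominated_interval (bound := fun _ => M)
    ?_ ?_ intervalIntegrable_const (Eventually.of_forall fun r hr => ?_)
  · filter_upwards [self_mem_nhdsWithin] with y hy using hmeas y hy
  · filter_upwards [self_mem_nhdsWithin, mem_nhdsWithin_of_mem_nhds
      (Metric.ball_mem_nhds z one_pos)] with y hy hyz
    refine Eventually.of_forall fun r hr => hM r (Ioc_subset_Icc_self (hIoc ▸ hr)) y hy ?_
    rw [Metric.mem_ball, dist_eq_norm] at hyz
    have h2 : ‖y‖ ≤ ‖y - z‖ + ‖z‖ := by simpa using norm_add_le (y - z) z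
    linarith
  · have hr' : r ∈ Icc a b := Ioc_subset_Icc_self (hIoc ▸ hr)
    exact hg.comp (by fun_prop : Continuous fun y : ℂ => (r, y)).continuousOn
      (fun y hy => ⟨hr', hy⟩) z hz

/-- If `f` is the derivative of `J` in the sense of integrals over horizontal segments of the real
axis, then it is its derivative in the lower half-plane. -/
lemma deriv_eq_of_integral_eq {f J : ℂ → ℂ} (hf : DiffContOnCl ℂ f lowerHalf)
    (hJ : DiffContOnCl ℂ J lowerHalf)
    (h : ∀ x δ : ℝ, 0 ≤ δ → J (x + δ) - J x = ∫ r in (0 : ℝ)..δ, f (x + r)) {z : ℂ}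
    (hz : z ∈ lowerHalf) : deriv J z = f z := by
  have hz0 : z.im < 0 := hz
  have hfc : ContinuousOn f {z : ℂ | z.im ≤ 0} := by
    have := hf.continuousOn
    rwa [closure_lowerHalf] at this
  have hshift : ∀ r : ℝ, DiffContOnCl ℂ (fun z : ℂ => f (z + r)) lowerHalf := fun r =>
    hf.comp (Differentiable.diffContOnCl (by fun_prop)) fun y hy => by
      simpa [lowerHalf] using hy
  have hJshift : ∀ r : ℝ, DiffContOnCl ℂ (fun z : ℂ => J (z + r)) lowerHalf := fun r =>
    hJ.comp (Differentiable.diffContOnCl (by fun_prop)) fun y hy => by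
      simpa [lowerHalf] using hy
  have key : ∀ δ : ℝ, 0 ≤ δ → J (z + δ) - J z = ∫ r in (0 : ℝ)..δ, f (z + r) := by
    intro δ hδ
    have h1 := (integral_param (g := fun r z => f (z + r)) hδ ?_
      (fun r _ => (hshift r).1) ?_).1
    · refine eq_of_eq_on_real (f := fun z : ℂ => J (z + δ) - J z) ((hJshift δ).sub hJ) h1
        (fun x => h x δ hδ) hz0.le
    · refine hfc.comp (by fun_prop : Continuous fun p : ℝ × ℂ => p.2 + (p.1 : ℂ)).continuousOn ?_
      rintro ⟨r, y⟩ ⟨_, hy⟩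
      simpa using hy
    · intro y hy
      simp only [deriv_comp_add_const]
      refine ((hf.1.deriv isOpen_lowerHalf).continuousOn).comp
        (by fun_prop : Continuous fun r : ℝ => y + (r : ℂ)).continuousOn fun r _ => ?_
      simpa [lowerHalf] using hy
  have hJd : HasDerivAt J (deriv J z) z := (hJ.differentiableAt isOpen_lowerHalf hz).hasDerivAt
  have h1 : HasDerivAt (fun δ : ℝ => J (z + δ) - J z) (deriv J z) 0 := by
    have h2 : HasDerivAt (fun δ : ℝ => z + (δ : ℂ)) 1 0 := by
      simpa using (Complex.ofRealCLM.hasDerivAt (x := (0 : ℝ))).const_add z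
    have h3 : HasDerivAt J (deriv J z) (z + ((0 : ℝ) : ℂ)) := by simpa using hJd
    simpa using (h3.comp (0 : ℝ) h2).sub_const (J z)
  have hcont : Continuous fun r : ℝ => f (z + r) :=
    continuousOn_univ.1 (hfc.comp (by fun_prop : Continuous fun r : ℝ => z + (r : ℂ)).continuousOn
      fun r _ => by simpa using hz0.le)
  have h4 : HasDerivAt (fun δ : ℝ => ∫ r in (0 : ℝ)..δ, f (z + r)) (f z) 0 := by
    simpa using intervalIntegral.integral_hasDerivAt_right (a := 0) (b := 0)
      (hcont.intervalIntegrable _ _) hcont.stronglyMeasurable.stronglyMeasurableAtFilter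
      hcont.continuousAt
  have hu := uniqueDiffWithinAt_Ici (0 : ℝ)
  refine hu.eq_deriv _ h1.hasDerivWithinAt
    ((h4.hasDerivWithinAt (s := Ici 0)).congr (fun δ hδ => key δ hδ) (key 0 le_rfl))

/-! ### Evolution of the extended exponents -/

/-- `Ψ t`, `t ≥ 0`, are extensions to the closed lower half-plane of the functions `ψ t`, locally
bounded there uniformly in time, and locally Lipschitz in time on the real axis. -/
structure IsExtensionFamily (Ψ : ℝ → ℂ → ℂ) (ψ : ℝ → ℝ → ℂ) : Prop where
  diffContOnCl : ∀ t, 0 ≤ t → DiffContOnCl ℂ (Ψ t) lowerHalf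
  real : ∀ t, 0 ≤ t → ∀ lam : ℝ, Ψ t lam = ψ t lam
  bounded : ∀ T R : ℝ, ∃ C : ℝ, ∀ t ∈ Icc 0 T, ∀ z : ℂ, z.im ≤ 0 → ‖z‖ ≤ R → ‖Ψ t z‖ ≤ C
  lipschitz : ∀ T R : ℝ, ∃ C : ℝ, 0 ≤ C ∧ ∀ s ∈ Icc 0 T, ∀ t ∈ Icc 0 T, ∀ lam : ℝ, |lam| ≤ R →
    ‖ψ s lam - ψ t lam‖ ≤ C * |s - t|

namespace IsExtensionFamily

variable {Ψ : ℝ → ℂ → ℂ} {ψ : ℝ → ℝ → ℂ}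

/-- Hölder continuity in time, from Lipschitz continuity on the real axis. -/
lemma exists_holder (hΨ : IsExtensionFamily Ψ ψ) (T R : ℝ) :
    ∃ K : ℝ, 0 ≤ K ∧ ∀ s ∈ Icc 0 T, ∀ t ∈ Icc 0 T, ∀ z : ℂ, z.im ≤ 0 → ‖z‖ ≤ R →
      ‖Ψ s z - Ψ t z‖ ^ 4 ≤ K * |s - t| := by
  obtain ⟨M, hM⟩ := hΨ.bounded T (3 * R)
  obtain ⟨C, hC0, hC⟩ := hΨ.lipschitz T (3 * R)
  set M' := 2 * max M 0 with hM'
  have hM'0 : 0 ≤ M' := by positivity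
  refine ⟨C * M' ^ 3, by positivity, fun s hs t ht z hz hzR => ?_⟩
  have hD : DiffContOnCl ℂ (fun z => Ψ s z - Ψ t z) lowerHalf :=
    (hΨ.diffContOnCl s hs.1).sub (hΨ.diffContOnCl t ht.1)
  have hb : ∀ y : ℂ, y.im ≤ 0 → ‖y‖ ≤ 3 * R → ‖Ψ s y - Ψ t y‖ ≤ M' := fun y hy hyR => by
    have h1 := (hM s hs y hy hyR).trans (le_max_left M 0)
    have h2 := (hM t ht y hy hyR).trans (le_max_left M 0)
    have := norm_sub_le (Ψ s y) (Ψ t y)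
    linarith
  have hr : ∀ x : ℝ, |x| ≤ 3 * R → ‖Ψ s x - Ψ t x‖ ≤ C * |s - t| := fun x hx => by
    rw [hΨ.real s hs.1, hΨ.real t ht.1]; exact hC s hs t ht x hx
  have hR : 0 ≤ R := (norm_nonneg z).trans hzR
  rcases eq_or_lt_of_le hz with h0 | h0
  · have e : z = (z.re : ℂ) := by apply Complex.ext <;> simp [h0]
    have h1 : |z.re| ≤ 3 * R := (Complex.abs_re_le_norm z).trans (by linarith)
    have h2 := hr z.re h1
    have h3 := hb z hz (by linarith)
    rw [← e] at h2
    calc ‖Ψ s z - Ψ t z‖ ^ 4 = ‖Ψ s z - Ψ t z‖ * ‖Ψ s z - Ψ t z‖ ^ 3 := by ring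
      _ ≤ (C * |s - t|) * M' ^ 3 := by gcongr
      _ = _ := by ring
  · have := norm_pow_four_le hD h0 (M := M') (ε := C * |s - t|)
      (fun y hy hyz => hb y hy (hyz.trans (by linarith)))
      (fun x hx => hr x (hx.trans (by linarith)))
    linarith

lemma tendstoUniformlyOn (hΨ : IsExtensionFamily Ψ ψ) {t : ℝ} (ht : 0 ≤ t) (R : ℝ) :
    TendstoUniformlyOn Ψ (Ψ t) (𝓝[Ici 0] t) {z : ℂ | z.im ≤ 0 ∧ ‖z‖ ≤ R} := by
  obtain ⟨K, hK0, hK⟩ := hΨ.exists_holder (t + 1) R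
  rw [Metric.tendstoUniformlyOn_iff]
  intro ε hε
  have h1 : Tendsto (fun s => K * |s - t|) (𝓝[Ici 0] t) (𝓝 0) := by
    have : Continuous fun s => K * |s - t| := by fun_prop
    simpa using (this.tendsto t).mono_left nhdsWithin_le_nhds
  filter_upwards [h1.eventually (Iio_mem_nhds (pow_pos hε 4)), self_mem_nhdsWithin,
    mem_nhdsWithin_of_mem_nhds (Iic_mem_nhds (lt_add_one t))] with s hs hs0 hs1 z hz
  have h2 := hK s ⟨hs0, hs1⟩ t ⟨ht, by linarith⟩ z hz.1 hz.2
  rw [dist_comm, dist_eq_norm]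
  exact lt_of_pow_lt_pow_left₀ 4 hε.le (h2.trans_lt hs)

lemma continuousOn_prod (hΨ : IsExtensionFamily Ψ ψ) :
    ContinuousOn (fun p : ℝ × ℂ => Ψ p.1 p.2) (Ici 0 ×ˢ {z : ℂ | z.im ≤ 0}) := by
  rintro ⟨t, z⟩ ⟨ht, hz⟩
  have ht : 0 ≤ t := ht
  have hz : z.im ≤ 0 := hz
  have hc : ContinuousWithinAt (Ψ t) {z : ℂ | z.im ≤ 0} z := by
    have := (hΨ.diffContOnCl t ht).continuousOn
    rw [closure_lowerHalf] at this
    exact this z hz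
  have hu := hΨ.tendstoUniformlyOn ht (‖z‖ + 1)
  rw [ContinuousWithinAt, Metric.tendsto_nhds]
  intro ε hε
  have h1 := Metric.tendstoUniformlyOn_iff.1 hu (ε / 2) (by positivity)
  have h2 := (Metric.tendsto_nhds.1 hc) (ε / 2) (by positivity)
  have h3 : ∀ᶠ y in 𝓝[{z : ℂ | z.im ≤ 0}] z, y.im ≤ 0 ∧ ‖y‖ ≤ ‖z‖ + 1 := by
    filter_upwards [self_mem_nhdsWithin, mem_nhdsWithin_of_mem_nhds
      (Metric.ball_mem_nhds z one_pos)] with y hy hyz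
    refine ⟨hy, ?_⟩
    rw [Metric.mem_ball, dist_eq_norm] at hyz
    have h2 : ‖y‖ ≤ ‖y - z‖ + ‖z‖ := by simpa using norm_add_le (y - z) z
    linarith
  rw [nhdsWithin_prod_eq]
  filter_upwards [h1.prod_mk (h2.and h3)] with p hp
  have h4 := hp.1 p.2 hp.2.2
  have h5 := hp.2.1
  rw [dist_comm] at h4
  linarith [dist_triangle (Ψ p.1 p.2) (Ψ t p.2) (Ψ t z)]

lemma continuousOn_deriv (hΨ : IsExtensionFamily Ψ ψ) {z : ℂ} (hz : z ∈ lowerHalf) :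
    ContinuousOn (fun t => deriv (Ψ t) z) (Ici 0) := by
  intro t ht
  have hloc : TendstoLocallyUniformlyOn Ψ (Ψ t) (𝓝[Ici 0] t) lowerHalf := by
    rw [tendstoLocallyUniformlyOn_iff_forall_isCompact isOpen_lowerHalf]
    intro K hK hKc
    obtain ⟨R, hR⟩ := hKc.isBounded.exists_norm_le
    exact (hΨ.tendstoUniformlyOn ht R).mono fun y hy => ⟨(show y.im < 0 from hK hy).le, hR y hy⟩
  have hd : ∀ᶠ s in 𝓝[Ici 0] t, DifferentiableOn ℂ (Ψ s) lowerHalf := by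
    filter_upwards [self_mem_nhdsWithin] with s hs using (hΨ.diffContOnCl s hs).1
  exact (hloc.deriv hd isOpen_lowerHalf).tendsto_at hz

end IsExtensionFamily

/-- The right-hand side `i Ψ Ψ' - z² / 2` of the evolution equation. -/
def burgersFlux (f : ℂ → ℂ) (z : ℂ) : ℂ := Complex.I * f z * deriv f z - z ^ 2 / 2

/-- The primitive `∫ ((i/2) Ψ² - z³ / 6) dt` with respect to `z` of the integrated right-hand
side. It involves no derivative of `Ψ`, and hence is well-behaved up to the real axis. -/
def fluxPrimitive (Ψ : ℝ → ℂ → ℂ) (a b : ℝ) (z : ℂ) : ℂ :=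
  ∫ t in a..b, (Complex.I / 2 * Ψ t z ^ 2 - z ^ 3 / 6)

namespace IsExtensionFamily

variable {Ψ : ℝ → ℂ → ℂ} {ψ : ℝ → ℝ → ℂ}

lemma continuousOn_burgersFlux (hΨ : IsExtensionFamily Ψ ψ) {z : ℂ} (hz : z ∈ lowerHalf) :
    ContinuousOn (fun t => burgersFlux (Ψ t) z) (Ici 0) :=
  ((continuousOn_const.mul (continuousOn_left_of_prod hΨ.continuousOn_prod
    (le_of_lt hz))).mul (hΨ.continuousOn_deriv hz)).sub continuousOn_const

lemma hasDerivAt_fluxDensity (hΨ : IsExtensionFamily Ψ ψ) {t : ℝ} (ht : 0 ≤ t) {z : ℂ}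
    (hz : z ∈ lowerHalf) :
    HasDerivAt (fun z => Complex.I / 2 * Ψ t z ^ 2 - z ^ 3 / 6) (burgersFlux (Ψ t) z) z := by
  have h1 := ((hΨ.diffContOnCl t ht).differentiableAt isOpen_lowerHalf hz).hasDerivAt
  refine (((h1.fun_pow 2).const_mul (Complex.I / 2)).fun_sub
    ((hasDerivAt_pow 3 z).div_const 6)).congr_deriv ?_
  rw [burgersFlux]
  push_cast
  ring

lemma fluxPrimitive_spec (hΨ : IsExtensionFamily Ψ ψ) {a b : ℝ} (ha : 0 ≤ a) (hab : a ≤ b) :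
    DiffContOnCl ℂ (fluxPrimitive Ψ a b) lowerHalf ∧ ∀ z ∈ lowerHalf,
      HasDerivAt (fluxPrimitive Ψ a b) (∫ t in a..b, burgersFlux (Ψ t) z) z := by
  have hsub : Icc a b ⊆ Ici 0 := fun t ht => ha.trans ht.1
  have hderiv : ∀ z ∈ lowerHalf, ∀ t ∈ Icc a b,
      deriv (fun z => Complex.I / 2 * Ψ t z ^ 2 - z ^ 3 / 6) z = burgersFlux (Ψ t) z :=
    fun z hz t ht => (hΨ.hasDerivAt_fluxDensity (hsub ht) hz).deriv
  have h := integral_param (g := fun t z => Complex.I / 2 * Ψ t z ^ 2 - z ^ 3 / 6) hab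
    ((continuousOn_const.mul ((hΨ.continuousOn_prod.mono (prod_mono hsub subset_rfl)).pow 2)).sub
      (by fun_prop))
    (fun t ht z hz => (hΨ.hasDerivAt_fluxDensity (hsub ht)
      hz).differentiableAt.differentiableWithinAt)
    (fun z hz => ((hΨ.continuousOn_burgersFlux hz).mono hsub).congr (hderiv z hz))
  refine ⟨h.1, fun z hz => (h.2 z hz).congr_deriv ?_⟩
  refine intervalIntegral.integral_congr fun t ht => ?_
  rw [uIcc_of_le hab] at ht
  exact hderiv z hz t ht

/-- An integrated evolution equation yields the differential one. -/
lemma hasDerivWithinAt_of_sub_eq_integral (hΨ : IsExtensionFamily Ψ ψ) {z : ℂ} (hz : z ∈ lowerHalf)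
    (h : ∀ T, 0 ≤ T → Ψ T z - Ψ 0 z = ∫ t in (0 : ℝ)..T, burgersFlux (Ψ t) z) {t : ℝ}
    (ht : 0 ≤ t) : HasDerivWithinAt (fun s => Ψ s z) (burgersFlux (Ψ t) z) (Ici 0) t := by
  let G : ℝ → ℂ := fun t => burgersFlux (Ψ (max t 0)) z
  have hG : Continuous G := continuousOn_univ.1 ((hΨ.continuousOn_burgersFlux hz).comp
    (by fun_prop : Continuous fun t : ℝ => max t 0).continuousOn
    fun t _ => mem_Ici.2 (le_max_right _ _))
  have h1 : HasDerivAt (fun T => ∫ t in (0 : ℝ)..T, G t) (G t) t :=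
    intervalIntegral.integral_hasDerivAt_right (hG.intervalIntegrable _ _)
      hG.stronglyMeasurable.stronglyMeasurableAtFilter hG.continuousAt
  have h2 : G t = burgersFlux (Ψ t) z := by simp only [G, max_eq_left ht]
  have h3 : ∀ T, 0 ≤ T → Ψ T z = (∫ t in (0 : ℝ)..T, G t) + Ψ 0 z := by
    intro T hT
    rw [← sub_eq_iff_eq_add, h T hT]
    refine intervalIntegral.integral_congr fun t ht => ?_
    rw [uIcc_of_le hT] at ht
    simp only [G, max_eq_left ht.1]
  rw [← h2]
  exact ((h1.add_const (Ψ 0 z)).hasDerivWithinAt).congr (fun T hT => h3 T hT) (h3 t ht)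

/-- The evolution equation on the real axis propagates to the lower half-plane. -/
lemma hasDerivWithinAt_of_solves (hΨ : IsExtensionFamily Ψ ψ)
    (hDiff : ∀ lam : ℝ, DifferentiableOn ℝ (fun t : ℝ => ψ t lam) (Ici 0))
    (hBdd : TimeDerivLocallyBounded ψ) (hsol : SolvesCharExponentEq ψ) {z : ℂ}
    (hz : z ∈ lowerHalf) {t : ℝ} (ht : 0 ≤ t) :
    HasDerivWithinAt (fun s => Ψ s z) (burgersFlux (Ψ t) z) (Ici 0) t := by
  refine hΨ.hasDerivWithinAt_of_sub_eq_integral hz (fun T hT => ?_) ht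
  have hIoc : uIoc 0 T = Ioc 0 T := uIoc_of_le hT
  have hψc : ∀ s, 0 ≤ s → Continuous (ψ s) := fun s hs =>
    continuous_iff_continuousAt.2 fun w => (hsol s hs w).1.continuousAt
  have htime : ∀ s, 0 ≤ s → ∀ x : ℝ, timeDeriv ψ s x
      = Complex.I * deriv (ψ s) x * ψ s x - ((x ^ 2 / 2 : ℝ) : ℂ) := fun s hs x =>
    (hsol s hs x).2.derivWithin (uniqueDiffOn_Ici 0 s hs)
  obtain ⟨hJ, hJ'⟩ := hΨ.fluxPrimitive_spec le_rfl hT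
  rw [← (hJ' z hz).deriv]
  refine (deriv_eq_of_integral_eq ((hΨ.diffContOnCl T hT).sub (hΨ.diffContOnCl 0 le_rfl)) hJ
    (fun x δ hδ => ?_) hz).symm
  have hreal : ∀ x : ℝ,
      HasDerivAt (fun x : ℝ => fluxPrimitive Ψ 0 T (x : ℂ)) (ψ T x - ψ 0 x) x := by
    intro x
    obtain ⟨C, hC⟩ := hBdd T (|x| + 1)
    have hmeas : AEStronglyMeasurable (fun t => timeDeriv ψ t x) (volume.restrict (uIoc 0 T)) := by
      rw [hIoc]
      refine (stronglyMeasurable_deriv fun s => ψ s x).aestronglyMeasurable.congr ?_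
      refine (ae_restrict_iff' measurableSet_Ioc).2 (Eventually.of_forall fun s hs => ?_)
      exact (derivWithin_of_mem_nhds (Ici_mem_nhds hs.1)).symm
    have hcont : ∀ x : ℝ, ContinuousOn (fun s => Complex.I / 2 * Ψ s x ^ 2 - (x : ℂ) ^ 3 / 6)
        (Icc 0 T) := fun x =>
      (continuousOn_const.mul (((continuousOn_left_of_prod hΨ.continuousOn_prod (z := (x : ℂ))
        (by simp)).mono Icc_subset_Ici_self).pow 2)).sub continuousOn_const
    have h1 := intervalIntegral.hasDerivAt_integral_of_dominated_loc_of_deriv_le (μ := volume)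
      (F := fun (x : ℝ) s => Complex.I / 2 * Ψ s x ^ 2 - (x : ℂ) ^ 3 / 6)
      (F' := fun x s => timeDeriv ψ s x) (a := 0) (b := T) (x₀ := x) (bound := fun _ => C)
      (Metric.ball_mem_nhds x one_pos) ?_ ?_ hmeas ?_ intervalIntegrable_const ?_
    · refine h1.2.congr_deriv ?_
      exact intervalIntegral.integral_eq_sub_of_hasDeriv_right_of_le hT
        ((hDiff x).continuousOn.mono Icc_subset_Ici_self)
        (fun s hs => (hasDerivWithinAt_timeDeriv hDiff hs.1.le x).mono fun r hr =>
          mem_Ici.2 (hs.1.trans hr).le) h1.1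
    · refine Eventually.of_forall fun y => ?_
      rw [hIoc]
      exact ((hcont y).mono Ioc_subset_Icc_self).aestronglyMeasurable measurableSet_Ioc
    · refine ContinuousOn.intervalIntegrable ?_
      rw [uIcc_of_le hT]
      exact hcont x
    · refine Eventually.of_forall fun s hs y hy => ?_
      rw [hIoc] at hs
      rw [Metric.mem_ball, Real.dist_eq] at hy
      refine hC s ⟨hs.1.le, hs.2⟩ y (abs_le.1 ?_)
      have : |y| ≤ |y - x| + |x| := by simpa using abs_add_le (y - x) x
      linarith
    · refine Eventually.of_forall fun s hs y hy => ?_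
      rw [hIoc] at hs
      simp only [hΨ.real s hs.1.le]
      rw [htime s hs.1.le]
      refine ((((hsol s hs.1.le y).1.hasDerivAt.fun_pow 2).const_mul (Complex.I / 2)).fun_sub
        (((Complex.ofRealCLM.hasDerivAt (x := y)).fun_pow 3).div_const 6)).congr_deriv ?_
      simp
      ring
  have h2 := intervalIntegral.integral_eq_sub_of_hasDerivAt (a := 0) (b := δ)
    (f := fun r : ℝ => fluxPrimitive Ψ 0 T ((x + r : ℝ) : ℂ))
    (f' := fun r => ψ T (x + r) - ψ 0 (x + r))
    (fun r _ => (hreal (x + r)).comp_const_add x r)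
    ((((hψc T hT).comp (by fun_prop)).sub ((hψc 0 le_rfl).comp (by fun_prop))).intervalIntegrable
      _ _)
  simp only [add_zero, Complex.ofReal_add] at h2
  rw [← h2]
  refine intervalIntegral.integral_congr fun r _ => ?_
  simp only [Pi.sub_apply]
  rw [← Complex.ofReal_add, hΨ.real T hT, hΨ.real 0 le_rfl]

end IsExtensionFamily

/-! ### First moments under exponential tilting -/

/-- The complex first moment `E X exp (i z X)`. -/
def firstMoment (ν : Measure ℝ) (z : ℂ) : ℂ := ∫ x, x * Complex.exp (Complex.I * z * x) ∂ν

/-- The real first moment `E X exp (w X)`. -/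
def tiltedMean (ν : Measure ℝ) (w : ℝ) : ℝ := ∫ x, x * Real.exp (w * x) ∂ν

lemma tiltedMean_zero (ν : Measure ℝ) : tiltedMean ν 0 = ∫ x, x ∂ν := by simp [tiltedMean]

lemma firstMoment_neg_I_mul (ν : Measure ℝ) (w : ℝ) :
    firstMoment ν (-Complex.I * w) = tiltedMean ν w := by
  rw [firstMoment, tiltedMean, ← integral_complex_ofReal]
  congr 1 with x
  push_cast
  congr 2
  linear_combination (-(w : ℂ) * x) * Complex.I_sq

lemma abs_mul_exp_le {s w : ℝ} (hs : 0 ≤ s) (hsw : s ≤ w) (x : ℝ) :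
    |x| * Real.exp (s * x) ≤ |x| + Real.exp ((w + 1) * x) := by
  rcases le_or_gt x 0 with hx | hx
  · have h1 : Real.exp (s * x) ≤ 1 := Real.exp_le_one_iff.2 (by nlinarith)
    nlinarith [abs_nonneg x, Real.exp_pos ((w + 1) * x)]
  · have h1 : Real.exp (s * x) ≤ Real.exp (w * x) := Real.exp_le_exp.2 (by nlinarith)
    have h2 : x ≤ Real.exp x := by linarith [Real.add_one_le_exp x]
    have h3 : Real.exp ((w + 1) * x) = Real.exp x * Real.exp (w * x) := by
      rw [← Real.exp_add]; ring_nf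
    rw [abs_of_pos hx, h3]
    nlinarith [Real.exp_pos (w * x), Real.exp_pos (s * x)]

lemma norm_mul_exp_I_mul (z : ℂ) (x : ℝ) :
    ‖(x : ℂ) * Complex.exp (Complex.I * z * x)‖ = |x| * Real.exp (-z.im * x) := by
  rw [norm_mul, norm_exp_I_mul, Complex.norm_real, Real.norm_eq_abs]

section

variable {ν : Measure ℝ}

lemma HasExpMoments.integrable_mul_exp (hν : HasExpMoments ν)
    (hi : Integrable (fun x : ℝ => x) ν) {w : ℝ}
    (hw : 0 ≤ w) : Integrable (fun x => x * Real.exp (w * x)) ν := by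
  refine Integrable.mono' (g := fun x => |x| + Real.exp ((w + 1) * x))
    (hi.abs.add (hν (w + 1) (by linarith))) (by fun_prop) (Eventually.of_forall fun x => ?_)
  rw [Real.norm_eq_abs, abs_mul, abs_of_pos (Real.exp_pos _)]
  exact abs_mul_exp_le hw le_rfl x

lemma HasExpMoments.integrable_firstMoment (hν : HasExpMoments ν)
    (hi : Integrable (fun x : ℝ => x) ν) {z : ℂ}
    (hz : z.im ≤ 0) : Integrable (fun x : ℝ => (x : ℂ) * Complex.exp (Complex.I * z * x)) ν := by
  refine Integrable.mono' (hν.integrable_mul_exp hi (w := -z.im) (by linarith)).abs (by fun_prop)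
    (Eventually.of_forall fun x => ?_)
  rw [norm_mul_exp_I_mul, abs_mul, abs_of_pos (Real.exp_pos _)]

lemma HasExpMoments.tendsto_firstMoment (hν : HasExpMoments ν)
    (hi : Integrable (fun x : ℝ => x) ν) {z : ℂ}
    (hz : z.im ≤ 0) : Tendsto (fun ε : ℝ => firstMoment ν (z - Complex.I * ε)) (𝓝[>] 0)
      (𝓝 (firstMoment ν z)) := by
  refine tendsto_integral_filter_of_dominated_convergence
    (fun x => |x| + Real.exp ((-z.im + 1 + 1) * x)) (Eventually.of_forall fun _ => by fun_prop) ?_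
    (hi.abs.add (hν _ (by linarith))) (Eventually.of_forall fun x => ?_)
  · filter_upwards [Ioc_mem_nhdsGT (zero_lt_one' ℝ)] with ε hε
    refine Eventually.of_forall fun x => ?_
    rw [norm_mul_exp_I_mul]
    have hε1 := hε.1
    have hε2 := hε.2
    refine abs_mul_exp_le ?_ ?_ x <;> simp <;> linarith
  · have : Continuous fun ε : ℝ => (x : ℂ) * Complex.exp (Complex.I * (z - Complex.I * ε) * x) := by
      fun_prop
    simpa using (this.tendsto 0).mono_left nhdsWithin_le_nhds

lemma HasExpMoments.tendsto_tiltedMean (hν : HasExpMoments ν) (hi : Integrable (fun x : ℝ => x) ν) :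
    Tendsto (tiltedMean ν) (𝓝[>] 0) (𝓝 (∫ x, x ∂ν)) := by
  have h := hν.tendsto_firstMoment hi (z := 0) (by simp)
  have h0 := firstMoment_neg_I_mul ν 0
  rw [tiltedMean_zero, Complex.ofReal_zero, mul_zero] at h0
  rw [h0] at h
  have h1 := (Complex.continuous_re.tendsto _).comp h
  refine h1.congr fun ε => ?_
  have := firstMoment_neg_I_mul ν ε
  simp only [Function.comp_def, zero_sub, ← neg_mul]
  rw [this, Complex.ofReal_re]

/-- The oscillation of the complex first moment along a vertical segment is controlled by that of
the tilted means, as `X (exp (ε X) - 1) ≥ 0`. -/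
lemma HasExpMoments.norm_firstMoment_sub_le (hν : HasExpMoments ν)
    (hi : Integrable (fun x : ℝ => x) ν) (x₀ : ℝ) {ε ε₀ : ℝ} (hε : 0 ≤ ε) (hε₀ : ε ≤ ε₀) :
    ‖firstMoment ν (x₀ - Complex.I * ε) - firstMoment ν (x₀ - Complex.I * ε₀)‖
      ≤ tiltedMean ν ε₀ - ∫ x, x ∂ν := by
  have h1 := hν.integrable_firstMoment hi (z := x₀ - Complex.I * ε) (by simpa using hε)
  have h2 := hν.integrable_firstMoment hi (z := x₀ - Complex.I * ε₀) (by simpa using hε.trans hε₀)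
  have h3 := hν.integrable_mul_exp hi (hε.trans hε₀)
  rw [firstMoment, firstMoment, tiltedMean, ← integral_sub h1 h2, ← integral_sub h3 hi]
  refine norm_integral_le_of_norm_le (h3.sub hi) (Eventually.of_forall fun x => ?_)
  have e : ∀ δ : ℝ, Complex.exp (Complex.I * (x₀ - Complex.I * δ) * x)
      = Complex.exp (((x₀ * x : ℝ) : ℂ) * Complex.I) * ((Real.exp (δ * x) : ℝ) : ℂ) := fun δ => by
    rw [Complex.ofReal_exp, ← Complex.exp_add]
    congr 1
    push_cast
    linear_combination (-(δ : ℂ) * x) * Complex.I_sq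
  rw [e, e, ← mul_sub, ← mul_sub, norm_mul, norm_mul, Complex.norm_exp_ofReal_mul_I, one_mul,
    ← Complex.ofReal_sub, Complex.norm_real, Complex.norm_real, Real.norm_eq_abs, Real.norm_eq_abs]
  rcases le_or_gt x 0 with hx | hx
  · have g1 : Real.exp (ε₀ * x) ≤ Real.exp (ε * x) := Real.exp_le_exp.2 (by nlinarith)
    have g2 : Real.exp (ε * x) ≤ 1 := Real.exp_le_one_iff.2 (by nlinarith)
    rw [abs_of_nonpos hx, abs_of_nonneg (by linarith)]
    nlinarith
  · have g1 : Real.exp (ε * x) ≤ Real.exp (ε₀ * x) := Real.exp_le_exp.2 (by nlinarith)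
    have g2 : 1 ≤ Real.exp (ε * x) := Real.one_le_exp (by nlinarith)
    rw [abs_of_pos hx, abs_of_nonpos (by linarith)]
    nlinarith

lemma HasExpMoments.tiltedMean_le (hν : HasExpMoments ν)
    (hi : Integrable (fun x : ℝ => x) ν) {w : ℝ}
    (hw : w ∈ Icc (0 : ℝ) 1) : tiltedMean ν w ≤ ∫ x, Real.exp (2 * x) ∂ν := by
  refine integral_mono (hν.integrable_mul_exp hi hw.1) (hν 2 (by norm_num)) fun x => ?_
  simp only
  rcases le_or_gt x 0 with hx | hx
  · have := mul_nonpos_of_nonpos_of_nonneg hx (Real.exp_pos (w * x)).le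
    linarith [Real.exp_pos (2 * x)]
  · have h1 : Real.exp (w * x) ≤ Real.exp x := Real.exp_le_exp.2 (by nlinarith [hw.2])
    have h2 : x ≤ Real.exp x := by linarith [Real.add_one_le_exp x]
    have h3 : Real.exp (2 * x) = Real.exp x * Real.exp x := by rw [← Real.exp_add]; ring_nf
    rw [h3]
    exact mul_le_mul h2 h1 (Real.exp_pos _).le (Real.exp_pos _).le

variable [IsProbabilityMeasure ν]

/-- Jensen's inequality for the exponential. -/
lemma HasExpMoments.exp_mul_mean_le (hν : HasExpMoments ν)
    (hi : Integrable (fun x : ℝ => x) ν) {w : ℝ}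
    (hw : 0 ≤ w) : Real.exp (w * ∫ x, x ∂ν) ≤ ∫ x, Real.exp (w * x) ∂ν := by
  set m := ∫ x, x ∂ν with hm
  have hi1 : Integrable (fun x : ℝ => (1 - w * m) + w * x) ν :=
    (integrable_const _).add (hi.const_mul w)
  have h1 : ∫ x, Real.exp (w * m) * ((1 - w * m) + w * x) ∂ν ≤ ∫ x, Real.exp (w * x) ∂ν := by
    refine integral_mono (hi1.const_mul _) (hν w hw) fun x => ?_
    have := Real.add_one_le_exp (w * x - w * m)
    have e : Real.exp (w * x) = Real.exp (w * m) * Real.exp (w * x - w * m) := by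
      rw [← Real.exp_add]; ring_nf
    simp only
    rw [e]
    exact mul_le_mul_of_nonneg_left (by linarith) (Real.exp_pos _).le
  rw [integral_const_mul, integral_add (integrable_const _) (hi.const_mul w),
    integral_const_mul] at h1
  simpa [← hm] using h1

/-- Jensen's inequality for the exponentially tilted law. -/
lemma HasExpMoments.integral_exp_le (hν : HasExpMoments ν)
    (hi : Integrable (fun x : ℝ => x) ν) {w : ℝ}
    (hw : 0 ≤ w) : ∫ x, Real.exp (w * x) ∂ν
      ≤ Real.exp (w * (tiltedMean ν w / ∫ x, Real.exp (w * x) ∂ν)) := by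
  set F := ∫ x, Real.exp (w * x) ∂ν with hF
  have hF0 : 0 < F := integral_exp_pos (hν w hw)
  set a := w * (tiltedMean ν w / F) with ha
  have haF : a * F = w * tiltedMean ν w := by rw [ha]; field_simp
  have h3 := hν.integrable_mul_exp hi hw
  have h4 : Integrable (fun x => (1 + a) * Real.exp (w * x) - w * (x * Real.exp (w * x))) ν :=
    ((hν w hw).const_mul _).sub (h3.const_mul _)
  have h1 : ∫ x, ((1 + a) * Real.exp (w * x) - w * (x * Real.exp (w * x))) ∂ν
      ≤ ∫ _x, Real.exp a ∂ν := by
    refine integral_mono h4 (integrable_const _) fun x => ?_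
    have h5 := Real.add_one_le_exp (a - w * x)
    have e : Real.exp a = Real.exp (w * x) * Real.exp (a - w * x) := by
      rw [← Real.exp_add]; ring_nf
    simp only
    rw [e]
    nlinarith [Real.exp_pos (w * x)]
  rw [integral_sub ((hν w hw).const_mul _) (h3.const_mul _), integral_const_mul,
    integral_const_mul, ← hF] at h1
  have h6 : ∫ x, x * Real.exp (w * x) ∂ν = tiltedMean ν w := rfl
  rw [h6, ← haF] at h1
  simp only [integral_const, probReal_univ, smul_eq_mul, one_mul] at h1
  linarith

end

/-! ### Laplace exponents -/

/-- `ψ` is the characteristic exponent of the Lévy law `μ`, of finite variance and with negative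
jumps, `Ψ` is its extension to the closed lower half-plane, and `φ` its Laplace exponent. -/
structure HasLaplaceExtension (μ : Measure CadlagPath) (ψ : ℝ → ℂ) (Ψ : ℂ → ℂ) (φ : ℝ → ℝ) :
    Prop where
  levy : IsLevyLaw μ
  finiteVariance : HasFiniteVariance μ
  charExponent : HasCharExponent μ ψ
  negativeJumps : HasNegativeJumps μ
  diffContOnCl : DiffContOnCl ℂ Ψ lowerHalf
  real : ∀ lam : ℝ, Ψ lam = ψ lam
  laplace : ∀ w : ℝ, 0 ≤ w → Ψ (-Complex.I * w) = φ w

lemma neg_I_mul_mem_lowerHalf {w : ℝ} (hw : 0 < w) : -Complex.I * (w : ℂ) ∈ lowerHalf := by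
  simpa [lowerHalf] using hw

namespace HasLaplaceExtension

variable {μ : Measure CadlagPath} {ψ : ℝ → ℂ} {Ψ : ℂ → ℂ} {φ : ℝ → ℝ}

lemma isProbabilityMeasure (H : HasLaplaceExtension μ ψ Ψ φ) :
    IsProbabilityMeasure (incrLaw μ 1) := H.levy.isProbabilityMeasure_incrLaw 1

lemma continuous (H : HasLaplaceExtension μ ψ Ψ φ) : Continuous ψ :=
  (H.charExponent.contDiff H.levy H.finiteVariance).continuous

lemma hasExpMoments (H : HasLaplaceExtension μ ψ Ψ φ) : HasExpMoments (incrLaw μ 1) :=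
  H.charExponent.hasExpMoments H.levy H.negativeJumps H.continuous ⟨one_pos, le_rfl⟩

lemma integrable_id (H : HasLaplaceExtension μ ψ Ψ φ) :
    Integrable (fun x : ℝ => x) (incrLaw μ 1) := by
  have := H.isProbabilityMeasure
  exact (H.finiteVariance.memLp_incrLaw 1).integrable (by norm_num)

lemma exp_eq (H : HasLaplaceExtension μ ψ Ψ φ) {z : ℂ} (hz : z.im ≤ 0) :
    Complex.exp (Ψ z) = charFunExt (incrLaw μ 1) z := by
  simpa using H.charExponent.exp_mul_eq_charFunExt H.levy H.negativeJumps H.continuous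
    H.diffContOnCl H.real (h := 1) ⟨one_pos, le_rfl⟩ hz

lemma firstMoment_eq (H : HasLaplaceExtension μ ψ Ψ φ) {z : ℂ} (hz : z ∈ lowerHalf) :
    firstMoment (incrLaw μ 1) z = -Complex.I * deriv Ψ z * Complex.exp (Ψ z) := by
  have h1 := (H.diffContOnCl.differentiableAt isOpen_lowerHalf hz).hasDerivAt.cexp
  have h2 : HasDerivAt (fun z => Complex.exp (Ψ z))
      (Complex.I * firstMoment (incrLaw μ 1) z) z := by
    refine (H.hasExpMoments.hasDerivAt_charFunExt hz).congr_of_eventuallyEq ?_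
    filter_upwards [isOpen_lowerHalf.mem_nhds hz] with y hy using H.exp_eq (le_of_lt hy)
  have h3 := h1.unique h2
  linear_combination Complex.I * h3 + firstMoment (incrLaw μ 1) z * Complex.I_sq

lemma deriv_extension (H : HasLaplaceExtension μ ψ Ψ φ) {z : ℂ} (hz : z ∈ lowerHalf) :
    deriv Ψ z = Complex.I * firstMoment (incrLaw μ 1) z * Complex.exp (-Ψ z) := by
  have h1 : Complex.exp (Ψ z) * Complex.exp (-Ψ z) = 1 := by rw [← Complex.exp_add]; simp
  rw [H.firstMoment_eq hz]
  linear_combination (-deriv Ψ z) * h1 + deriv Ψ z * Complex.exp (Ψ z) * Complex.exp (-Ψ z)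
    * Complex.I_sq

lemma deriv_exponent (H : HasLaplaceExtension μ ψ Ψ φ) (lam : ℝ) :
    deriv ψ lam = Complex.I * firstMoment (incrLaw μ 1) lam * Complex.exp (-ψ lam) := by
  have := H.isProbabilityMeasure
  have h0 : (fun x => Complex.exp (ψ x)) = charFun (incrLaw μ 1) := by
    ext x
    rw [H.charExponent.charFun_incrLaw one_pos]
    simp
  have h1 := (H.charExponent.hasDerivAt H.levy H.finiteVariance lam).cexp.deriv
  have h2 : deriv (charFun (incrLaw μ 1)) lam = Complex.I * firstMoment (incrLaw μ 1) lam := by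
    rw [← iteratedDeriv_one, iteratedDeriv_charFun
      (by exact_mod_cast (H.finiteVariance.memLp_incrLaw 1).mono_exponent (by norm_num)),
      firstMoment]
    simp only [pow_one]
    congr 2 with x
    congr 2
    ring
  rw [h0, h2] at h1
  have h3 : Complex.exp (ψ lam) * Complex.exp (-ψ lam) = 1 := by rw [← Complex.exp_add]; simp
  rw [h1]
  linear_combination (-deriv ψ lam) * h3

lemma exp_laplace (H : HasLaplaceExtension μ ψ Ψ φ) {w : ℝ} (hw : 0 ≤ w) :
    Real.exp (φ w) = ∫ x, Real.exp (w * x) ∂(incrLaw μ 1) := by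
  have h1 := H.exp_eq (z := -Complex.I * w) (by simpa using hw)
  rw [H.laplace w hw, charFunExt_neg_I_mul] at h1
  exact_mod_cast h1

lemma laplace_zero (H : HasLaplaceExtension μ ψ Ψ φ) : φ 0 = 0 := by
  have h1 := H.laplace 0 le_rfl
  have h2 := H.real 0
  rw [H.charExponent.zero H.levy] at h2
  simp only [Complex.ofReal_zero, mul_zero] at h1 h2
  rw [h2] at h1
  exact_mod_cast h1.symm

/-- The derivative of the Laplace exponent is the mean of the exponentially tilted increment. -/
lemma hasDerivAt_laplace (H : HasLaplaceExtension μ ψ Ψ φ) {w : ℝ} (hw : 0 < w) :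
    HasDerivAt φ (tiltedMean (incrLaw μ 1) w / Real.exp (φ w)) w ∧
      deriv Ψ (-Complex.I * w)
        = Complex.I * ((tiltedMean (incrLaw μ 1) w / Real.exp (φ w) : ℝ) : ℂ) := by
  have hz := neg_I_mul_mem_lowerHalf hw
  have h1 : deriv Ψ (-Complex.I * w)
      = Complex.I * ((tiltedMean (incrLaw μ 1) w / Real.exp (φ w) : ℝ) : ℂ) := by
    rw [H.deriv_extension hz, firstMoment_neg_I_mul, H.laplace w hw.le, Complex.exp_neg]
    push_cast
    ring
  refine ⟨?_, h1⟩
  have h2 : HasDerivAt (fun s : ℝ => -Complex.I * (s : ℂ)) (-Complex.I) w := by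
    simpa using (Complex.ofRealCLM.hasDerivAt (x := w)).const_mul (-Complex.I)
  have h3 := (H.diffContOnCl.differentiableAt isOpen_lowerHalf hz).hasDerivAt.comp w h2
  rw [h1] at h3
  have h4 := (Complex.reCLM.hasFDerivAt.comp_hasDerivAt w h3)
  refine (h4.congr_deriv ?_).congr_of_eventuallyEq ?_
  · have e : ∀ p : ℂ, Complex.I * p * -Complex.I = p := fun p => by
      linear_combination (-p) * Complex.I_sq
    rw [e, Complex.reCLM_apply, Complex.ofReal_re]
  · filter_upwards [Ioi_mem_nhds hw] with s hs
    have hs : 0 < s := hs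
    simp only [Function.comp_apply, Complex.reCLM_apply]
    rw [H.laplace s hs.le, Complex.ofReal_re]

lemma mul_mean_le_laplace (H : HasLaplaceExtension μ ψ Ψ φ) {w : ℝ} (hw : 0 ≤ w) :
    w * ∫ x, x ∂(incrLaw μ 1) ≤ φ w := by
  have := H.isProbabilityMeasure
  rw [← Real.exp_le_exp, H.exp_laplace hw]
  exact H.hasExpMoments.exp_mul_mean_le H.integrable_id hw

lemma laplace_le_mul_deriv (H : HasLaplaceExtension μ ψ Ψ φ) {w : ℝ} (hw : 0 ≤ w) :
    φ w ≤ w * (tiltedMean (incrLaw μ 1) w / Real.exp (φ w)) := by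
  have := H.isProbabilityMeasure
  rw [← Real.exp_le_exp]
  nth_rewrite 2 [H.exp_laplace hw]
  rw [H.exp_laplace hw]
  exact H.hasExpMoments.integral_exp_le H.integrable_id hw

lemma tendsto_laplace (H : HasLaplaceExtension μ ψ Ψ φ) :
    Tendsto φ (𝓝[>] 0) (𝓝 0) := by
  have hc := H.diffContOnCl.continuousOn
  rw [closure_lowerHalf] at hc
  have h1 : Tendsto (fun w : ℝ => Ψ (-Complex.I * w)) (𝓝[>] 0) (𝓝 (Ψ 0)) := by
    refine (hc 0 (by simp)).tendsto.comp (tendsto_nhdsWithin_iff.2 ⟨?_, ?_⟩)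
    · have : Continuous fun w : ℝ => -Complex.I * (w : ℂ) := by fun_prop
      simpa using (this.tendsto 0).mono_left nhdsWithin_le_nhds
    · filter_upwards [self_mem_nhdsWithin] with w hw
      simpa using (le_of_lt hw : (0 : ℝ) ≤ w)
  have h2 := (Complex.continuous_re.tendsto _).comp h1
  have h3 : Ψ 0 = 0 := by
    have h2 := H.real 0
    rwa [H.charExponent.zero H.levy, Complex.ofReal_zero] at h2
  rw [h3, Complex.zero_re] at h2
  refine h2.congr' ?_
  filter_upwards [self_mem_nhdsWithin] with w hw
  simp only [Function.comp_apply]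
  rw [H.laplace w (le_of_lt hw), Complex.ofReal_re]

/-- The slope of the Laplace exponent at the origin is the mean: both Jensen inequalities squeeze
the difference quotient. -/
lemma tendsto_laplace_div (H : HasLaplaceExtension μ ψ Ψ φ) :
    Tendsto (fun w => φ w / w) (𝓝[>] 0) (𝓝 (∫ x, x ∂(incrLaw μ 1))) := by
  have h1 : Tendsto (fun w => tiltedMean (incrLaw μ 1) w / Real.exp (φ w)) (𝓝[>] 0)
      (𝓝 (∫ x, x ∂(incrLaw μ 1))) := by
    have := (H.hasExpMoments.tendsto_tiltedMean H.integrable_id).div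
      ((Real.continuous_exp.tendsto 0).comp H.tendsto_laplace) (by simp)
    rwa [Real.exp_zero, div_one] at this
  refine tendsto_of_tendsto_of_tendsto_of_le_of_le' tendsto_const_nhds h1 ?_ ?_
  · filter_upwards [self_mem_nhdsWithin] with w hw
    have hw : 0 < w := hw
    rw [le_div_iff₀ hw, mul_comm]
    exact H.mul_mean_le_laplace hw.le
  · filter_upwards [self_mem_nhdsWithin] with w hw
    have hw : 0 < w := hw
    rw [div_le_iff₀ hw, mul_comm]
    exact H.laplace_le_mul_deriv hw.le

lemma hasDerivWithinAt_laplace_zero (H : HasLaplaceExtension μ ψ Ψ φ) :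
    HasDerivWithinAt φ (∫ x, x ∂(incrLaw μ 1)) (Ici 0) 0 := by
  rw [hasDerivWithinAt_iff_tendsto_slope, Ici_sdiff_left]
  refine H.tendsto_laplace_div.congr fun w => ?_
  rw [slope_def_field, H.laplace_zero]
  simp

end HasLaplaceExtension

/-! ### The evolution equation of the Laplace exponents -/

section

variable {μ : ℝ → Measure CadlagPath} {ψ : ℝ → ℝ → ℂ} {Ψ : ℝ → ℂ → ℂ} {φ : ℝ → ℝ → ℝ}

lemma isExtensionFamily_of_hasLaplaceExtension
    (H : ∀ t, 0 ≤ t → HasLaplaceExtension (μ t) (ψ t) (Ψ t) (φ t))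
    (hDiff : ∀ lam : ℝ, DifferentiableOn ℝ (fun t : ℝ => ψ t lam) (Ici 0))
    (hBdd : TimeDerivLocallyBounded ψ) : IsExtensionFamily Ψ ψ where
  diffContOnCl t ht := (H t ht).diffContOnCl
  real t ht := (H t ht).real
  bounded T R := by
    obtain ⟨B, hB⟩ := exists_norm_le_of_abs_le_two (H 0 le_rfl).continuous
    obtain ⟨C, hC0, hC⟩ := hBdd.exists_lipschitz hDiff T 2
    obtain ⟨K, _, hK⟩ := exists_norm_extension_le (B + C * T) (abs_nonneg R)
    refine ⟨K, fun t ht z hz hzR => hK (μ t) (ψ t) (Ψ t) (H t ht.1).levy (H t ht.1).charExponent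
      (H t ht.1).negativeJumps (H t ht.1).continuous (fun lam hlam => ?_) (H t ht.1).diffContOnCl
      (H t ht.1).real z hz (hzR.trans (le_abs_self R))⟩
    have h1 := hC t ht 0 ⟨le_rfl, ht.1.trans ht.2⟩ lam hlam
    rw [sub_zero, abs_of_nonneg ht.1] at h1
    have h2 : ‖ψ t lam‖ ≤ ‖ψ t lam - ψ 0 lam‖ + ‖ψ 0 lam‖ := by
      simpa using norm_add_le (ψ t lam - ψ 0 lam) (ψ 0 lam)
    have h3 := hB lam hlam
    have h4 : C * t ≤ C * T := mul_le_mul_of_nonneg_left ht.2 hC0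
    linarith
  lipschitz T R := hBdd.exists_lipschitz hDiff T R

lemma HasLaplaceExtension.burgersFlux_eq {μ : Measure CadlagPath} {ψ : ℝ → ℂ} {Ψ : ℂ → ℂ}
    {φ : ℝ → ℝ} (H : HasLaplaceExtension μ ψ Ψ φ) {w : ℝ} (hw : 0 < w) :
    burgersFlux Ψ (-Complex.I * w)
      = ((-(φ w * derivWithin φ (Ici 0) w) + w ^ 2 / 2 : ℝ) : ℂ) := by
  obtain ⟨h1, h2⟩ := H.hasDerivAt_laplace hw
  rw [burgersFlux, h2, H.laplace w hw.le, (h1.hasDerivWithinAt (s := Ici 0)).derivWithin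
    (uniqueDiffOn_Ici 0 w hw.le)]
  push_cast
  linear_combination ((φ w : ℂ) * (tiltedMean (incrLaw μ 1) w / Complex.exp (φ w))
    - (w : ℂ) ^ 2 / 2) * Complex.I_sq

/-- The equation is restricted from the lower half-plane to the negative imaginary axis. At `w = 0`
it reduces to `φ(t, 0) = 0`, apart from the existence of the one-sided derivative in `w`. -/
lemma solvesLaplaceExponentEq_of_solvesCharExponentEq
    (H : ∀ t, 0 ≤ t → HasLaplaceExtension (μ t) (ψ t) (Ψ t) (φ t))
    (hDiff : ∀ lam : ℝ, DifferentiableOn ℝ (fun t : ℝ => ψ t lam) (Ici 0))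
    (hBdd : TimeDerivLocallyBounded ψ) (hsol : SolvesCharExponentEq ψ) :
    SolvesLaplaceExponentEq φ := by
  have hΨ := isExtensionFamily_of_hasLaplaceExtension H hDiff hBdd
  intro t ht w hw
  rcases eq_or_lt_of_le hw with rfl | hw0
  · refine ⟨(H t ht).hasDerivWithinAt_laplace_zero.differentiableWithinAt, ?_⟩
    rw [(H t ht).laplace_zero]
    refine ((hasDerivWithinAt_const t (Ici 0) (0 : ℝ)).congr
      (fun s hs => (H s hs).laplace_zero) (H t ht).laplace_zero).congr_deriv ?_
    simp
  · refine ⟨((H t ht).hasDerivAt_laplace hw0).1.differentiableAt.differentiableWithinAt, ?_⟩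
    have h1 := hΨ.hasDerivWithinAt_of_solves hDiff hBdd hsol (neg_I_mul_mem_lowerHalf hw0) ht
    rw [(H t ht).burgersFlux_eq hw0] at h1
    have h2 := Complex.reCLM.hasFDerivAt.comp_hasDerivWithinAt t h1
    refine (h2.congr_deriv (by rw [Complex.reCLM_apply, Complex.ofReal_re])).congr
      (fun s hs => ?_) ?_
    · simp only [Function.comp_apply, Complex.reCLM_apply]
      rw [(H s hs).laplace w hw, Complex.ofReal_re]
    · simp only [Function.comp_apply, Complex.reCLM_apply]
      rw [(H t ht).laplace w hw, Complex.ofReal_re]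

/-- The evolution equation of the Laplace exponents prevents the mean from dropping suddenly: the
ratio `r = φ / w` satisfies `∂ₜ r = -r ∂_w φ + w / 2`, with `r ≤ ∂_w φ` bounded above near `w = 0`,
and hence has a lower barrier of finite slope that does not depend on `w`. -/
lemma exists_mean_ge (H : ∀ t, 0 ≤ t → HasLaplaceExtension (μ t) (ψ t) (Ψ t) (φ t))
    (hΨ : IsExtensionFamily Ψ ψ) (hφ : SolvesLaplaceExponentEq φ) {t₀ : ℝ} (ht₀ : 0 ≤ t₀) :
    ∃ K δ : ℝ, 0 < δ ∧ ∀ t ∈ Icc t₀ (t₀ + δ),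
      (∫ x, x ∂(incrLaw (μ t₀) 1)) - K * (t - t₀) ≤ ∫ x, x ∂(incrLaw (μ t) 1) := by
  obtain ⟨C, hC⟩ := hΨ.bounded (t₀ + 1) 2
  have hφC : ∀ t ∈ Icc 0 (t₀ + 1), ∀ w ∈ Icc (0 : ℝ) 2, |φ t w| ≤ C := by
    intro t ht w hw
    have h1 := hC t ht (-Complex.I * w) (by simpa using hw.1) (by
      simpa [abs_of_nonneg hw.1] using hw.2)
    rw [(H t ht.1).laplace w hw.1] at h1
    simpa using h1
  set m := ∫ x, x ∂(incrLaw (μ t₀) 1) with hm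
  -- `L` bounds `∂_w φ` from above, and `-L` stays below the barrier during a time `1 / (L² + 1)`
  set L := Real.exp (C + C) + |m| + 1 with hL
  have hp : ∀ t ∈ Icc 0 (t₀ + 1), ∀ w ∈ Icc (0 : ℝ) 1,
      tiltedMean (incrLaw (μ t) 1) w / Real.exp (φ t w) ≤ L := by
    intro t ht w hw
    have h1 := (H t ht.1).hasExpMoments.tiltedMean_le (H t ht.1).integrable_id hw
    rw [← (H t ht.1).exp_laplace (by norm_num)] at h1
    have h2 := (abs_le.1 (hφC t ht w ⟨hw.1, by linarith [hw.2]⟩)).1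
    have h3 := (abs_le.1 (hφC t ht 2 ⟨by norm_num, le_rfl⟩)).2
    have h4 : Real.exp (φ t 2) ≤ Real.exp (C + C) * Real.exp (φ t w) := by
      rw [← Real.exp_add, Real.exp_le_exp]; linarith
    rw [div_le_iff₀ (Real.exp_pos _)]
    have h5 : Real.exp (C + C) * Real.exp (φ t w) ≤ L * Real.exp (φ t w) :=
      mul_le_mul_of_nonneg_right (by linarith [abs_nonneg m]) (Real.exp_pos _).le
    linarith
  have hL1 : 1 ≤ L := by linarith [abs_nonneg m, Real.exp_pos (C + C)]
  have hmL : -L ≤ m - 1 := by linarith [neg_abs_le m, Real.exp_pos (C + C)]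
  have hδ1 : 1 / (L ^ 2 + 1) ≤ 1 := by
    rw [div_le_one (by positivity)]; nlinarith
  have key : ∀ w ∈ Ioc (0 : ℝ) 1, ∀ t ∈ Icc t₀ (t₀ + 1 / (L ^ 2 + 1)),
      -(φ t w / w) ≤ -m + (L ^ 2 + 1) * (t - t₀) := by
    intro w hw
    have hder : ∀ t, 0 ≤ t → HasDerivWithinAt (fun t => -(φ t w / w))
        (-((-(φ t w * (tiltedMean (incrLaw (μ t) 1) w / Real.exp (φ t w))) + w ^ 2 / 2) / w))
        (Ici 0) t := by
      intro t ht
      have h1 := (hφ t ht w hw.1.le).2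
      rw [(((H t ht).hasDerivAt_laplace hw.1).1.hasDerivWithinAt (s := Ici 0)).derivWithin
        (uniqueDiffOn_Ici 0 w hw.1.le)] at h1
      exact (h1.div_const w).fun_neg
    refine image_le_of_deriv_right_lt_deriv_boundary
      (f := fun t => -(φ t w / w)) (B := fun t => -m + (L ^ 2 + 1) * (t - t₀))
      (B' := fun _ => L ^ 2 + 1)
      (fun t ht => (hder t (ht₀.trans ht.1)).continuousWithinAt.mono
        fun s hs => mem_Ici.2 (ht₀.trans hs.1))
      (fun t ht => (hder t (ht₀.trans ht.1)).mono
        fun s hs => mem_Ici.2 ((ht₀.trans ht.1).trans hs)) ?_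
      (fun t => by
        simpa using (((hasDerivAt_id t).sub_const t₀).const_mul (L ^ 2 + 1)).const_add (-m)) ?_
    · have h1 := (H t₀ ht₀).mul_mean_le_laplace hw.1.le
      simp only [sub_self, mul_zero, add_zero]
      rw [neg_le_neg_iff, le_div_iff₀ hw.1, mul_comm]
      exact h1
    · intro t ht heq
      have ht0 : 0 ≤ t := ht₀.trans ht.1
      have htT : t ∈ Icc 0 (t₀ + 1) := ⟨ht0, by linarith [ht.2]⟩
      set p := tiltedMean (incrLaw (μ t) 1) w / Real.exp (φ t w) with hpdef
      have h1 : p ≤ L := hp t htT w ⟨hw.1.le, hw.2⟩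
      have h2 : φ t w / w ≤ p := by
        rw [div_le_iff₀ hw.1, mul_comm]
        exact (H t ht0).laplace_le_mul_deriv hw.1.le
      have h3 : (L ^ 2 + 1) * (t - t₀) ≤ 1 := by
        have := ht.2.le
        rw [← le_div_iff₀' (by positivity)]
        linarith
      set r := φ t w / w with hr
      have h4 : -L ≤ r := by linarith
      have e : -((-(φ t w * p) + w ^ 2 / 2) / w) = r * p - w / 2 := by
        have := hw.1.ne'
        rw [hr]; field_simp; ring
      rw [e]
      -- when the barrier is met, `-L ≤ r ≤ p ≤ L`
      have h5 : r * p ≤ L ^ 2 := by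
        rcases le_or_gt 0 p with h | h
        · nlinarith
        · nlinarith
      linarith [hw.1]
  refine ⟨L ^ 2 + 1, 1 / (L ^ 2 + 1), by positivity, fun t ht => ?_⟩
  refine ge_of_tendsto (H t (ht₀.trans ht.1)).tendsto_laplace_div ?_
  filter_upwards [Ioc_mem_nhdsGT (zero_lt_one' ℝ)] with w hw
  linarith [key w hw t ht]

end

/-! ### From Laplace exponents back to characteristic exponents -/

lemma sub_I_mul_mem_lowerHalf (x : ℝ) {ε : ℝ} (hε : 0 < ε) :
    (x : ℂ) - Complex.I * ε ∈ lowerHalf := by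
  simpa [lowerHalf] using hε

section

variable {μ : ℝ → Measure CadlagPath} {ψ : ℝ → ℝ → ℂ} {Ψ : ℝ → ℂ → ℂ} {φ : ℝ → ℝ → ℝ}

/-- The evolution equation on the negative imaginary axis holds in the whole lower half-plane, by
analytic continuation of its integrated form. -/
lemma sub_eq_integral_burgersFlux (H : ∀ t, 0 ≤ t → HasLaplaceExtension (μ t) (ψ t) (Ψ t) (φ t))
    (hΨ : IsExtensionFamily Ψ ψ) (hφ : SolvesLaplaceExponentEq φ) {a b : ℝ} (ha : 0 ≤ a)
    (hab : a ≤ b) {z : ℂ} (hz : z ∈ lowerHalf) :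
    Ψ b z - Ψ a z = ∫ t in a..b, burgersFlux (Ψ t) z := by
  have hsub : Icc a b ⊆ Ici 0 := fun t ht => ha.trans ht.1
  obtain ⟨hJ, hJ'⟩ := hΨ.fluxPrimitive_spec ha hab
  have hax : ∀ w : ℝ, 0 < w → Ψ b (-Complex.I * w) - Ψ a (-Complex.I * w)
      = ∫ t in a..b, burgersFlux (Ψ t) (-Complex.I * w) := by
    intro w hw
    have hzw := neg_I_mul_mem_lowerHalf hw
    have hder : ∀ t, 0 ≤ t → HasDerivWithinAt (fun s => Ψ s (-Complex.I * w))
        (burgersFlux (Ψ t) (-Complex.I * w)) (Ici 0) t := by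
      intro t ht
      rw [(H t ht).burgersFlux_eq hw]
      exact (hφ t ht w hw.le).2.ofReal_comp.congr (fun s hs => (H s hs).laplace w hw.le)
        ((H t ht).laplace w hw.le)
    refine (intervalIntegral.integral_eq_sub_of_hasDeriv_right_of_le hab
      (fun t ht => ((hder t (hsub ht)).continuousWithinAt.mono hsub))
      (fun t ht => (hder t (ha.trans ht.1.le)).mono fun s hs =>
        mem_Ici.2 (ha.trans (ht.1.trans hs).le)) ?_).symm
    refine ContinuousOn.intervalIntegrable ?_
    rw [uIcc_of_le hab]
    exact (hΨ.continuousOn_burgersFlux hzw).mono hsub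
  have h1 : AnalyticOnNhd ℂ (fun z => Ψ b z - Ψ a z) lowerHalf :=
    (((hΨ.diffContOnCl b (ha.trans hab)).sub (hΨ.diffContOnCl a ha)).1).analyticOnNhd
      isOpen_lowerHalf
  have h2 : AnalyticOnNhd ℂ (deriv (fluxPrimitive Ψ a b)) lowerHalf :=
    (hJ.1.deriv isOpen_lowerHalf).analyticOnNhd isOpen_lowerHalf
  have hlim : Tendsto (fun w : ℝ => -Complex.I * (w : ℂ)) (𝓝[>] 1) (𝓝[≠] (-Complex.I)) := by
    refine tendsto_nhdsWithin_iff.2 ⟨?_, ?_⟩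
    · have : Continuous fun w : ℝ => -Complex.I * (w : ℂ) := by fun_prop
      simpa using (this.tendsto 1).mono_left nhdsWithin_le_nhds
    · filter_upwards [self_mem_nhdsWithin] with w hw hw'
      have h3 := congrArg Complex.im hw'
      have hw : 1 < w := hw
      simp at h3
      linarith
  have h3 : ∃ᶠ y in 𝓝[≠] (-Complex.I),
      Ψ b y - Ψ a y = deriv (fluxPrimitive Ψ a b) y := by
    refine hlim.frequently (Eventually.frequently ?_)
    filter_upwards [self_mem_nhdsWithin] with w hw
    have hw0 : 0 < w := zero_lt_one.trans hw
    rw [hax w hw0, (hJ' _ (neg_I_mul_mem_lowerHalf hw0)).deriv]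
  have hmem : -Complex.I ∈ lowerHalf := by simp [lowerHalf]
  rw [← (hJ' z hz).deriv]
  exact h1.eqOn_of_preconnected_of_frequently_eq h2
    (convex_halfSpace_im_lt 0).isPreconnected hmem h3 hz

/-- Right-continuity in time of the first moment, jointly with vertical approach to the real axis.
The contribution of the boundary layer is controlled by the tilted means, which converge away from
the axis, and by the means, which do not drop. -/
lemma tendsto_firstMoment_prod (H : ∀ t, 0 ≤ t → HasLaplaceExtension (μ t) (ψ t) (Ψ t) (φ t))
    (hΨ : IsExtensionFamily Ψ ψ) (hφ : SolvesLaplaceExponentEq φ) {t₀ : ℝ} (ht₀ : 0 ≤ t₀)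
    (lam : ℝ) :
    Tendsto (fun q : ℝ × ℝ => firstMoment (incrLaw (μ q.1) 1) (lam - Complex.I * q.2))
      (𝓝[≥] t₀ ×ˢ 𝓝[>] 0) (𝓝 (firstMoment (incrLaw (μ t₀) 1) lam)) := by
  have hle : 𝓝[≥] t₀ ≤ 𝓝[Ici 0] t₀ := nhdsWithin_mono _ (Ici_subset_Ici.2 ht₀)
  have hfix : ∀ z ∈ lowerHalf, Tendsto (fun t => firstMoment (incrLaw (μ t) 1) z) (𝓝[≥] t₀)
      (𝓝 (firstMoment (incrLaw (μ t₀) 1) z)) := by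
    intro z hz
    have h1 : ContinuousOn (fun t => -Complex.I * deriv (Ψ t) z * Complex.exp (Ψ t z)) (Ici 0) :=
      (continuousOn_const.mul (hΨ.continuousOn_deriv hz)).mul
        (continuousOn_left_of_prod hΨ.continuousOn_prod (le_of_lt hz)).cexp
    have h2 : ContinuousOn (fun t => firstMoment (incrLaw (μ t) 1) z) (Ici 0) :=
      h1.congr fun t ht => (H t ht).firstMoment_eq hz
    exact (h2 t₀ ht₀).tendsto.mono_left hle
  rw [Metric.tendsto_nhds]
  intro η hη
  have hη5 : 0 < η / 6 := by positivity
  have hm0 := (H t₀ ht₀).hasExpMoments.tendsto_tiltedMean (H t₀ ht₀).integrable_id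
  have hf0 := (H t₀ ht₀).hasExpMoments.tendsto_firstMoment (H t₀ ht₀).integrable_id
    (z := (lam : ℂ)) (by simp)
  -- `ε₀` is the height of the boundary layer, chosen at time `t₀`
  obtain ⟨ε₀, ⟨h1, h2⟩, h3⟩ := ((Metric.tendsto_nhds.1 hm0 _ hη5).and
    (Metric.tendsto_nhds.1 hf0 _ hη5)).and self_mem_nhdsWithin |>.exists
  have hε₀ : 0 < ε₀ := h3
  have h4 := Metric.tendsto_nhds.1 (hfix _ (sub_I_mul_mem_lowerHalf lam hε₀)) _ hη5
  have h5 := Metric.tendsto_nhds.1 (hfix _ (neg_I_mul_mem_lowerHalf hε₀)) _ hη5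
  simp only [firstMoment_neg_I_mul] at h5
  obtain ⟨K, δ, hδ, hK⟩ := exists_mean_ge H hΨ hφ ht₀
  have h6 : ∀ᶠ t in 𝓝[≥] t₀, (∫ x, x ∂(incrLaw (μ t₀) 1)) - η / 6 < ∫ x, x ∂(incrLaw (μ t) 1) := by
    have h7 : Tendsto (fun t => K * (t - t₀)) (𝓝[≥] t₀) (𝓝 0) := by
      have : Continuous fun t => K * (t - t₀) := by fun_prop
      simpa using (this.tendsto t₀).mono_left nhdsWithin_le_nhds
    filter_upwards [h7.eventually (Iio_mem_nhds hη5), Icc_mem_nhdsGE (lt_add_of_pos_right t₀ hδ)]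
      with t ht ht'
    have := hK t ht'
    have ht : K * (t - t₀) < η / 6 := ht
    linarith
  have h8 : ∀ᶠ ε in 𝓝[>] (0 : ℝ), ε ∈ Ioc 0 ε₀ := Ioc_mem_nhdsGT hε₀
  filter_upwards [((h4.and h5).and (h6.and self_mem_nhdsWithin)).prod_mk h8] with q hq
  obtain ⟨⟨⟨g4, g5⟩, g6, g7⟩, g8⟩ := hq
  have hq0 : 0 ≤ q.1 := ht₀.trans g7
  have g9 := (H q.1 hq0).hasExpMoments.norm_firstMoment_sub_le (H q.1 hq0).integrable_id lam
    g8.1.le g8.2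
  rw [dist_eq_norm, ← Complex.ofReal_sub, Complex.norm_real, Real.norm_eq_abs] at g5
  rw [Real.dist_eq] at h1
  have g1 := (abs_lt.1 h1).2
  have g5 := (abs_lt.1 g5).2
  rw [← dist_eq_norm] at g9
  have t1 := dist_triangle4 (firstMoment (incrLaw (μ q.1) 1) (lam - Complex.I * q.2))
    (firstMoment (incrLaw (μ q.1) 1) (lam - Complex.I * ε₀))
    (firstMoment (incrLaw (μ t₀) 1) (lam - Complex.I * ε₀)) (firstMoment (incrLaw (μ t₀) 1) lam)
  linarith

/-- Right-continuity in time of the right-hand side of the equation, jointly with vertical approach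
to the real axis. -/
lemma tendsto_burgersFlux_prod (H : ∀ t, 0 ≤ t → HasLaplaceExtension (μ t) (ψ t) (Ψ t) (φ t))
    (hΨ : IsExtensionFamily Ψ ψ) (hφ : SolvesLaplaceExponentEq φ) {t₀ : ℝ} (ht₀ : 0 ≤ t₀)
    (lam : ℝ) :
    Tendsto (fun q : ℝ × ℝ => burgersFlux (Ψ q.1) (lam - Complex.I * q.2))
      (𝓝[≥] t₀ ×ˢ 𝓝[>] 0)
      (𝓝 (Complex.I * deriv (ψ t₀) lam * ψ t₀ lam - ((lam ^ 2 / 2 : ℝ) : ℂ))) := by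
  have hz : Tendsto (fun q : ℝ × ℝ => (lam : ℂ) - Complex.I * q.2) (𝓝[≥] t₀ ×ˢ 𝓝[>] 0)
      (𝓝 (lam : ℂ)) := by
    have : Continuous fun q : ℝ × ℝ => (lam : ℂ) - Complex.I * q.2 := by fun_prop
    have h := (this.tendsto (t₀, 0)).mono_left
      (nhds_prod_eq (x := t₀) (y := (0 : ℝ)) ▸
        Filter.prod_mono nhdsWithin_le_nhds nhdsWithin_le_nhds :
        𝓝[≥] t₀ ×ˢ 𝓝[>] (0 : ℝ) ≤ 𝓝 (t₀, 0))
    simpa using h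
  have hmem : ∀ᶠ q : ℝ × ℝ in 𝓝[≥] t₀ ×ˢ 𝓝[>] 0, t₀ ≤ q.1 ∧ 0 < q.2 :=
    Eventually.prod_mk (pa := fun t => t₀ ≤ t) (pb := fun ε => 0 < ε)
      self_mem_nhdsWithin self_mem_nhdsWithin
  have hval : Tendsto (fun q : ℝ × ℝ => Ψ q.1 (lam - Complex.I * q.2)) (𝓝[≥] t₀ ×ˢ 𝓝[>] 0)
      (𝓝 (ψ t₀ lam)) := by
    rw [← (H t₀ ht₀).real lam]
    refine (hΨ.continuousOn_prod (t₀, (lam : ℂ)) ⟨ht₀, by simp⟩).tendsto.comp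
      (f := fun q : ℝ × ℝ => (q.1, (lam : ℂ) - Complex.I * q.2)) ?_
    refine tendsto_nhdsWithin_iff.2 ⟨?_, ?_⟩
    · rw [nhds_prod_eq]
      exact (tendsto_fst.mono_right nhdsWithin_le_nhds).prodMk hz
    · filter_upwards [hmem] with q hq
      exact ⟨ht₀.trans hq.1, by simpa using hq.2.le⟩
  have h1 := ((hval.const_mul Complex.I).mul (((tendsto_firstMoment_prod H hΨ hφ ht₀ lam).const_mul
    Complex.I).mul hval.neg.cexp)).sub ((hz.pow 2).div_const 2)
  have e : Complex.I * deriv (ψ t₀) lam * ψ t₀ lam - ((lam ^ 2 / 2 : ℝ) : ℂ)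
      = Complex.I * ψ t₀ lam * (Complex.I * firstMoment (incrLaw (μ t₀) 1) lam
        * Complex.exp (-ψ t₀ lam)) - (lam : ℂ) ^ 2 / 2 := by
    rw [(H t₀ ht₀).deriv_exponent lam]
    push_cast
    ring
  rw [e]
  refine h1.congr' ?_
  filter_upwards [hmem] with q hq
  rw [burgersFlux, (H q.1 (ht₀.trans hq.1)).deriv_extension (sub_I_mul_mem_lowerHalf lam hq.2)]

/-- The integrated equation on a short time interval, taken at a point slightly below the real axis,
has an almost constant integrand; the point is then moved to the axis. -/
lemma solvesCharExponentEq_of_solvesLaplaceExponentEq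
    (H : ∀ t, 0 ≤ t → HasLaplaceExtension (μ t) (ψ t) (Ψ t) (φ t))
    (hDiff : ∀ lam : ℝ, DifferentiableOn ℝ (fun t : ℝ => ψ t lam) (Ici 0))
    (hBdd : TimeDerivLocallyBounded ψ) (hφ : SolvesLaplaceExponentEq φ) :
    SolvesCharExponentEq ψ := by
  have hΨ := isExtensionFamily_of_hasLaplaceExtension H hDiff hBdd
  intro t₀ ht₀ lam
  refine ⟨((H t₀ ht₀).charExponent.hasDerivAt (H t₀ ht₀).levy
    (H t₀ ht₀).finiteVariance lam).differentiableAt, ?_⟩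
  set g := Complex.I * deriv (ψ t₀) lam * ψ t₀ lam - ((lam ^ 2 / 2 : ℝ) : ℂ) with hg
  -- as the time derivative exists, it is enough to compute the right derivative
  have hright : HasDerivWithinAt (fun s => ψ s lam) g (Ici t₀) t₀ := by
    rw [hasDerivWithinAt_iff_isLittleO, Asymptotics.isLittleO_iff]
    intro c hc
    have h1 := Metric.tendsto_nhds.1 (tendsto_burgersFlux_prod H hΨ hφ ht₀ lam) c hc
    obtain ⟨pa, hpa, pb, hpb, hab⟩ := eventually_prod_iff.1 h1
    obtain ⟨u, hu, hua⟩ := mem_nhdsGE_iff_exists_Ico_subset.1 hpa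
    have hu : t₀ < u := hu
    filter_upwards [Ico_mem_nhdsGE hu] with s hs
    have hs0 : 0 ≤ s := ht₀.trans hs.1
    have hlim : ∀ t, 0 ≤ t → Tendsto (fun ε : ℝ => Ψ t (lam - Complex.I * ε)) (𝓝[>] 0)
        (𝓝 (ψ t lam)) := by
      intro t ht
      have hc := (H t ht).diffContOnCl.continuousOn
      rw [closure_lowerHalf] at hc
      rw [← (H t ht).real lam]
      refine (hc lam (by simp)).tendsto.comp (tendsto_nhdsWithin_iff.2 ⟨?_, ?_⟩)
      · have : Continuous fun ε : ℝ => (lam : ℂ) - Complex.I * ε := by fun_prop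
        simpa using (this.tendsto 0).mono_left nhdsWithin_le_nhds
      · filter_upwards [self_mem_nhdsWithin] with ε hε
        exact le_of_lt (sub_I_mul_mem_lowerHalf lam hε)
    refine le_of_tendsto (((hlim s hs0).sub (hlim t₀ ht₀)).sub_const ((s - t₀) • g)).norm ?_
    filter_upwards [hpb, self_mem_nhdsWithin] with ε hε hε0
    have hz := sub_I_mul_mem_lowerHalf lam hε0
    have hint : IntervalIntegrable (fun t => burgersFlux (Ψ t) (lam - Complex.I * ε))
        volume t₀ s := by
      refine ContinuousOn.intervalIntegrable ?_
      rw [uIcc_of_le hs.1]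
      exact (hΨ.continuousOn_burgersFlux hz).mono fun t ht => ht₀.trans ht.1
    rw [sub_eq_integral_burgersFlux H hΨ hφ ht₀ hs.1 hz, ← intervalIntegral.integral_const,
      ← intervalIntegral.integral_sub hint intervalIntegrable_const, Real.norm_eq_abs]
    refine intervalIntegral.norm_integral_le_of_norm_le_const fun t ht => ?_
    rw [uIoc_of_le hs.1] at ht
    rw [← dist_eq_norm]
    exact (hab (hua ⟨ht.1.le, ht.2.trans_lt hs.2⟩) hε).le
  have h1 := hasDerivWithinAt_timeDeriv hDiff ht₀ lam
  have h2 := (uniqueDiffWithinAt_Ici t₀).eq_deriv _ (h1.mono (Ici_subset_Ici.2 ht₀)) hright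
  rwa [h2] at h1

end

end LevyBurgers

end

theorem mainTheorem1
    (ψ : ℝ → ℝ → ℂ) (μ : ℝ → MeasureTheory.Measure LevyBurgers.CadlagPath)
    (hLevy : ∀ t : ℝ, 0 ≤ t → LevyBurgers.IsLevyLaw (μ t))
    (hVar : ∀ t : ℝ, 0 ≤ t → LevyBurgers.HasFiniteVariance (μ t))
    (hExp : ∀ t : ℝ, 0 ≤ t → LevyBurgers.HasCharExponent (μ t) (ψ t))
    (hDiff : ∀ lam : ℝ, DifferentiableOn ℝ (fun t : ℝ => ψ t lam) (Set.Ici 0))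
    (hBdd : LevyBurgers.TimeDerivLocallyBounded ψ) :
    (LevyBurgers.IsIntrinsicStatisticalSolution μ ↔ LevyBurgers.SolvesCharExponentEq ψ) ∧
    ((∀ t : ℝ, 0 ≤ t → LevyBurgers.HasNegativeJumps (μ t)) →
      (∃ φ : ℝ → ℝ → ℝ, ∀ t : ℝ, 0 ≤ t → LevyBurgers.IsLaplaceExponent (ψ t) (φ t)) ∧
      ∀ φ : ℝ → ℝ → ℝ, (∀ t : ℝ, 0 ≤ t → LevyBurgers.IsLaplaceExponent (ψ t) (φ t)) →
        (LevyBurgers.SolvesCharExponentEq ψ ↔ LevyBurgers.SolvesLaplaceExponentEq φ)) := by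
  refine ⟨LevyBurgers.isIntrinsicStatisticalSolution_iff ψ μ hLevy hVar hExp hDiff hBdd,
    fun hNeg => ⟨?_, fun φ hφ => ?_⟩⟩
  · have hex : ∀ t : ℝ, ∃ φ : ℝ → ℝ, 0 ≤ t → LevyBurgers.IsLaplaceExponent (ψ t) φ := by
      intro t
      by_cases ht : 0 ≤ t
      · obtain ⟨Ψ, h1, h2, h3⟩ := (hExp t ht).exists_extension (hLevy t ht) (hNeg t ht)
          ((hExp t ht).contDiff (hLevy t ht) (hVar t ht)).continuous fun R =>
            ((hExp t ht).eventually_log_charFun (hLevy t ht) R).mono fun h hh lam hlam =>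
              (hh lam hlam).2
        exact ⟨fun w => (Ψ (-Complex.I * w)).re, fun _ => ⟨Ψ, h1, h2, fun w hw =>
          Complex.ext (Complex.ofReal_re _).symm ((h3 w hw).trans (Complex.ofReal_im _).symm)⟩⟩
      · exact ⟨0, fun h => absurd h ht⟩
    choose φ hφ using hex
    exact ⟨φ, hφ⟩
  · have hex : ∀ t : ℝ, ∃ Ψ : ℂ → ℂ, 0 ≤ t →
        LevyBurgers.HasLaplaceExtension (μ t) (ψ t) Ψ (φ t) := by
      intro t
      by_cases ht : 0 ≤ t
      · obtain ⟨Ψ, h1, h2, h3⟩ := hφ t ht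
        exact ⟨Ψ, fun _ => ⟨hLevy t ht, hVar t ht, hExp t ht, hNeg t ht, h1, h2, h3⟩⟩
      · exact ⟨0, fun h => absurd h ht⟩
    choose Ψ H using hex
    exact ⟨LevyBurgers.solvesLaplaceExponentEq_of_solvesCharExponentEq H hDiff hBdd,
      LevyBurgers.solvesCharExponentEq_of_solvesLaplaceExponentEq H hDiff hBdd⟩
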